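/- Fix an integer $r\ge 1$ and put $R=(r^2+r)/2$. For $A\in\mathbb{R}^{r\times n}$ with columns $a_1,\dots,a_n\in\mathbb{R}^r$ such that the covariance matrix $A^\top A$ has rank $r$, and for integers $1\le d\le s\le n$, consider row-sparse sparse principal component analysis $$\text{(SPCA)}\qquad \max_{U\in\mathbb{R}^{n\times d}}\bigl\{\|AU\|_F^2:\ U^\top U=I_d,\ \|U\|_0\le s\bigr\},$$ where $\|U\|_0$ is the number of nonzero rows of $U$, together with its reformulation over the permutation-invariant binary set $\{x\in\{0,1\}^n:\sum_i x_i\le s\}$, $$\text{(B)}\qquad \max_{x\in\{0,1\}^n}\Bigl\{\Bigl\|\sum_{i=1}^n x_i\,a_ia_i^\top\Bigr\|_{(d)}:\ \sum_{i=1}^n x_i\le s\Bigr\},$$ where $\|X\|_{(d)}$ (the Ky Fan $d$-norm) is the sum of the $d$ largest eigenvalues of the symmetric matrix $X$, counted with multiplicity (of all of them if $d$ exceeds the order of $X$). A set $S\subseteq\{1,\dots,n\}$ with $|S|\le s$ is called an optimal support if some optimal solution $U$ of (SPCA) has all its nonzero rows in $S$. Running times are measured on a random access machine with exact real numbers: arithmetic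 operations on and comparisons of reals, additions, subtractions and comparisons of natural numbers, and memory accesses (with computed addresses) have unit cost, and the $m$ largest eigenvalues of a symmetric $k\times k$ matrix together with corresponding orthonormal eigenvectors ($m\le k$) are available at cost $m k^2$. Programs and constants hidden in $\mathcal{O}(\cdot)$ may depend on $r$ only. Then: 1. (SPCA) and (B) both attain their maxima, and the two optimal values are equal. 2. There is a collection of $\mathcal{O}(n^{R})$ candidate supports, each given as an explicit list, among which at least one is an optimal support. More precisely, there is a program that, given $n,s,A$ (but not $d$), and without using the eigenvalue operation, lists $\mathcal{O}(n^{R})$ subsets of $\{1,\dots,n\}$ in $\mathcal{O}(n^{R}s^2)$ time such that, for every $1\le d\le s$, at least one listed set is an optimal support for (SPCA) and its incidence vector is optimal for (B). 3. (SPCA) can be solved in $\mathcal{O}(n^{R}\cdot d s^2)$ time: there is a program that, given $n,d,s,A$, computes an optimal solution $U$ of (SPCA) within this time, whatever admissible eigenvectors the eigenvalue operation returns. -/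

import Mathlib

open scoped Matrix

/-! ## Row-sparse principal component analysis -/

/-- The set of indices of the nonzero rows of `U`. -/
noncomputable def rowSupport {n d : ℕ} (U : Matrix (Fin n) (Fin d) ℝ) : Finset (Fin n) :=
  open Classical in Finset.univ.filter (fun i => ∃ j, U i j ≠ 0)

/-- `U` has orthonormal columns and at most `s` nonzero rows. -/
def SPCAFeasible {n : ℕ} (d s : ℕ) (U : Matrix (Fin n) (Fin d) ℝ) : Prop :=
  Uᵀ * U = 1 ∧ (rowSupport U).card ≤ s

/-- The squared Frobenius norm of `A * U`. -/
def spcaObjective {r n d : ℕ} (A : Matrix (Fin r) (Fin n) ℝ) (U : Matrix (Fin n) (Fin d) ℝ) : ℝ :=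
  ∑ i, ∑ j, ((A * U) i j) ^ 2

/-- `U` is an optimal solution of row-sparse SPCA. -/
def SPCAOptimal {r n d : ℕ} (A : Matrix (Fin r) (Fin n) ℝ) (s : ℕ)
    (U : Matrix (Fin n) (Fin d) ℝ) : Prop :=
  SPCAFeasible d s U ∧ ∀ V : Matrix (Fin n) (Fin d) ℝ, SPCAFeasible d s V →
    spcaObjective A V ≤ spcaObjective A U

/-- `S` is an admissible choice of at most `s` rows (features), and some globally optimal
solution uses only rows of `S`. -/
def SPCAOptimalSupport {r n : ℕ} (A : Matrix (Fin r) (Fin n) ℝ) (d s : ℕ)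
    (S : Finset (Fin n)) : Prop :=
  S.card ≤ s ∧ ∃ U : Matrix (Fin n) (Fin d) ℝ, SPCAOptimal A s U ∧ rowSupport U ⊆ S

/-! ## The binary reformulation -/

/-- Sum of the `d` largest eigenvalues, with multiplicity (of all eigenvalues when `d` exceeds the
size of the matrix); `eigenvalues₀` lists the eigenvalues in nonincreasing order. -/
noncomputable def kyFan {ι : Type*} [Fintype ι] [DecidableEq ι] (d : ℕ) {X : Matrix ι ι ℝ}
    (hX : X.IsHermitian) : ℝ :=
  ∑ j : Fin (Fintype.card ι), if (j : ℕ) < d then hX.eigenvalues₀ j else 0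

/-- `∑ i, x i • a_i a_iᵀ`, where `a_i` is the `i`-th column of `A`. -/
def columnGram {r n : ℕ} (A : Matrix (Fin r) (Fin n) ℝ) (x : Fin n → ℝ) :
    Matrix (Fin r) (Fin r) ℝ :=
  ∑ i, x i • Matrix.vecMulVec (fun k => A k i) (fun k => A k i)

theorem columnGram_isHermitian {r n : ℕ} (A : Matrix (Fin r) (Fin n) ℝ) (x : Fin n → ℝ) :
    (columnGram A x).IsHermitian := by
  ext p q
  simp [columnGram, Matrix.sum_apply, Matrix.vecMulVec_apply, mul_comm]

/-- Objective of the binary reformulation. -/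
noncomputable def binaryObjective {r n : ℕ} (A : Matrix (Fin r) (Fin n) ℝ) (d : ℕ)
    (x : Fin n → ℝ) : ℝ :=
  kyFan d (columnGram_isHermitian A x)

/-- Feasible set of the binary reformulation. -/
def binaryFeasible (n s : ℕ) : Set (Fin n → ℝ) :=
  {x | (∀ i, x i = 0 ∨ x i = 1) ∧ ∑ i, x i ≤ s}

/-- The incidence vector of `S`. -/
def incidence {n : ℕ} (S : Finset (Fin n)) : Fin n → ℝ := fun i => if i ∈ S then 1 else 0

/-- `x` is an optimal solution of the binary reformulation. -/
def BinaryOptimal {r n : ℕ} (A : Matrix (Fin r) (Fin n) ℝ) (d s : ℕ) (x : Fin n → ℝ) : Prop :=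
  x ∈ binaryFeasible n s ∧ ∀ y ∈ binaryFeasible n s, binaryObjective A d y ≤ binaryObjective A d x

/-! ## The model of computation: imperative programs over a real-number memory

The memory consists of arrays of natural numbers and arrays of reals.  The name of an array is
fixed in the program text; the two indices are computed at run time; a scalar variable is the cell
`(0, 0)` of an array.  Each node of an evaluated expression and each executed command costs one
step.  The only operations on natural numbers are addition, truncated subtraction and comparison;
the only ones on reals are the four arithmetic operations and comparison.  There is no rounding,
and no conversion between reals and natural numbers.  In addition there is a truncated symmetric
eigenvalue decomposition; for `m` eigenpairs of a `k × k` matrix it is charged `m * k ^ 2`. -/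

structure Memory where
  nat : ℕ → ℕ → ℕ → ℕ
  real : ℕ → ℕ → ℕ → ℝ

/-- Natural-number expressions. -/
inductive NExp where
  | const (c : ℕ)
  | get (a : ℕ) (i j : NExp)
  | add (e f : NExp)
  | sub (e f : NExp)

def NExp.eval (σ : Memory) : NExp → ℕ
  | .const c => c
  | .get a i j => σ.nat a (i.eval σ) (j.eval σ)
  | .add e f => e.eval σ + f.eval σ
  | .sub e f => e.eval σ - f.eval σ

def NExp.cost : NExp → ℕ
  | .const _ => 1
  | .get _ i j => 1 + i.cost + j.cost
  | .add e f => 1 + e.cost + f.cost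
  | .sub e f => 1 + e.cost + f.cost

/-- Real-number expressions; the only constants are integers. -/
inductive RExp where
  | const (c : ℤ)
  | get (a : ℕ) (i j : NExp)
  | add (e f : RExp)
  | sub (e f : RExp)
  | mul (e f : RExp)
  | div (e f : RExp)

noncomputable def RExp.eval (σ : Memory) : RExp → ℝ
  | .const c => c
  | .get a i j => σ.real a (i.eval σ) (j.eval σ)
  | .add e f => e.eval σ + f.eval σ
  | .sub e f => e.eval σ - f.eval σ
  | .mul e f => e.eval σ * f.eval σ
  | .div e f => e.eval σ / f.eval σ

def RExp.cost : RExp → ℕ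
  | .const _ => 1
  | .get _ i j => 1 + i.cost + j.cost
  | .add e f => 1 + e.cost + f.cost
  | .sub e f => 1 + e.cost + f.cost
  | .mul e f => 1 + e.cost + f.cost
  | .div e f => 1 + e.cost + f.cost

/-- Tests. -/
inductive Test where
  | natLE (e f : NExp)
  | realLE (e f : RExp)
  | neg (b : Test)
  | conj (b c : Test)

def Test.holds (σ : Memory) : Test → Prop
  | .natLE e f => e.eval σ ≤ f.eval σ
  | .realLE e f => e.eval σ ≤ f.eval σ
  | .neg b => ¬ b.holds σ
  | .conj b c => b.holds σ ∧ c.holds σ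

def Test.cost : Test → ℕ
  | .natLE e f => 1 + e.cost + f.cost
  | .realLE e f => 1 + e.cost + f.cost
  | .neg b => 1 + b.cost
  | .conj b c => 1 + b.cost + c.cost

/-- Programs.  `eig k m M lam vec` computes `m` eigenpairs of the `k × k` matrix in the real array
`M`, and writes the eigenvalues to column `0` of the real array `lam` and the eigenvectors to the
first `m` columns of the real array `vec`. -/
inductive Program where
  | skip
  | setNat (a : ℕ) (i j : NExp) (e : NExp)
  | setReal (a : ℕ) (i j : NExp) (e : RExp)
  | seq (p q : Program)
  | ite (b : Test) (p q : Program)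
  | loop (b : Test) (p : Program)
  | eig (k m : NExp) (M lam vec : ℕ)

/-- The program contains no eigenvalue decomposition. -/
def Program.EigFree : Program → Prop
  | .skip => True
  | .setNat _ _ _ _ => True
  | .setReal _ _ _ _ => True
  | .seq p q => p.EigFree ∧ q.EigFree
  | .ite _ p q => p.EigFree ∧ q.EigFree
  | .loop _ p => p.EigFree
  | .eig _ _ _ _ _ => False

def Memory.setNat (σ : Memory) (a i j v : ℕ) : Memory where
  nat := fun a' i' j' => if a' = a ∧ i' = i ∧ j' = j then v else σ.nat a' i' j'
  real := σ.real

noncomputable def Memory.setReal (σ : Memory) (a i j : ℕ) (v : ℝ) : Memory where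
  nat := σ.nat
  real := fun a' i' j' => if a' = a ∧ i' = i ∧ j' = j then v else σ.real a' i' j'

/-- The `k × m` matrix in the upper left corner of the real array `a`. -/
def Memory.matrix (σ : Memory) (a k m : ℕ) : Matrix (Fin k) (Fin m) ℝ :=
  Matrix.of fun i j => σ.real a i j

/-- Overwrites the upper left `k × m` corner of the real array `a` by `X`. -/
noncomputable def Memory.setMatrix (σ : Memory) (a : ℕ) {k m : ℕ} (X : Matrix (Fin k) (Fin m) ℝ) :
    Memory where
  nat := σ.nat
  real := fun a' i j =>
    if h : a' = a ∧ i < k ∧ j < m then X ⟨i, h.2.1⟩ ⟨j, h.2.2⟩ else σ.real a' i j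

/-- A map returning `m` eigenvalues and `m` eigenvectors (as columns) of a `k × k` matrix. -/
abbrev EigSolver : Type :=
  (k m : ℕ) → Matrix (Fin k) (Fin k) ℝ → (Fin m → ℝ) × Matrix (Fin k) (Fin m) ℝ

/-- For every symmetric `k × k` matrix and every `m ≤ k`, the solver returns the `m` largest
eigenvalues in nonincreasing order, with orthonormal eigenvectors.  Nothing is assumed about the
choice of the eigenvectors, nor about the answers to other queries. -/
def EigSolver.Correct (E : EigSolver) : Prop :=
  ∀ (k m : ℕ) (M : Matrix (Fin k) (Fin k) ℝ) (hM : M.IsHermitian) (hmk : m ≤ k),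
    (∀ j : Fin m, (E k m M).1 j =
      hM.eigenvalues₀ ⟨j, lt_of_lt_of_le j.2 (hmk.trans_eq (Fintype.card_fin k).symm)⟩) ∧
    (E k m M).2ᵀ * (E k m M).2 = 1 ∧
    M * (E k m M).2 = (E k m M).2 * Matrix.diagonal (E k m M).1

/-- `Exec E p σ t τ`: started in memory `σ`, the program `p` halts after `t` steps in memory `τ`. -/
inductive Exec (E : EigSolver) : Program → Memory → ℕ → Memory → Prop where
  | skip (σ : Memory) : Exec E .skip σ 1 σ
  | setNat (σ : Memory) (a : ℕ) (i j e : NExp) :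
      Exec E (.setNat a i j e) σ (1 + i.cost + j.cost + e.cost)
        (σ.setNat a (i.eval σ) (j.eval σ) (e.eval σ))
  | setReal (σ : Memory) (a : ℕ) (i j : NExp) (e : RExp) :
      Exec E (.setReal a i j e) σ (1 + i.cost + j.cost + e.cost)
        (σ.setReal a (i.eval σ) (j.eval σ) (e.eval σ))
  | seq {p q : Program} {σ τ υ : Memory} {t u : ℕ} :
      Exec E p σ t τ → Exec E q τ u υ → Exec E (.seq p q) σ (1 + t + u) υ
  | iteTrue {b : Test} {p q : Program} {σ τ : Memory} {t : ℕ} :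
      b.holds σ → Exec E p σ t τ → Exec E (.ite b p q) σ (1 + b.cost + t) τ
  | iteFalse {b : Test} {p q : Program} {σ τ : Memory} {t : ℕ} :
      ¬ b.holds σ → Exec E q σ t τ → Exec E (.ite b p q) σ (1 + b.cost + t) τ
  | loopTrue {b : Test} {p : Program} {σ τ υ : Memory} {t u : ℕ} :
      b.holds σ → Exec E p σ t τ → Exec E (.loop b p) τ u υ →
        Exec E (.loop b p) σ (1 + b.cost + t + u) υ
  | loopFalse {b : Test} {p : Program} {σ : Memory} :
      ¬ b.holds σ → Exec E (.loop b p) σ (1 + b.cost) σ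
  | eig (σ : Memory) (k m : NExp) (M lam vec : ℕ) :
      Exec E (.eig k m M lam vec) σ (1 + k.cost + m.cost + m.eval σ * k.eval σ ^ 2)
        ((σ.setMatrix lam
            (Matrix.of fun j (_ : Fin 1) => (E (k.eval σ) (m.eval σ) (σ.matrix M _ _)).1 j)).setMatrix vec
          (E (k.eval σ) (m.eval σ) (σ.matrix M _ _)).2)

/-! ## Input and output conventions -/

/-- `n`, `s`, `d` are the scalars `0`, `1`, `2`; the matrix `A` is real array `0`; every other cell
is zero. -/
noncomputable def inputMemory {r n : ℕ} (A : Matrix (Fin r) (Fin n) ℝ) (s d : ℕ) : Memory :=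
  (((Memory.setMatrix ⟨fun _ _ _ => 0, fun _ _ _ => 0⟩ 0 A).setNat 0 0 0 n).setNat 1 0 0 s).setNat
    2 0 0 d

/-- The number of listed candidate supports: scalar `3`. -/
def Memory.numCandidates (σ : Memory) : ℕ := σ.nat 3 0 0

/-- The `l`-th listed candidate support: its length is cell `(l, 0)` of array `4`, its elements are
the first cells of row `l` of array `5`. -/
def Memory.candidate (σ : Memory) (n l : ℕ) : Finset (Fin n) :=
  Finset.univ.filter (fun i => ∃ t ∈ Finset.range (σ.nat 4 l 0), σ.nat 5 l t = i)

/-!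
The Ky Fan norm is a maximum of linear functionals: for a symmetric matrix `X`, the sum of its `d`
largest eigenvalues is the maximum of `tr (Vᵀ X V)` over all `V` with `d` orthonormal columns
(`trace_le_kyFan`, `trace_of_eigenpairs`). So at an optimal point of the binary problem there is a
supporting functional (`exists_support`), which assigns to the column `a_i` a nonnegative weight
that is a quadratic form in `a_i`. Every set of `s` columns of largest total weight is then optimal
too (`exists_binaryOptimal`). Passing between `B Bᵀ` and `Bᵀ B`, which have the same nonzero
eigenvalues (`kyFan_mul_transpose_comm`), eigenvectors of the covariance matrix of such a set of
columns form an optimal loading matrix of the same value (`spcaOptimal_spreadRows`).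

A quadratic form in `a_i` is a linear functional of the point in `ℝ ^ R` whose coordinates are the
products of pairs of entries of `a_i`, where `R = m + 1` is the number of unordered pairs of rows.
Hence it suffices to list a family of sets that contains, for every linear functional on `ℝ ^ R`, a
set of `s` of the given `n` points on which it is largest. In general position, a hyperplane that
separates such a set from the other points can be moved until it contains `R` of the points
(`exists_separating_many_zeros`); the set then consists of the points strictly on one side of this
hyperplane and of some of the `R` points on it. General position is achieved by moving the points
along the moment curve by an infinitesimal `ε`: the orientation determinants become polynomials in
`ε`, whose leading coefficients are Vandermonde determinants (`eventually_isGeneric`). The sign of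
such a polynomial for small `ε > 0` is that of its first nonzero coefficient, so that it can be
decided by finitely many exact arithmetic operations (`holds_sideTest`). Letting `ε` tend to zero
recovers the original points (`exists_maximizing_mem`).

There are `O(n ^ R)` hyperplanes through `R` points, but to test all points against each of them
and to examine all their cut sets would be compatible with the time bound only for `s ^ 2` at least
of the order of `n`. Only the shallow ones are therefore examined, those with at most `s + O(1)`
points on the chosen side. The hyperplanes through `R - 1` given points form a pencil. On one side
of a fixed hyperplane of the pencil, which is spanned by a reference point, they are linearly
ordered by rotation, because of the Plücker relation (`isStrictTotalOn_onSide`), and the shallow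
hyperplanes are among the last `s + O(1)` of this order. So repeatedly selecting a last remaining
point finds all of them, at a cost of `O(n)` for each selection and each cut set
(`appends_pencilScan`). The reference points are `R + 1` additional points, not all of which can
lie on the hyperplane. Altogether `O(n ^ (R - 1) * s)` sets are listed in time `O(n ^ R * s)`
(`exists_haltsWithin_enumerate`). The list serves every linear functional, and hence every `d`.

To solve the problem, the program computes the `d` largest eigenvalues of the covariance matrix of
each listed set, at cost `O(d * s ^ 2)`, and returns the eigenvectors for the set with the largest
sum (`exists_haltsWithin_solveListed`). The programs are verified with a logic of total correctness
and running time (`HaltsWithin`).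
-/

/-! ### Total correctness with running time -/

/-- Started in `σ`, the program `P` halts within `T` steps in a memory satisfying `Q`. -/
def HaltsWithin (E : EigSolver) (P : Program) (σ : Memory) (T : ℕ) (Q : Memory → Prop) : Prop :=
  ∃ t τ, Exec E P σ t τ ∧ t ≤ T ∧ Q τ

/-- Every natural-number array that the program may write belongs to `W`. -/
def Program.NatIn (W : ℕ → Prop) : Program → Prop
  | .skip => True
  | .setNat a _ _ _ => W a
  | .setReal _ _ _ _ => True
  | .seq p q => p.NatIn W ∧ q.NatIn W
  | .ite _ p q => p.NatIn W ∧ q.NatIn W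
  | .loop _ p => p.NatIn W
  | .eig _ _ _ _ _ => True

/-- Every real array that the program may write belongs to `W`. -/
def Program.RealIn (W : ℕ → Prop) : Program → Prop
  | .skip => True
  | .setNat _ _ _ _ => True
  | .setReal a _ _ _ => W a
  | .seq p q => p.RealIn W ∧ q.RealIn W
  | .ite _ p q => p.RealIn W ∧ q.RealIn W
  | .loop _ p => p.RealIn W
  | .eig _ _ _ lam vec => W lam ∧ W vec

theorem Program.NatIn.mono {W W' : ℕ → Prop} (h : ∀ a, W a → W' a) :
    ∀ {P : Program}, P.NatIn W → P.NatIn W'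
  | .skip, _ => trivial
  | .setNat _ _ _ _, hP => h _ hP
  | .setReal _ _ _ _, _ => trivial
  | .seq _ _, hP => ⟨Program.NatIn.mono h hP.1, Program.NatIn.mono h hP.2⟩
  | .ite _ _ _, hP => ⟨Program.NatIn.mono h hP.1, Program.NatIn.mono h hP.2⟩
  | .loop _ p, hP => Program.NatIn.mono (P := p) h hP
  | .eig _ _ _ _ _, _ => trivial

/-- An array of natural numbers that the program cannot write keeps its contents. -/
theorem Exec.nat_eq {E : EigSolver} {W : ℕ → Prop} {P : Program} {σ τ : Memory} {t : ℕ}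
    (h : Exec E P σ t τ) (hP : P.NatIn W) {a : ℕ} (ha : ¬ W a) : τ.nat a = σ.nat a := by
  induction h with
  | skip => rfl
  | setNat σ b i j e =>
    funext x y
    have : a ≠ b := fun hab => ha (hab ▸ hP)
    simp [Memory.setNat, this]
  | setReal => rfl
  | seq _ _ ih1 ih2 => rw [ih2 hP.2, ih1 hP.1]
  | iteTrue _ _ ih => exact ih hP.1
  | iteFalse _ _ ih => exact ih hP.2
  | loopTrue _ _ _ ih1 ih2 => rw [ih2 hP, ih1 hP]
  | loopFalse => rfl
  | eig => rfl

/-- A real array that the program cannot write keeps its contents. -/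
theorem Exec.real_eq {E : EigSolver} {W : ℕ → Prop} {P : Program} {σ τ : Memory} {t : ℕ}
    (h : Exec E P σ t τ) (hP : P.RealIn W) {a : ℕ} (ha : ¬ W a) : τ.real a = σ.real a := by
  induction h with
  | skip => rfl
  | setNat => rfl
  | setReal σ b i j e =>
    funext x y
    have : a ≠ b := fun hab => ha (hab ▸ hP)
    simp [Memory.setReal, this]
  | seq _ _ ih1 ih2 => rw [ih2 hP.2, ih1 hP.1]
  | iteTrue _ _ ih => exact ih hP.1
  | iteFalse _ _ ih => exact ih hP.2
  | loopTrue _ _ _ ih1 ih2 => rw [ih2 hP, ih1 hP]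
  | loopFalse => rfl
  | eig σ k m M lam vec =>
    have h1 : a ≠ lam := fun hab => ha (hab ▸ hP.1)
    have h2 : a ≠ vec := fun hab => ha (hab ▸ hP.2)
    funext x y
    simp [Memory.setMatrix, h1, h2]

namespace HaltsWithin

variable {E : EigSolver} {σ : Memory} {T : ℕ} {Q : Memory → Prop}

theorem mono {P : Program} {T' : ℕ} {Q' : Memory → Prop} (h : HaltsWithin E P σ T Q)
    (hT : T ≤ T') (hQ : ∀ τ, Q τ → Q' τ) : HaltsWithin E P σ T' Q' := by
  obtain ⟨t, τ, h1, h2, h3⟩ := h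
  exact ⟨t, τ, h1, h2.trans hT, hQ τ h3⟩

/-- The postcondition may use that arrays not written by the program keep their contents. -/
theorem frame {P : Program} {W V : ℕ → Prop} (h : HaltsWithin E P σ T Q) (hW : P.NatIn W)
    (hV : P.RealIn V) :
    HaltsWithin E P σ T (fun τ => Q τ ∧ (∀ a, ¬ W a → τ.nat a = σ.nat a) ∧
      ∀ a, ¬ V a → τ.real a = σ.real a) := by
  obtain ⟨t, τ, h1, h2, h3⟩ := h
  exact ⟨t, τ, h1, h2, h3, fun a ha => h1.nat_eq hW ha, fun a ha => h1.real_eq hV ha⟩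

theorem skip (h : Q σ) : HaltsWithin E .skip σ 1 Q := ⟨_, _, Exec.skip σ, le_rfl, h⟩

theorem setNat {a : ℕ} {i j e : NExp} (h : Q (σ.setNat a (i.eval σ) (j.eval σ) (e.eval σ))) :
    HaltsWithin E (.setNat a i j e) σ (1 + i.cost + j.cost + e.cost) Q :=
  ⟨_, _, Exec.setNat σ a i j e, le_rfl, h⟩

theorem setReal {a : ℕ} {i j : NExp} {e : RExp}
    (h : Q (σ.setReal a (i.eval σ) (j.eval σ) (e.eval σ))) :
    HaltsWithin E (.setReal a i j e) σ (1 + i.cost + j.cost + e.cost) Q :=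
  ⟨_, _, Exec.setReal σ a i j e, le_rfl, h⟩

theorem seq {P P' : Program} {T' : ℕ} {M : Memory → Prop} (h : HaltsWithin E P σ T M)
    (h' : ∀ τ, M τ → HaltsWithin E P' τ T' Q) : HaltsWithin E (.seq P P') σ (1 + T + T') Q := by
  obtain ⟨t, τ, h1, h2, h3⟩ := h
  obtain ⟨u, υ, g1, g2, g3⟩ := h' τ h3
  exact ⟨_, υ, Exec.seq h1 g1, by omega, g3⟩

theorem ite {b : Test} {P P' : Program} (h : b.holds σ → HaltsWithin E P σ T Q)
    (h' : ¬ b.holds σ → HaltsWithin E P' σ T Q) :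
    HaltsWithin E (.ite b P P') σ (1 + b.cost + T) Q := by
  by_cases hb : b.holds σ
  · obtain ⟨t, τ, h1, h2, h3⟩ := h hb
    exact ⟨_, τ, Exec.iteTrue hb h1, by omega, h3⟩
  · obtain ⟨t, τ, h1, h2, h3⟩ := h' hb
    exact ⟨_, τ, Exec.iteFalse hb h1, by omega, h3⟩

end HaltsWithin

/-- The scalar variable `a`. -/
def NExp.var (a : ℕ) : NExp := .get a (.const 0) (.const 0)

@[simp] theorem NExp.eval_var (σ : Memory) (a : ℕ) : (NExp.var a).eval σ = σ.nat a 0 0 := rfl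

/-- `e < f`. -/
def Test.natLT (e f : NExp) : Test := .natLE (.add e (.const 1)) f

@[simp] theorem Test.holds_natLT (σ : Memory) (e f : NExp) :
    (Test.natLT e f).holds σ ↔ e.eval σ < f.eval σ := by
  simp [Test.natLT, Test.holds, NExp.eval]

/-- `for v = 0, …, b - 1 do P`. -/
def Program.forLoop (v : ℕ) (b : NExp) (P : Program) : Program :=
  .seq (.setNat v (.const 0) (.const 0) (.const 0))
    (.loop (.natLT (.var v) b)
      (.seq P (.setNat v (.const 0) (.const 0) (.add (.var v) (.const 1)))))

@[simp] theorem Program.natIn_forLoop {W : ℕ → Prop} {v : ℕ} {b : NExp} {P : Program} :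
    (Program.forLoop v b P).NatIn W ↔ W v ∧ P.NatIn W := by
  simp only [forLoop, NatIn]; tauto

@[simp] theorem Program.realIn_forLoop {W : ℕ → Prop} {v : ℕ} {b : NExp} {P : Program} :
    (Program.forLoop v b P).RealIn W ↔ P.RealIn W := by
  simp [forLoop, RealIn]

@[simp] theorem Program.eigFree_forLoop {v : ℕ} {b : NExp} {P : Program} :
    (Program.forLoop v b P).EigFree ↔ P.EigFree := by
  simp [forLoop, EigFree]

/-- Rule for counting loops whose body takes at most `B` steps. The invariant `Inv k` speaks about
the memory in which the counter `v` has just become `k`; it must also imply that the bound `b`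
still has the value `N`. -/
theorem HaltsWithin.forLoop {E : EigSolver} {v : ℕ} {b : NExp} {P : Program} {σ : Memory}
    {B N : ℕ} (Inv : ℕ → Memory → Prop) (h0 : Inv 0 (σ.setNat v 0 0 0))
    (hv : ∀ k τ, Inv k τ → τ.nat v 0 0 = k ∧ b.eval τ = N)
    (hP : ∀ k < N, ∀ τ, Inv k τ → HaltsWithin E P τ B
      (fun τ' => τ'.nat v 0 0 = k ∧ Inv (k + 1) (τ'.setNat v 0 0 (k + 1)))) :
    HaltsWithin E (Program.forLoop v b P) σ (N * (B + b.cost + 20) + b.cost + 20) (Inv N) := by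
  -- `j` is the number of remaining iterations
  have key : ∀ j k, k + j = N → ∀ τ, Inv k τ →
      HaltsWithin E (.loop (.natLT (.var v) b)
        (.seq P (.setNat v (.const 0) (.const 0) (.add (.var v) (.const 1))))) τ
        (j * (B + b.cost + 20) + b.cost + 10) (Inv N) := by
    intro j
    induction j with
    | zero =>
      intro k hk τ hτ
      obtain ⟨h1, h2⟩ := hv k τ hτ
      have : ¬ (Test.natLT (.var v) b).holds τ := by simp [h1, h2]; omega
      refine ⟨_, τ, Exec.loopFalse this, ?_, by simpa [← hk] using hτ⟩
      simp [Test.natLT, Test.cost, NExp.cost, NExp.var]; omega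
    | succ j ih =>
      intro k hk τ hτ
      obtain ⟨h1, h2⟩ := hv k τ hτ
      have hb : (Test.natLT (.var v) b).holds τ := by simp [h1, h2]; omega
      have hbody : HaltsWithin E
          (.seq P (.setNat v (.const 0) (.const 0) (.add (.var v) (.const 1)))) τ
          (1 + B + 8) (Inv (k + 1)) := by
        refine ((hP k (by omega) τ hτ).seq (T' := 8) fun τ' h => ?_)
        refine HaltsWithin.setNat ?_
        simpa [NExp.eval, h.1] using h.2
      obtain ⟨t, τ', e1, e2, e3⟩ := hbody
      obtain ⟨u, υ, f1, f2, f3⟩ := ih (k + 1) (by omega) τ' e3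
      refine ⟨_, υ, Exec.loopTrue hb e1 f1, ?_, f3⟩
      simp [Test.natLT, Test.cost, NExp.cost, NExp.var]
      rw [Nat.succ_mul]; omega
  refine ((HaltsWithin.setNat (Q := Inv 0) h0).seq
    (key N 0 (by omega))).mono ?_ fun _ h => h
  simp [NExp.cost]; omega

/-- Sequential composition of a list of programs. -/
def Program.seqList : List Program → Program
  | [] => .skip
  | P :: L => .seq P (seqList L)

theorem Program.natIn_seqList {W : ℕ → Prop} {L : List Program} (h : ∀ P ∈ L, P.NatIn W) :
    (Program.seqList L).NatIn W := by
  induction L with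
  | nil => trivial
  | cons P L ih =>
    exact ⟨h P (by simp), ih fun Q hQ => h Q (by simp [hQ])⟩

theorem Program.realIn_seqList {W : ℕ → Prop} {L : List Program} (h : ∀ P ∈ L, P.RealIn W) :
    (Program.seqList L).RealIn W := by
  induction L with
  | nil => trivial
  | cons P L ih =>
    exact ⟨h P (by simp), ih fun Q hQ => h Q (by simp [hQ])⟩

theorem Program.eigFree_seqList {L : List Program} (h : ∀ P ∈ L, P.EigFree) :
    (Program.seqList L).EigFree := by
  induction L with
  | nil => trivial
  | cons P L ih =>
    exact ⟨h P (by simp), ih fun Q hQ => h Q (by simp [hQ])⟩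

/-! ### Sums of largest eigenvalues -/

/-- A weighted sum with weights in `[0, 1]` of total weight `d` is at most the sum of the `d`
largest terms. -/
theorem sum_mul_le_sum_lt {N d : ℕ} (hd : d ≤ N) {f w : Fin N → ℝ} (hf : Antitone f)
    (h0 : ∀ j, 0 ≤ w j) (h1 : ∀ j, w j ≤ 1) (hw : ∑ j, w j = d) :
    ∑ j, f j * w j ≤ ∑ j : Fin N, if (j : ℕ) < d then f j else 0 := by
  rcases Nat.eq_zero_or_pos d with rfl | hpos
  · have hz : ∀ j, w j = 0 := fun j =>
      (Finset.sum_eq_zero_iff_of_nonneg fun j _ => h0 j).1 (by simpa using hw) j (Finset.mem_univ j)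
    simp [hz]
  -- `t` is the smallest of the `d` largest terms
  set t := f ⟨d - 1, by omega⟩ with ht
  have hterm : ∀ j : Fin N, (f j - t) * w j ≤ if (j : ℕ) < d then f j - t else 0 := by
    intro j
    split_ifs with hj
    · have : t ≤ f j := hf (Fin.mk_le_mk.2 (by omega) : j ≤ ⟨d - 1, by omega⟩)
      nlinarith [h1 j]
    · have : f j ≤ t := hf (Fin.mk_le_mk.2 (by omega) : (⟨d - 1, by omega⟩ : Fin N) ≤ j)
      nlinarith [h0 j]
  have hcount : ∑ j : Fin N, (if (j : ℕ) < d then t else 0) = t * d := by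
    rw [← Finset.sum_filter, Finset.sum_const, nsmul_eq_mul, mul_comm]
    congr 2
    have : (Finset.univ.filter fun j : Fin N => (j : ℕ) < d).card = d := by
      rw [Fin.card_filter_val_lt]; omega
    exact this
  have hsum := Finset.sum_le_sum fun j (_ : j ∈ Finset.univ) => hterm j
  simp only [sub_mul, Finset.sum_sub_distrib, ← Finset.mul_sum, hw] at hsum
  have hsplit : ∑ j : Fin N, (if (j : ℕ) < d then f j - t else 0) =
      (∑ j : Fin N, if (j : ℕ) < d then f j else 0) - t * d := by
    rw [← hcount, ← Finset.sum_sub_distrib]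
    exact Finset.sum_congr rfl fun j _ => by split_ifs <;> simp
  rw [hsplit] at hsum
  linarith

section Hermitian

variable {k : ℕ} {X : Matrix (Fin k) (Fin k) ℝ}

theorem kyFan_eq_sum_castLE (hX : X.IsHermitian) {d : ℕ} (hd : d ≤ k) :
    kyFan d hX = ∑ j : Fin d, hX.eigenvalues₀
      ⟨j, lt_of_lt_of_le j.2 (hd.trans_eq (Fintype.card_fin k).symm)⟩ := by
  have hd' : d ≤ Fintype.card (Fin k) := by simpa using hd
  rw [kyFan, ← Finset.sum_filter]
  symm
  refine Finset.sum_bij (fun j _ => ⟨j, lt_of_lt_of_le j.2 hd'⟩) (fun j _ => by simp)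
    (fun a _ b _ h => Fin.ext (by simpa using h)) (fun b hb => ?_) (fun _ _ => rfl)
  exact ⟨⟨b, by simpa using hb⟩, Finset.mem_univ _, rfl⟩

theorem kyFan_min (hX : X.IsHermitian) (d : ℕ) : kyFan (min d k) hX = kyFan d hX := by
  refine Finset.sum_congr rfl fun j _ => ?_
  have : (j : ℕ) < k := by simpa using j.2
  simp [this]

/-- Orthonormal eigenvectors for the largest eigenvalues exist. -/
theorem exists_eigenpairs (hX : X.IsHermitian) {d : ℕ} (hd : d ≤ k) :
    ∃ V : Matrix (Fin k) (Fin d) ℝ, Vᵀ * V = 1 ∧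
      X * V = V * Matrix.diagonal fun j : Fin d => hX.eigenvalues₀
        ⟨j, lt_of_lt_of_le j.2 (hd.trans_eq (Fintype.card_fin k).symm)⟩ := by
  let π : Fin (Fintype.card (Fin k)) ≃ Fin k := Fintype.equivOfCardEq (Fintype.card_fin _)
  let Q : Matrix (Fin k) (Fin k) ℝ := hX.eigenvectorUnitary
  let e : Fin d → Fin k := fun j =>
      π ⟨j, lt_of_lt_of_le j.2 (hd.trans_eq (Fintype.card_fin k).symm)⟩
  have he : Function.Injective e := fun a b h => by
    have := π.injective h
    exact Fin.ext (by simpa using this)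
  have hQ : Qᵀ * Q = 1 := by
    have := Unitary.coe_star_mul_self hX.eigenvectorUnitary
    rwa [Matrix.star_eq_conjTranspose, Matrix.conjTranspose_eq_transpose_of_trivial] at this
  refine ⟨Q.submatrix id e, ?_, ?_⟩
  · ext a b
    have := congrFun (congrFun hQ (e a)) (e b)
    simp only [Matrix.mul_apply, Matrix.transpose_apply, Matrix.submatrix_apply, id] at this ⊢
    rw [this, Matrix.one_apply, Matrix.one_apply]
    simp [he.eq_iff]
  · ext i j
    have := congrFun (hX.mulVec_eigenvectorBasis (e j)) i
    rw [Matrix.mul_diagonal]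
    simp only [Matrix.mulVec, dotProduct, Pi.smul_apply, smul_eq_mul] at this
    simp only [Matrix.mul_apply, Matrix.submatrix_apply, id, Q,
      Matrix.IsHermitian.eigenvectorUnitary_apply]
    rw [this, mul_comm]
    congr 1
    simp [Matrix.IsHermitian.eigenvalues, e, π]

theorem trace_of_eigenpairs (hX : X.IsHermitian) {d : ℕ} (hd : d ≤ k) {V : Matrix (Fin k) (Fin d) ℝ}
    (hV : Vᵀ * V = 1) (hXV : X * V = V * Matrix.diagonal fun j : Fin d => hX.eigenvalues₀
        ⟨j, lt_of_lt_of_le j.2 (hd.trans_eq (Fintype.card_fin k).symm)⟩) :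
    (Vᵀ * X * V).trace = kyFan d hX := by
  rw [Matrix.mul_assoc, hXV, ← Matrix.mul_assoc, hV, Matrix.one_mul, Matrix.trace_diagonal,
    kyFan_eq_sum_castLE hX hd]

/-- Ky Fan's inequality: the trace of a compression of `X` to a `d`-dimensional subspace is at most
the sum of the `d` largest eigenvalues. -/
theorem trace_le_kyFan (hX : X.IsHermitian) {d : ℕ} (hd : d ≤ k) {V : Matrix (Fin k) (Fin d) ℝ}
    (hV : Vᵀ * V = 1) : (Vᵀ * X * V).trace ≤ kyFan d hX := by
  let π : Fin (Fintype.card (Fin k)) ≃ Fin k := Fintype.equivOfCardEq (Fintype.card_fin _)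
  let Q : Matrix (Fin k) (Fin k) ℝ := hX.eigenvectorUnitary
  have hQ : Q * Qᵀ = 1 := by
    have := Matrix.mem_unitaryGroup_iff.1 hX.eigenvectorUnitary.2
    rwa [Matrix.star_eq_conjTranspose, Matrix.conjTranspose_eq_transpose_of_trivial] at this
  have hspec : X = Q * Matrix.diagonal hX.eigenvalues * Qᵀ := by
    have := hX.spectral_theorem
    rw [Unitary.conjStarAlgAut_apply, Matrix.star_eq_conjTranspose,
      Matrix.conjTranspose_eq_transpose_of_trivial] at this
    exact this
  -- the eigenvectors are weighted by their squared projections to the column space of `V`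
  set W : Matrix (Fin k) (Fin d) ℝ := Qᵀ * V with hW
  have hWW : Wᵀ * W = 1 := by
    rw [hW, Matrix.transpose_mul, Matrix.transpose_transpose, Matrix.mul_assoc,
      ← Matrix.mul_assoc Q,
      hQ, Matrix.one_mul, hV]
  set P : Matrix (Fin k) (Fin k) ℝ := W * Wᵀ with hP
  have hPP : P * P = P := by
    rw [hP, Matrix.mul_assoc, ← Matrix.mul_assoc Wᵀ, hWW, Matrix.one_mul]
  have hPs : ∀ i j, P i j = P j i := fun i j => by
    have : Pᵀ = P := by rw [hP, Matrix.transpose_mul, Matrix.transpose_transpose]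
    exact congrFun (congrFun this j) i
  have hdiag : ∀ i, P i i = ∑ j, P i j ^ 2 := fun i => by
    conv_lhs => rw [← hPP, Matrix.mul_apply]
    exact Finset.sum_congr rfl fun j _ => by rw [hPs j i, sq]
  have h0 : ∀ i, 0 ≤ P i i := fun i => by rw [hdiag]; positivity
  have h1 : ∀ i, P i i ≤ 1 := fun i => by
    have h2 : P i i ^ 2 ≤ P i i := by
      conv_rhs => rw [hdiag]
      exact Finset.single_le_sum (f := fun j => P i j ^ 2) (fun j _ => sq_nonneg _)
        (Finset.mem_univ i)
    nlinarith [h0 i]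
  have htr : ∑ i, P i i = d := by
    change P.trace = d
    rw [hP, Matrix.trace_mul_comm, hWW, Matrix.trace_one, Fintype.card_fin]
  have hval : (Vᵀ * X * V).trace = ∑ i, hX.eigenvalues i * P i i := by
    have h3 : Vᵀ * X * V = Wᵀ * (Matrix.diagonal hX.eigenvalues * W) := by
      conv_lhs => rw [hspec]
      rw [hW, Matrix.transpose_mul, Matrix.transpose_transpose]
      simp only [Matrix.mul_assoc]
    rw [h3, Matrix.trace_mul_comm, Matrix.mul_assoc, ← hP, Matrix.trace]
    simp [Matrix.diagonal_mul]
  have hw := sum_mul_le_sum_lt (d := d) (by simpa using hd) hX.eigenvalues₀_antitone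
    (w := fun j => P (π j) (π j)) (fun j => h0 _) (fun j => h1 _)
    (by rw [← htr]; exact π.sum_comp fun i => P i i)
  rw [hval, ← π.sum_comp]
  refine le_trans (le_of_eq (Finset.sum_congr rfl fun j _ => ?_)) hw
  simp [Matrix.IsHermitian.eigenvalues, π]

theorem kyFan_eq_sum_take (hX : X.IsHermitian) (d : ℕ) :
    kyFan d hX = ((List.ofFn hX.eigenvalues₀).take d).sum := by
  rw [List.sum_take_ofFn, kyFan, Finset.sum_filter]

theorem isHermitian_mul_transpose {r s : ℕ} (B : Matrix (Fin r) (Fin s) ℝ) :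
    (B * Bᵀ).IsHermitian := by
  simpa [Matrix.conjTranspose_eq_transpose_of_trivial]
    using Matrix.isHermitian_mul_conjTranspose_self B

theorem eigenvalues₀_mul_transpose_nonneg {r s : ℕ} (B : Matrix (Fin r) (Fin s) ℝ)
    (h : (B * Bᵀ).IsHermitian) (j : Fin (Fintype.card (Fin r))) : 0 ≤ h.eigenvalues₀ j := by
  have hp : (B * Bᵀ).PosSemidef := by
    simpa [Matrix.conjTranspose_eq_transpose_of_trivial]
      using Matrix.posSemidef_self_mul_conjTranspose B
  have := hp.eigenvalues_nonneg (Fintype.equivOfCardEq (Fintype.card_fin _) j)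
  simpa [Matrix.IsHermitian.eigenvalues] using this

/-- `B Bᵀ` and `Bᵀ B` have the same nonzero eigenvalues, hence the same Ky Fan norms.  Since all
eigenvalues are nonnegative, the two nonincreasing lists of eigenvalues agree once they are padded
with zeros. -/
theorem kyFan_mul_transpose_comm {r s : ℕ} (B : Matrix (Fin r) (Fin s) ℝ) (d : ℕ)
    (h : (B * Bᵀ).IsHermitian) (h' : (Bᵀ * B).IsHermitian) : kyFan d h = kyFan d h' := by
  have hroots := congrArg Polynomial.roots (Matrix.charpoly_mul_comm' B Bᵀ)
  rw [Polynomial.roots_mul, Polynomial.roots_mul, Polynomial.roots_X_pow, Polynomial.roots_X_pow,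
    h.roots_charpoly_eq_eigenvalues₀, h'.roots_charpoly_eq_eigenvalues₀] at hroots
  rotate_left
  · exact mul_ne_zero (pow_ne_zero _ Polynomial.X_ne_zero) (Matrix.charpoly_monic _).ne_zero
  · exact mul_ne_zero (pow_ne_zero _ Polynomial.X_ne_zero) (Matrix.charpoly_monic _).ne_zero
  have hn : ∀ x ∈ List.ofFn h.eigenvalues₀, 0 ≤ x := by
    intro x hx
    obtain ⟨j, rfl⟩ := List.mem_ofFn.1 hx
    exact eigenvalues₀_mul_transpose_nonneg B h j
  have hn' : ∀ x ∈ List.ofFn h'.eigenvalues₀, 0 ≤ x := by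
    intro x hx
    obtain ⟨j, rfl⟩ := List.mem_ofFn.1 hx
    have := eigenvalues₀_mul_transpose_nonneg Bᵀ (by rwa [Matrix.transpose_transpose]) j
    simpa using this
  have pad : ∀ (L : List ℝ) (z : ℕ), L.Pairwise (· ≥ ·) → (∀ x ∈ L, 0 ≤ x) →
      (L ++ List.replicate z 0).Pairwise (· ≥ ·) := by
    intro L z hL hL0
    refine List.pairwise_append.2 ⟨hL, List.pairwise_replicate.2 (Or.inr le_rfl),
      fun a ha b hb => ?_⟩
    rw [List.eq_of_mem_replicate hb]
    exact hL0 a ha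
  have heq : List.ofFn h.eigenvalues₀ ++ List.replicate s 0 =
      List.ofFn h'.eigenvalues₀ ++ List.replicate r 0 := by
    refine List.Perm.eq_of_pairwise' (r := (· ≥ ·))
      (pad _ _ h.eigenvalues₀_antitone.sortedGE_ofFn.pairwise hn)
      (pad _ _ h'.eigenvalues₀_antitone.sortedGE_ofFn.pairwise hn') ?_
    rw [← Multiset.coe_eq_coe, ← Multiset.coe_add, ← Multiset.coe_add, add_comm,
      add_comm (List.ofFn h'.eigenvalues₀ : Multiset ℝ)]
    simpa [Fin.univ_val_map, Multiset.nsmul_singleton, Function.comp_def,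
      ← Multiset.coe_replicate] using hroots
  have htake : ∀ (L : List ℝ) (z : ℕ), ((L ++ List.replicate z 0).take d).sum = (L.take d).sum := by
    intro L z
    simp [List.take_append]
  rw [kyFan_eq_sum_take, kyFan_eq_sum_take, ← htake _ s, heq, htake]

end Hermitian

/-! ### The binary reformulation -/

section Binary

variable {r n : ℕ} (A : Matrix (Fin r) (Fin n) ℝ)

theorem trace_columnGram (x : Fin n → ℝ) {d : ℕ} (V : Matrix (Fin r) (Fin d) ℝ) :
    (Vᵀ * columnGram A x * V).trace = ∑ i, x i * ∑ p, ∑ q, (V * Vᵀ) p q * (A p i * A q i) := by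
  rw [Matrix.mul_assoc, Matrix.trace_mul_comm, Matrix.mul_assoc, Matrix.trace_mul_comm]
  have h : ∀ p, ((V * Vᵀ) * columnGram A x) p p =
      ∑ q, ∑ i, x i * ((V * Vᵀ) p q * (A p i * A q i)) := fun p => by
    rw [Matrix.mul_apply]
    refine Finset.sum_congr rfl fun q _ => ?_
    simp only [columnGram, Matrix.sum_apply, Matrix.smul_apply, Matrix.vecMulVec_apply, smul_eq_mul,
      Finset.mul_sum]
    exact Finset.sum_congr rfl fun i _ => by ring
  simp only [Matrix.trace, Matrix.diag_apply, h, Finset.mul_sum]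
  rw [Finset.sum_comm (s := Finset.univ (α := Fin n))]
  exact Finset.sum_congr rfl fun p _ => Finset.sum_comm

/-- The objective of the binary problem has a supporting functional at every point: nonnegative
weights of the columns, linear in the matrices `a_i a_iᵀ`. The functional is given by the
projection to the span of the eigenvectors for the largest eigenvalues. -/
theorem exists_support (d : ℕ) (x : Fin n → ℝ) : ∃ C : Matrix (Fin r) (Fin r) ℝ,
    (∀ i, 0 ≤ ∑ p, ∑ q, C p q * (A p i * A q i)) ∧
    binaryObjective A d x = ∑ i, x i * ∑ p, ∑ q, C p q * (A p i * A q i) ∧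
    ∀ y, ∑ i, y i * ∑ p, ∑ q, C p q * (A p i * A q i) ≤ binaryObjective A d y := by
  obtain ⟨V, hV, hXV⟩ := exists_eigenpairs (columnGram_isHermitian A x) (min_le_right d r)
  refine ⟨V * Vᵀ, fun i => ?_, ?_, fun y => ?_⟩
  · have h : ∑ p, ∑ q, (V * Vᵀ) p q * (A p i * A q i) = ∑ j, (∑ p, V p j * A p i) ^ 2 := by
      have h1 : ∀ j, (∑ p, V p j * A p i) ^ 2 = ∑ p, ∑ q, (V p j * A p i) * (V q j * A q i) :=
        fun j => by rw [sq, Finset.sum_mul_sum]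
      simp only [h1, Matrix.mul_apply, Matrix.transpose_apply, Finset.sum_mul]
      rw [Finset.sum_comm (s := Finset.univ (α := Fin (min d r)))]
      refine Finset.sum_congr rfl fun p _ => ?_
      rw [Finset.sum_comm]
      exact Finset.sum_congr rfl fun j _ => Finset.sum_congr rfl fun q _ => by ring
    rw [h]; positivity
  · rw [← trace_columnGram, trace_of_eigenpairs (columnGram_isHermitian A x) (min_le_right d r)
      hV hXV, kyFan_min]
    rfl
  · rw [← trace_columnGram]
    refine (trace_le_kyFan (columnGram_isHermitian A y) (min_le_right d r) hV).trans_eq ?_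
    rw [kyFan_min]; rfl

theorem incidence_mem_binaryFeasible {s : ℕ} {S : Finset (Fin n)} (hS : S.card ≤ s) :
    incidence S ∈ binaryFeasible n s := by
  refine ⟨fun i => by simp only [incidence]; split_ifs <;> simp, ?_⟩
  simpa [incidence] using hS

/-- Binary feasible points are incidence vectors of sets of at most `s` indices. -/
theorem exists_eq_incidence {s : ℕ} {x : Fin n → ℝ} (hx : x ∈ binaryFeasible n s) :
    ∃ S : Finset (Fin n), S.card ≤ s ∧ x = incidence S := by
  classical
  have h : x = incidence (Finset.univ.filter fun i => x i = 1) := by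
    funext i
    rcases hx.1 i with h | h <;> simp [incidence, h]
  refine ⟨_, ?_, h⟩
  have h2 := hx.2
  rw [h] at h2
  simpa [incidence] using h2

/-- If for every quadratic weight function some set of the family `F` has maximal weight among the
sets of size `s`, then `F` contains an optimal solution of the binary problem: the set that is best
for the supporting functional at an optimal solution is optimal as well. -/
theorem exists_binaryOptimal {d s : ℕ} (hsn : s ≤ n) {F : Finset (Fin n) → Prop}
    (hF : ∀ C : Matrix (Fin r) (Fin r) ℝ, ∃ S, F S ∧ S.card = s ∧ ∀ T : Finset (Fin n), T.card = s →
      ∑ i ∈ T, ∑ p, ∑ q, C p q * (A p i * A q i) ≤ ∑ i ∈ S, ∑ p, ∑ q, C p q * (A p i * A q i)) :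
    ∃ S, F S ∧ S.card = s ∧ BinaryOptimal A d s (incidence S) := by
  classical
  obtain ⟨S0, hS0, hmax⟩ := Finset.exists_max_image
    (Finset.univ.filter fun S : Finset (Fin n) => S.card ≤ s)
    (fun S => binaryObjective A d (incidence S)) ⟨∅, by simp⟩
  obtain ⟨C, hC0, hC1, hC2⟩ := exists_support A d (incidence S0)
  obtain ⟨S, hFS, hSc, hS⟩ := hF C
  obtain ⟨T, hT, -, hTc⟩ := Finset.exists_subsuperset_card_eq (Finset.subset_univ S0)
    (by simpa using hS0) (by simpa using hsn)
  have hinc : ∀ (U : Finset (Fin n)) (f : Fin n → ℝ), ∑ i, incidence U i * f i = ∑ i ∈ U, f i := by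
    intro U f
    simp [incidence, ite_mul]
  refine ⟨S, hFS, hSc, incidence_mem_binaryFeasible hSc.le, fun y hy => ?_⟩
  obtain ⟨Y, hY, rfl⟩ := exists_eq_incidence hy
  refine (hmax Y (by simpa using hY)).trans ?_
  have h3 := hC2 (incidence S)
  rw [hinc] at h3 hC1
  rw [hC1]
  exact (Finset.sum_le_sum_of_subset_of_nonneg hT fun i _ _ => hC0 i).trans ((hS T hTc).trans h3)

/-! ### From binary solutions to loading matrices -/

theorem spcaObjective_eq_trace {d : ℕ} (U : Matrix (Fin n) (Fin d) ℝ) :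
    spcaObjective A U = (Uᵀ * (Aᵀ * A) * U).trace := by
  have : Uᵀ * (Aᵀ * A) * U = (A * U)ᵀ * (A * U) := by
    rw [Matrix.transpose_mul]; simp only [Matrix.mul_assoc]
  rw [this, Matrix.trace, spcaObjective, Finset.sum_comm]
  refine Finset.sum_congr rfl fun j _ => ?_
  rw [Matrix.diag_apply, Matrix.mul_apply]
  exact Finset.sum_congr rfl fun i _ => sq _

/-- Only the columns in `S` matter, and the covariance matrix of these columns has the same Ky Fan
norm as their Gram matrix `∑ a_i a_iᵀ`. -/
theorem spcaObjective_le {d : ℕ} (hd : d ≤ n) {U : Matrix (Fin n) (Fin d) ℝ} (hU : Uᵀ * U = 1)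
    {S : Finset (Fin n)} (hS : rowSupport U ⊆ S) :
    spcaObjective A U ≤ binaryObjective A d (incidence S) := by
  set B : Matrix (Fin r) (Fin n) ℝ := A * Matrix.diagonal (incidence S) with hB
  have hBU : B * U = A * U := by
    rw [hB, Matrix.mul_assoc]
    congr 1
    ext i j
    rw [Matrix.diagonal_mul]
    by_cases hi : i ∈ S
    · simp [incidence, hi]
    · have : U i j = 0 := by
        by_contra h
        refine hi (hS ?_)
        simp only [rowSupport, Finset.mem_filter, Finset.mem_univ, true_and]
        exact ⟨j, h⟩
      simp [this]
  have hgram : B * Bᵀ = columnGram A (incidence S) := by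
    ext p q
    rw [Matrix.mul_apply]
    simp only [hB, Matrix.transpose_apply, Matrix.mul_diagonal, columnGram, Matrix.sum_apply,
      Matrix.smul_apply, Matrix.vecMulVec_apply, smul_eq_mul]
    refine Finset.sum_congr rfl fun i _ => ?_
    by_cases hi : i ∈ S <;> simp [incidence, hi]
  have hobj : spcaObjective A U = spcaObjective B U := by simp only [spcaObjective, hBU]
  have hherm : (Bᵀ * B).IsHermitian := by simpa using isHermitian_mul_transpose Bᵀ
  have h1 := trace_le_kyFan hherm hd hU
  rw [← spcaObjective_eq_trace, ← hobj, ← kyFan_mul_transpose_comm B d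
    (isHermitian_mul_transpose B)] at h1
  refine h1.trans_eq ?_
  simp only [binaryObjective, hgram]

/-- The rows of `V`, placed at the positions given by `e`, all other rows being zero. -/
def spreadRows {s d : ℕ} (e : Fin s → Fin n) (V : Matrix (Fin s) (Fin d) ℝ) :
    Matrix (Fin n) (Fin d) ℝ :=
  Matrix.of fun i j => ∑ t, if e t = i then V t j else 0

theorem spreadRows_eq_mul {s d : ℕ} (e : Fin s → Fin n) (V : Matrix (Fin s) (Fin d) ℝ) :
    spreadRows e V = (Matrix.of fun i t => if e t = i then (1 : ℝ) else 0) * V := by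
  ext i j
  simp [spreadRows, Matrix.mul_apply]

theorem mul_transpose_submatrix {s : ℕ} {e : Fin s → Fin n} (he : Function.Injective e) :
    A.submatrix id e * (A.submatrix id e)ᵀ = columnGram A (incidence (Finset.univ.image e)) := by
  ext p q
  simp only [Matrix.mul_apply, Matrix.transpose_apply, columnGram, Matrix.sum_apply,
    Matrix.smul_apply,
    Matrix.vecMulVec_apply, smul_eq_mul, incidence, ite_mul, one_mul, zero_mul,
      Matrix.submatrix_apply, id]
  rw [← Finset.sum_filter, Finset.filter_mem_eq_inter, Finset.univ_inter, Finset.sum_image he.injOn]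

theorem kyFan_gram_submatrix {s : ℕ} {e : Fin s → Fin n} (he : Function.Injective e) (d : ℕ)
    (h : ((A.submatrix id e)ᵀ * A.submatrix id e).IsHermitian) :
    kyFan d h = binaryObjective A d (incidence (Finset.univ.image e)) := by
  rw [← kyFan_mul_transpose_comm _ d (isHermitian_mul_transpose _)]
  simp only [binaryObjective, mul_transpose_submatrix A he]

/-- Eigenvectors of the covariance matrix of an optimal support give an optimal solution. -/
theorem spcaOptimal_spreadRows {d s : ℕ} (hds : d ≤ s) {e : Fin s → Fin n}
    (he : Function.Injective e) (hopt : BinaryOptimal A d s (incidence (Finset.univ.image e)))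
    {V : Matrix (Fin s) (Fin d) ℝ} (hV : Vᵀ * V = 1)
    (h : ((A.submatrix id e)ᵀ * A.submatrix id e).IsHermitian)
    (hXV : ((A.submatrix id e)ᵀ * A.submatrix id e) * V = V * Matrix.diagonal fun j : Fin d =>
      h.eigenvalues₀ ⟨j, lt_of_lt_of_le j.2 (hds.trans_eq (Fintype.card_fin s).symm)⟩) :
    SPCAOptimal A s (spreadRows e V) ∧ rowSupport (spreadRows e V) ⊆ Finset.univ.image e ∧
      spcaObjective A (spreadRows e V) = binaryObjective A d (incidence (Finset.univ.image e)) := by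
  classical
  have hsn : s ≤ n := by simpa using Fintype.card_le_of_injective e he
  set P : Matrix (Fin n) (Fin s) ℝ := Matrix.of fun i t => if e t = i then (1 : ℝ) else 0 with hP
  have hPP : Pᵀ * P = 1 := by
    ext a b
    simp [hP, Matrix.mul_apply, Matrix.one_apply, he.eq_iff, eq_comm]
  have hAP : A * P = A.submatrix id e := by
    ext i t
    simp [hP, Matrix.mul_apply]
  have hsup : rowSupport (spreadRows e V) ⊆ Finset.univ.image e := by
    intro i hi
    simp only [rowSupport, Finset.mem_filter, Finset.mem_univ, true_and] at hi
    obtain ⟨j, hj⟩ := hi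
    simp only [spreadRows, Matrix.of_apply] at hj
    obtain ⟨t, -, ht⟩ := Finset.exists_ne_zero_of_sum_ne_zero hj
    refine Finset.mem_image.2 ⟨t, Finset.mem_univ _, ?_⟩
    by_contra h
    simp [h] at ht
  have hobj : spcaObjective A (spreadRows e V) = binaryObjective A d
      (incidence (Finset.univ.image e)) := by
    rw [← kyFan_gram_submatrix A he d h, ← trace_of_eigenpairs h hds hV hXV,
      ← spcaObjective_eq_trace, spreadRows_eq_mul]
    simp only [spcaObjective, ← Matrix.mul_assoc, ← hP, hAP]
  refine ⟨⟨⟨?_, ?_⟩, fun U hU => ?_⟩, hsup, hobj⟩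
  · rw [spreadRows_eq_mul, ← hP, Matrix.transpose_mul, Matrix.mul_assoc, ← Matrix.mul_assoc Pᵀ, hPP,
      Matrix.one_mul, hV]
  · refine (Finset.card_le_card hsup).trans (Finset.card_image_le.trans ?_)
    simp
  · rw [hobj]
    exact (spcaObjective_le A (hds.trans hsn) hU.1 subset_rfl).trans
      (hopt.2 _ (incidence_mem_binaryFeasible hU.2))

/-- An optimal solution of the binary problem of full size yields an optimal support. -/
theorem exists_spcaOptimal {d s : ℕ} (hds : d ≤ s) {S : Finset (Fin n)} (hS : S.card = s)
    (hopt : BinaryOptimal A d s (incidence S)) :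
    ∃ U : Matrix (Fin n) (Fin d) ℝ, SPCAOptimal A s U ∧ rowSupport U ⊆ S ∧
      spcaObjective A U = binaryObjective A d (incidence S) := by
  have he : Function.Injective fun t => (S.orderIsoOfFin hS t : Fin n) :=
    Subtype.val_injective.comp (S.orderIsoOfFin hS).injective
  have himg : Finset.univ.image (fun t => (S.orderIsoOfFin hS t : Fin n)) = S := by
    ext i
    simp only [Finset.mem_image, Finset.mem_univ, true_and]
    constructor
    · rintro ⟨t, rfl⟩; exact (S.orderIsoOfFin hS t).2
    · intro hi
      exact ⟨(S.orderIsoOfFin hS).symm ⟨i, hi⟩, by simp⟩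
  set e : Fin s → Fin n := fun t => (S.orderIsoOfFin hS t : Fin n) with hedef
  have h : ((A.submatrix id e)ᵀ * A.submatrix id e).IsHermitian := by
    simpa using isHermitian_mul_transpose (A.submatrix id e)ᵀ
  obtain ⟨V, hV, hXV⟩ := exists_eigenpairs h hds
  rw [← himg] at hopt ⊢
  exact ⟨_, spcaOptimal_spreadRows A hds he hopt hV h hXV⟩

end Binary

section PencilEnumeration

open Filter Topology

/-! ### Determinants as alternating forms in their first two rows -/

/-- The determinant with rows `x`, `y`, `Q 0`, `Q 1`, …, as a bilinear form in `x` and `y`. -/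
noncomputable def detForm {m : ℕ} (Q : Fin m → Fin (m + 2) → ℝ) (x y : Fin (m + 2) → ℝ) : ℝ :=
  Matrix.det (Matrix.of (Fin.cons x (Fin.cons y Q) : Fin (m + 2) → Fin (m + 2) → ℝ))

section detForm

variable {m : ℕ} (Q : Fin m → Fin (m + 2) → ℝ) (x y z : Fin (m + 2) → ℝ)

theorem detForm_eq_curry : detForm Q x y =
    (((Matrix.detRowAlternating (R := ℝ) (n := Fin (m + 2))).curryLeft x).curryLeft y) Q := rfl

theorem detForm_add_left : detForm Q (x + y) z = detForm Q x z + detForm Q y z := by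
  simp only [detForm_eq_curry, map_add, AlternatingMap.curryLeft_add, LinearMap.add_apply,
    AlternatingMap.add_apply]

theorem detForm_smul_left (c : ℝ) : detForm Q (c • x) z = c * detForm Q x z := by
  simp only [detForm_eq_curry, map_smul, AlternatingMap.curryLeft_smul, LinearMap.smul_apply,
    AlternatingMap.smul_apply, smul_eq_mul]

theorem detForm_self : detForm Q x x = 0 := by
  simp [detForm_eq_curry]

theorem detForm_sum_left {ι : Type*} (s : Finset ι) (f : ι → Fin (m + 2) → ℝ) :
    detForm Q (∑ i ∈ s, f i) z = ∑ i ∈ s, detForm Q (f i) z := by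
  simp only [detForm_eq_curry, map_sum]
  classical
  induction s using Finset.induction_on with
  | empty => simp [AlternatingMap.curryLeft_zero]
  | insert a s ha ih =>
    rw [Finset.sum_insert ha, Finset.sum_insert ha, AlternatingMap.curryLeft_add, ← ih]; rfl

theorem detForm_swap : detForm Q y x = - detForm Q x y := by
  have h : Matrix.of (Fin.cons y (Fin.cons x Q) : Fin (m + 2) → Fin (m + 2) → ℝ) =
      (Matrix.of (Fin.cons x (Fin.cons y Q) : Fin (m + 2) → Fin (m + 2) → ℝ)).submatrix
        (Equiv.swap 0 1) id := by
    ext i j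
    refine Fin.cases ?_ (fun i => Fin.cases ?_ (fun i => ?_) i) i
    · simp
    · simp
    · rw [Matrix.submatrix_apply, Equiv.swap_apply_of_ne_of_ne]
      · rfl
      · exact Fin.succ_ne_zero _
      · intro h; have := congrArg Fin.val h; simp at this
  rw [detForm, h, Matrix.det_permute]
  simp [detForm]

theorem detForm_left_eq_zero (a : Fin m) : detForm Q (Q a) z = 0 := by
  refine Matrix.det_zero_of_row_eq (i := 0) (j := a.succ.succ) (Fin.succ_ne_zero _).symm ?_
  rfl

/-- The three-term Grassmann–Plücker relation. -/
theorem detForm_plucker {a b : Fin (m + 2) → ℝ} (hab : detForm Q a b ≠ 0) :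
    detForm Q a b * detForm Q x y =
      detForm Q a x * detForm Q b y - detForm Q a y * detForm Q b x := by
  -- every vector is a combination of the rows `a`, `b`, `Q 0`, …
  have span : ∀ v : Fin (m + 2) → ℝ, ∃ α β : ℝ, ∀ w,
      detForm Q v w = α * detForm Q a w + β * detForm Q b w := by
    intro v
    set M : Matrix (Fin (m + 2)) (Fin (m + 2)) ℝ :=
      Matrix.of (Fin.cons a (Fin.cons b Q) : Fin (m + 2) → Fin (m + 2) → ℝ) with hM
    have hu : IsUnit M.det := isUnit_iff_ne_zero.2 hab
    set c := v ᵥ* M⁻¹ with hc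
    have hv : v = c ᵥ* M := by
      rw [hc, Matrix.vecMul_vecMul, Matrix.nonsing_inv_mul _ hu, Matrix.vecMul_one]
    have hv' : v = c 0 • a + (c 1 • b + ∑ i : Fin m, c i.succ.succ • Q i) := by
      rw [hv, Matrix.vecMul_eq_sum, Fin.sum_univ_succ, Fin.sum_univ_succ]
      rfl
    refine ⟨c 0, c 1, fun w => ?_⟩
    rw [hv', detForm_add_left, detForm_add_left, detForm_sum_left, detForm_smul_left,
      detForm_smul_left,
      Finset.sum_eq_zero, add_zero]
    intro i _
    rw [detForm_smul_left, detForm_left_eq_zero, mul_zero]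
  obtain ⟨α, β, hx⟩ := span x
  rw [hx y, detForm_swap Q x a, detForm_swap Q x b, hx a, hx b, detForm_self, detForm_self,
    detForm_swap Q a b]
  ring

end detForm

/-! ### Extreme separating hyperplanes -/

/-- A linear form `w` that is nonnegative on the vectors with index in `S` and nonpositive on the
others can be moved until it vanishes on `d` of them: among the forms with this sign pattern, take
one with as many zeros as possible. If it had fewer than `d` zeros, it could be moved in a
direction that preserves its zeros until a further vector is reached. -/
theorem exists_separating_many_zeros {N d : ℕ} (q : Fin N → Fin (d + 1) → ℝ) (hN : d + 1 ≤ N)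
    (hq : ∀ e : Fin (d + 1) → Fin N, Function.Injective e →
      (Matrix.of fun a => q (e a)).det ≠ 0)
    (S : Set (Fin N)) (w : Fin (d + 1) → ℝ) (hw : w ≠ 0)
    (h1 : ∀ k ∈ S, 0 ≤ w ⬝ᵥ q k) (h2 : ∀ k ∉ S, w ⬝ᵥ q k ≤ 0) :
    ∃ (w' : Fin (d + 1) → ℝ) (I : Fin d → Fin N), w' ≠ 0 ∧ Function.Injective I ∧
      (∀ a, w' ⬝ᵥ q (I a) = 0) ∧ (∀ k ∈ S, 0 ≤ w' ⬝ᵥ q k) ∧ (∀ k ∉ S, w' ⬝ᵥ q k ≤ 0) := by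
  classical
  -- `T w` is the set of indices where `w` vanishes; its cardinality is maximized
  let good : (Fin (d + 1) → ℝ) → Prop := fun w =>
    w ≠ 0 ∧ (∀ k ∈ S, 0 ≤ w ⬝ᵥ q k) ∧ (∀ k ∉ S, w ⬝ᵥ q k ≤ 0)
  let T : (Fin (d + 1) → ℝ) → Finset (Fin N) := fun w => Finset.univ.filter fun k => w ⬝ᵥ q k = 0
  have hex : ∃ c, ∃ w, good w ∧ (T w).card = c := ⟨_, w, ⟨hw, h1, h2⟩, rfl⟩
  have hbd : ∀ c, (∃ w, good w ∧ (T w).card = c) → c ≤ N := by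
    rintro c ⟨w, _, rfl⟩
    simpa using Finset.card_le_univ (T w)
  obtain ⟨w, hg, hwc⟩ := Nat.findGreatest_spec (P := fun c => ∃ w, good w ∧ (T w).card = c)
    (hbd _ hex.choose_spec) hex.choose_spec
  have hmax : ∀ w', good w' → (T w').card ≤ (T w).card := by
    intro w' hw'
    rw [hwc]
    exact Nat.le_findGreatest (hbd _ ⟨w', hw', rfl⟩) ⟨w', hw', rfl⟩
  have hcard : d ≤ (T w).card := by
    by_contra hlt
    push Not at hlt
    -- the form `u` vanishes wherever `w` does, and is not a multiple of `w`
    obtain ⟨u, hu0, huT, huw⟩ : ∃ u : Fin (d + 1) → ℝ, u ≠ 0 ∧ (∀ k ∈ T w, u ⬝ᵥ q k = 0) ∧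
        u ⬝ᵥ w = 0 := by
      let L : (Fin (d + 1) → ℝ) →ₗ[ℝ] ((T w → ℝ) × ℝ) :=
        { toFun := fun u => (fun k => u ⬝ᵥ q k, u ⬝ᵥ w)
          map_add' := fun u v => by ext <;> simp [add_dotProduct]
          map_smul' := fun c u => by ext <;> simp [smul_dotProduct] }
      have hnot : ¬ Function.Injective L := by
        intro hinj
        have := LinearMap.finrank_le_finrank_of_injective hinj
        simp at this
        omega
      rw [← LinearMap.ker_eq_bot] at hnot
      obtain ⟨u, hu, hu0⟩ := Submodule.exists_mem_ne_zero_of_ne_bot hnot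
      have hu' : L u = 0 := hu
      refine ⟨u, hu0, fun k hk => ?_, congrArg Prod.snd hu'⟩
      exact congrFun (congrArg Prod.fst hu') ⟨k, hk⟩
    have hnz : ∃ k, u ⬝ᵥ q k ≠ 0 := by
      by_contra hall
      push Not at hall
      refine hq (Fin.castLE hN) (Fin.castLE_injective hN) ?_
      exact Matrix.exists_mulVec_eq_zero_iff.1 ⟨u, hu0, by
        ext a; simpa [Matrix.mulVec, dotProduct_comm] using hall (Fin.castLE hN a)⟩
    -- orient `u` so that adding it decreases some slack
    obtain ⟨u, hu0, huT, huw, k0, hk0⟩ : ∃ u : Fin (d + 1) → ℝ, u ≠ 0 ∧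
        (∀ k ∈ T w, u ⬝ᵥ q k = 0) ∧ u ⬝ᵥ w = 0 ∧ ∃ k, (w ⬝ᵥ q k) * (u ⬝ᵥ q k) < 0 := by
      obtain ⟨k, hk⟩ := hnz
      have hwk : w ⬝ᵥ q k ≠ 0 := fun h => hk (huT k (by simp [T, h]))
      rcases lt_or_gt_of_ne (mul_ne_zero hwk hk) with h | h
      · exact ⟨u, hu0, huT, huw, k, h⟩
      · refine ⟨-u, by simpa using hu0, fun k hk => by simp [huT k hk], by simp [huw], k, ?_⟩
        simp only [neg_dotProduct, mul_neg]; linarith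
    let B : Finset (Fin N) := Finset.univ.filter fun k => (w ⬝ᵥ q k) * (u ⬝ᵥ q k) < 0
    obtain ⟨k1, hk1, hmin⟩ := B.exists_min_image (fun k => -(w ⬝ᵥ q k) / (u ⬝ᵥ q k))
      ⟨k0, by simp [B, hk0]⟩
    -- `w + t • u` vanishes at `k1`, and no value has changed its sign before
    set t := -(w ⬝ᵥ q k1) / (u ⬝ᵥ q k1) with ht
    have hk1' : (w ⬝ᵥ q k1) * (u ⬝ᵥ q k1) < 0 := by simpa [B] using hk1
    have hu1 : u ⬝ᵥ q k1 ≠ 0 := fun h => by simp [h] at hk1'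
    have ht0 : 0 < t := by
      have : t = -((w ⬝ᵥ q k1) * (u ⬝ᵥ q k1)) / (u ⬝ᵥ q k1) ^ 2 := by rw [ht]; field_simp
      rw [this]; exact div_pos (by linarith) (by positivity)
    have heval : ∀ k, (w + t • u) ⬝ᵥ q k = w ⬝ᵥ q k + t * (u ⬝ᵥ q k) := fun k => by
      simp [add_dotProduct, smul_dotProduct]
    have hgood : good (w + t • u) := by
      refine ⟨fun h0 => ?_, fun k hk => ?_, fun k hk => ?_⟩
      -- `u` is orthogonal to `w`, so `w + t • u = 0` would give `u = 0`
      · have := congrArg (fun v => u ⬝ᵥ v) h0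
        simp [dotProduct_add, huw, ht0.ne'] at this
        exact hu0 this
      · rw [heval]
        have hwk := hg.2.1 k hk
        by_cases hb : (w ⬝ᵥ q k) * (u ⬝ᵥ q k) < 0
        · have h3 := hmin k (by simp [B, hb])
          have hu2 : u ⬝ᵥ q k < 0 := by
            by_contra h; push Not at h; nlinarith [mul_nonneg hwk h]
          rw [le_div_iff_of_neg hu2] at h3; linarith
        · push Not at hb
          rcases hwk.eq_or_lt with h | h
          · have : u ⬝ᵥ q k = 0 := huT k (by simp [T, ← h])
            simp [← h, this]
          · have : 0 ≤ u ⬝ᵥ q k := nonneg_of_mul_nonneg_right hb h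
            positivity
      · rw [heval]
        have hwk := hg.2.2 k hk
        by_cases hb : (w ⬝ᵥ q k) * (u ⬝ᵥ q k) < 0
        · have h3 := hmin k (by simp [B, hb])
          have hu2 : 0 < u ⬝ᵥ q k := by
            by_contra h; push Not at h; nlinarith [mul_nonneg_of_nonpos_of_nonpos hwk h]
          rw [le_div_iff₀ hu2] at h3; linarith
        · push Not at hb
          rcases hwk.eq_or_lt with h | h
          · have : u ⬝ᵥ q k = 0 := huT k (by simp [T, h])
            simp [h, this]
          · have : u ⬝ᵥ q k ≤ 0 := nonpos_of_mul_nonneg_right hb h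
            nlinarith [mul_nonneg ht0.le (neg_nonneg.2 this)]
    have hsub : T w ⊂ T (w + t • u) := by
      refine (Finset.ssubset_iff_of_subset fun k hk => ?_).2 ⟨k1, ?_, ?_⟩
      · have : w ⬝ᵥ q k = 0 := by simpa [T] using hk
        simp [T, heval, this, huT k hk]
      · simp only [T, Finset.mem_filter, Finset.mem_univ, true_and]
        rw [heval, ht]
        field_simp; ring
      · intro hk
        have : w ⬝ᵥ q k1 = 0 := by simpa [T] using hk
        simp [this] at hk1'
    exact absurd (hmax _ hgood) (not_le.2 (Finset.card_lt_card hsub))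
  obtain ⟨T', hT', hT'c⟩ := Finset.exists_subset_card_eq hcard
  refine ⟨w, fun a => (T'.orderIsoOfFin hT'c a : Fin N), hg.1, ?_, fun a => ?_, hg.2.1, hg.2.2⟩
  · exact Subtype.val_injective.comp (T'.orderIsoOfFin hT'c).injective
  · have := hT' (T'.orderIsoOfFin hT'c a).2
    simpa [T] using this

/-! ### Points in general position by symbolic perturbation -/

/-- The sign of a nonzero polynomial is constant to the right of `0`. -/
theorem Polynomial.eventually_pos_or_neg {p : Polynomial ℝ} (hp : p ≠ 0) :
    (∀ᶠ ε in 𝓝[>] (0 : ℝ), 0 < p.eval ε) ∨ (∀ᶠ ε in 𝓝[>] (0 : ℝ), p.eval ε < 0) := by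
  obtain ⟨q, hq, hdvd⟩ := Polynomial.exists_eq_pow_rootMultiplicity_mul_and_not_dvd p hp 0
  have hq0 : q.eval 0 ≠ 0 := fun h => hdvd (Polynomial.dvd_iff_isRoot.2 h)
  have hev : ∀ ε, p.eval ε = ε ^ p.rootMultiplicity 0 * q.eval ε := fun ε => by
    conv_lhs => rw [hq]
    simp
  have hpos : ∀ᶠ ε in 𝓝[>] (0 : ℝ), 0 < ε := self_mem_nhdsWithin
  have hcont : Tendsto (fun ε => q.eval ε) (𝓝[>] 0) (𝓝 (q.eval 0)) :=
    (q.continuous.tendsto 0).mono_left nhdsWithin_le_nhds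
  rcases lt_or_gt_of_ne hq0 with h | h
  · right
    filter_upwards [hpos, hcont.eventually (gt_mem_nhds h)] with ε h1 h2
    rw [hev]; exact mul_neg_of_pos_of_neg (pow_pos h1 _) h2
  · left
    filter_upwards [hpos, hcont.eventually (lt_mem_nhds h)] with ε h1 h2
    rw [hev]; exact mul_pos (pow_pos h1 _) h2

section Perturbation

variable {m : ℕ}

/-- The homogeneous coordinates `(1, b i)` of the `i`-th point, perturbed by `ε` times the point
`(1, i, i², …)` of the moment curve. -/
noncomputable def perturbed (b : ℕ → Fin (m + 1) → ℝ) (ε : ℝ) (i : ℕ) : Fin (m + 2) → ℝ :=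
  fun k => (Fin.cons 1 (b i) : Fin (m + 2) → ℝ) k + ε * (i : ℝ) ^ (k : ℕ)

/-- The orientation determinant of the perturbed points `x`, `y`, `I 0`, `I 1`, …. -/
noncomputable def orientation (b : ℕ → Fin (m + 1) → ℝ) (ε : ℝ) (I : Fin m → ℕ) (x y : ℕ) : ℝ :=
  detForm (fun a => perturbed b ε (I a)) (perturbed b ε x) (perturbed b ε y)

/-- For `σ = true`: for all small positive perturbations, the points `x`, `y`, `I` are positively
oriented; for `σ = false` the roles of `x` and `y` are exchanged.  In other words, `y` lies
strictly on the side `σ` of the hyperplane through the points `x` and `I`. -/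
def OnSide (b : ℕ → Fin (m + 1) → ℝ) (I : Fin m → ℕ) (σ : Bool) (x y : ℕ) : Prop :=
  ∀ᶠ ε in 𝓝[>] (0 : ℝ), 0 < if σ then orientation b ε I x y else orientation b ε I y x

theorem orientation_eq (b : ℕ → Fin (m + 1) → ℝ) (ε : ℝ) (I : Fin m → ℕ) (x y : ℕ) :
    orientation b ε I x y =
      (Matrix.of fun a => perturbed b ε ((Fin.cons x (Fin.cons y I) : Fin (m + 2) → ℕ) a)).det := by
  unfold orientation detForm
  congr 1
  ext a k
  refine Fin.cases rfl (fun a => Fin.cases rfl (fun a => rfl) a) a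

theorem orientation_swap (b : ℕ → Fin (m + 1) → ℝ) (ε : ℝ) (I : Fin m → ℕ) (x y : ℕ) :
    orientation b ε I y x = - orientation b ε I x y := detForm_swap _ _ _

/-- The orientation of the perturbed points is a polynomial in the perturbation parameter, with a
Vandermonde determinant as leading coefficient. -/
theorem exists_polynomial_orientation (b : ℕ → Fin (m + 1) → ℝ) (I : Fin m → ℕ) (x y : ℕ) :
    ∃ p : Polynomial ℝ, (∀ ε, p.eval ε = orientation b ε I x y) ∧
      (Function.Injective (Fin.cons x (Fin.cons y I) : Fin (m + 2) → ℕ) → p ≠ 0) := by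
  set rows : Fin (m + 2) → ℕ := Fin.cons x (Fin.cons y I) with hrows
  let V : Matrix (Fin (m + 2)) (Fin (m + 2)) ℝ := Matrix.vandermonde fun a => (rows a : ℝ)
  let B : Matrix (Fin (m + 2)) (Fin (m + 2)) ℝ :=
    Matrix.of fun a => (Fin.cons 1 (b (rows a)) : Fin (m + 2) → ℝ)
  refine ⟨((Polynomial.X : Polynomial ℝ) • V.map Polynomial.C + B.map Polynomial.C).det,
    fun ε => ?_, fun hinj h0 => ?_⟩
  · rw [orientation_eq, ← Polynomial.coe_evalRingHom, RingHom.map_det]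
    congr 1
    ext a k
    simp [V, B, perturbed, Matrix.vandermonde_apply, add_comm, hrows]
  · have h1 := Polynomial.coeff_det_X_add_C_card V B
    rw [h0, Polynomial.coeff_zero] at h1
    refine Matrix.det_vandermonde_ne_zero_iff.2 ?_ h1.symm
    exact Nat.cast_injective.comp hinj

/-- The perturbation `ε` represents all sufficiently small ones, as far as the orientations of the
first `N` points are concerned, and brings these points into general position. -/
structure IsGeneric (b : ℕ → Fin (m + 1) → ℝ) (N : ℕ) (ε : ℝ) : Prop where
  onSide_iff : ∀ (I : Fin m → ℕ), (∀ a, I a < N) → ∀ σ, ∀ x < N, ∀ y < N,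
    (OnSide b I σ x y ↔ 0 < if σ then orientation b ε I x y else orientation b ε I y x)
  orientation_ne_zero : ∀ (I : Fin m → ℕ), (∀ a, I a < N) → ∀ x < N, ∀ y < N,
    Function.Injective (Fin.cons x (Fin.cons y I) : Fin (m + 2) → ℕ) → orientation b ε I x y ≠ 0

/-- Each of the finitely many orientations is a polynomial in `ε`, nonzero if the points are
distinct, and hence of constant nonzero sign for small positive `ε`. -/
theorem eventually_isGeneric (b : ℕ → Fin (m + 1) → ℝ) (N : ℕ) :
    ∀ᶠ ε in 𝓝[>] (0 : ℝ), IsGeneric b N ε := by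
  have sign : ∀ (I : Fin m → ℕ) (x y : ℕ), ∀ᶠ ε in 𝓝[>] (0 : ℝ),
      ((∀ᶠ ε in 𝓝[>] (0 : ℝ), 0 < orientation b ε I x y) ↔ 0 < orientation b ε I x y) := by
    intro I x y
    obtain ⟨p, hp, -⟩ := exists_polynomial_orientation b I x y
    simp only [← hp]
    by_cases h0 : p = 0
    -- the filter is proper, so the zero polynomial is not eventually positive
    · simpa [h0] using (inferInstance : (𝓝[>] (0 : ℝ)).NeBot).ne
    · rcases Polynomial.eventually_pos_or_neg h0 with h | h
      · filter_upwards [h] with ε hε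
        simp [hε, h]
      · filter_upwards [h] with ε hε
        refine ⟨fun h' => ?_, fun h' => absurd h' hε.le.not_gt⟩
        obtain ⟨δ, h1, h2⟩ := (h.and h').exists
        exact absurd h1 h2.le.not_gt
  have nonzero : ∀ (I : Fin m → ℕ) (x y : ℕ), ∀ᶠ ε in 𝓝[>] (0 : ℝ),
      (Function.Injective (Fin.cons x (Fin.cons y I) : Fin (m + 2) → ℕ) →
        orientation b ε I x y ≠ 0) := by
    intro I x y
    obtain ⟨p, hp, hp0⟩ := exists_polynomial_orientation b I x y
    simp only [← hp]
    by_cases hinj : Function.Injective (Fin.cons x (Fin.cons y I) : Fin (m + 2) → ℕ)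
    · rcases Polynomial.eventually_pos_or_neg (hp0 hinj) with h | h
      · filter_upwards [h] with ε hε _ using hε.ne'
      · filter_upwards [h] with ε hε _ using hε.ne
    · simp [hinj]
  have all : ∀ᶠ ε in 𝓝[>] (0 : ℝ), ∀ z : (Fin m → Fin N) × Fin N × Fin N,
      ((∀ᶠ ε in 𝓝[>] (0 : ℝ), 0 < orientation b ε (fun a => z.1 a) z.2.1 z.2.2) ↔
        0 < orientation b ε (fun a => z.1 a) z.2.1 z.2.2) ∧
      (Function.Injective (Fin.cons (z.2.1 : ℕ) (Fin.cons (z.2.2 : ℕ) fun a => (z.1 a : ℕ)) :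
        Fin (m + 2) → ℕ) → orientation b ε (fun a => z.1 a) z.2.1 z.2.2 ≠ 0) :=
    eventually_all.2 fun z => (sign _ _ _).and (nonzero _ _ _)
  filter_upwards [all] with ε h
  refine ⟨fun I hI σ x hx y hy => ?_, fun I hI x hx y hy =>
    (h (fun a => ⟨I a, hI a⟩, ⟨x, hx⟩, ⟨y, hy⟩)).2⟩
  cases σ
  · simpa [OnSide] using (h (fun a => ⟨I a, hI a⟩, ⟨y, hy⟩, ⟨x, hx⟩)).1
  · simpa [OnSide] using (h (fun a => ⟨I a, hI a⟩, ⟨x, hx⟩, ⟨y, hy⟩)).1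

/-! ### The rotational order of a pencil of hyperplanes -/

/-- `lt` is a strict total order on the natural numbers satisfying `C`. -/
structure IsStrictTotalOn (C : ℕ → Prop) (lt : ℕ → ℕ → Prop) : Prop where
  asymm : ∀ x y, C x → C y → lt x y → ¬ lt y x
  trans : ∀ x y z, C x → C y → C z → lt x y → lt y z → lt x z
  total : ∀ x y, C x → C y → x ≠ y → lt x y ∨ lt y x

theorem injective_cons_cons {I : Fin m → ℕ} {x y : ℕ} :
    Function.Injective (Fin.cons x (Fin.cons y I) : Fin (m + 2) → ℕ) ↔
      x ≠ y ∧ (∀ a, I a ≠ x) ∧ (∀ a, I a ≠ y) ∧ Function.Injective I := by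
  simp only [Fin.cons_injective_iff, Set.mem_range, not_exists]
  constructor
  · rintro ⟨h1, h2, h3⟩
    exact ⟨fun h => h1 0 h.symm, fun a => h1 a.succ, h2, h3⟩
  · rintro ⟨h1, h2, h3, h4⟩
    exact ⟨Fin.cases h1.symm h2, h3, h4⟩

theorem orientation_eq_zero_left {b : ℕ → Fin (m + 1) → ℝ} {ε : ℝ} {I : Fin m → ℕ} {x y : ℕ}
    (h : ∃ a, I a = x) : orientation b ε I x y = 0 := by
  obtain ⟨a, rfl⟩ := h
  exact detForm_left_eq_zero _ _ a

theorem orientation_eq_zero_right {b : ℕ → Fin (m + 1) → ℝ} {ε : ℝ} {I : Fin m → ℕ} {x y : ℕ}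
    (h : ∃ a, I a = y) : orientation b ε I x y = 0 := by
  rw [orientation_swap, orientation_eq_zero_left h, neg_zero]

/-- The hyperplanes through the points `I` and one further point are linearly ordered by rotation
around `I`, as long as the further point stays on one side `c` of the hyperplane through `z` and
`I`. Transitivity is the Plücker relation: with `z` as reference, the orientation of `x` and `w` is
a combination of those of `x`, `y` and of `y`, `w` with coefficients of known sign. -/
theorem isStrictTotalOn_onSide {b : ℕ → Fin (m + 1) → ℝ} {N : ℕ} {I : Fin m → ℕ}
    (hI : ∀ a, I a < N) (hinj : Function.Injective I) {z : ℕ} (hz : z < N) (c σ : Bool) :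
    IsStrictTotalOn (fun x => x < N ∧ OnSide b I c z x) (OnSide b I σ) := by
  obtain ⟨ε, hε⟩ := (eventually_isGeneric b N).exists
  have plucker : ∀ x y w, orientation b ε I z y ≠ 0 →
      orientation b ε I z y * orientation b ε I x w = orientation b ε I z x * orientation b ε I y w -
        orientation b ε I z w * orientation b ε I y x :=
    fun x y w h => detForm_plucker _ _ _ h
  have hcl : ∀ x, x < N ∧ OnSide b I c z x → x < N ∧
      0 < if c then orientation b ε I z x else - orientation b ε I z x := by
    rintro x ⟨hx, h⟩
    rw [hε.onSide_iff I hI _ _ hz _ hx, orientation_swap b ε I z x] at h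
    exact ⟨hx, h⟩
  have hlt : ∀ x y, x < N → y < N → (OnSide b I σ x y ↔
      0 < if σ then orientation b ε I x y else - orientation b ε I x y) := by
    intro x y hx hy
    rw [hε.onSide_iff I hI _ _ hx _ hy, orientation_swap b ε I x y]
  have hne : ∀ x, (0 < if c then orientation b ε I z x else - orientation b ε I z x) →
      orientation b ε I z x ≠ 0 := by
    intro x h h0
    simp [h0] at h
  refine ⟨fun x y hx hy h h' => ?_, fun x y w hx hy hw h h' => ?_, fun x y hx hy hxy => ?_⟩
  · rw [hlt _ _ hx.1 hy.1] at h
    rw [hlt _ _ hy.1 hx.1, orientation_swap b ε I x y] at h'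
    cases σ <;> simp at h h' <;> linarith
  · have hx := hcl x hx
    have hy := hcl y hy
    have hw := hcl w hw
    rw [hlt _ _ hx.1 hy.1] at h
    rw [hlt _ _ hy.1 hw.1] at h'
    rw [hlt _ _ hx.1 hw.1]
    have hp := plucker x y w (hne y hy.2)
    rw [orientation_swap b ε I x y] at hp
    have hx := hx.2
    have hy := hy.2
    have hw := hw.2
    -- in each case the two sides of the Plücker relation would have different signs
    cases c <;> cases σ <;> simp at h h' hx hy hw ⊢ <;> by_contra hcon <;> push Not at hcon
    · nlinarith [mul_nonneg_of_nonpos_of_nonpos hy.le (neg_nonpos.2 hcon),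
        mul_pos_of_neg_of_neg hx h', mul_pos_of_neg_of_neg hw h]
    · nlinarith [mul_nonneg_of_nonpos_of_nonpos hy.le hcon, mul_neg_of_neg_of_pos hx h',
        mul_neg_of_neg_of_pos hw h]
    · nlinarith [mul_nonneg hy.le hcon, mul_neg_of_pos_of_neg hx h', mul_neg_of_pos_of_neg hw h]
    · nlinarith [mul_nonneg hy.le (neg_nonneg.2 hcon), mul_pos hx h', mul_pos hw h]
  · have hx := hcl x hx
    have hy := hcl y hy
    rw [hlt _ _ hx.1 hy.1, hlt _ _ hy.1 hx.1, orientation_swap b ε I x y]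
    have h0 : orientation b ε I x y ≠ 0 := by
      refine hε.orientation_ne_zero I hI x hx.1 y hy.1 (injective_cons_cons.2 ⟨hxy, ?_, ?_, hinj⟩)
      · exact fun a ha => hne x hx.2 (orientation_eq_zero_right ⟨a, ha⟩)
      · exact fun a ha => hne y hy.2 (orientation_eq_zero_right ⟨a, ha⟩)
    cases σ <;> rcases lt_or_gt_of_ne h0 with h | h <;> simp [h]

end Perturbation

/-! ### Sets cut off by hyperplanes through given points -/

section CutSet

variable {m : ℕ}

/-- The points with index below `n` that lie strictly on side `σ` of the hyperplane through `j` and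
`I`, together with those points among `j`, `I` that are selected by `J`. -/
noncomputable def cutSet (b : ℕ → Fin (m + 1) → ℝ) (n : ℕ) (I : Fin m → ℕ) (σ : Bool) (j : ℕ)
    (J : Finset (Fin (m + 1))) : Finset ℕ :=
  open Classical in (Finset.range n).filter fun i =>
    (∃ a ∈ J, (Fin.cons j I : Fin (m + 1) → ℕ) a = i) ∨ OnSide b I σ j i

/-- Besides the `n` given points there are `m + 2` further ones, with indices `n`, …, `n + m + 1`.
The hyperplane through `j` and `I` has at most `s + m + 2` points strictly on its side `σ`, and `j`
belongs to a class, with respect to the reference point `z`, on which the hyperplanes through `I`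
are linearly ordered. The bound allows for `s` of the given points and all the further ones. -/
structure IsShallow (b : ℕ → Fin (m + 1) → ℝ) (n s : ℕ) (I : Fin m → ℕ) (z : ℕ) (c σ : Bool)
    (j : ℕ) : Prop where
  lt_I : ∀ a, I a < n + (m + 2)
  lt_j : j < n + (m + 2)
  mem_class : OnSide b I c z j
  order : IsStrictTotalOn (fun x => x < n + (m + 2) ∧ OnSide b I c z x) (OnSide b I σ)
  card_le : ∀ T : Finset ℕ, (∀ x ∈ T, x < n + (m + 2) ∧ OnSide b I σ j x) → T.card ≤ s + m + 2

/-- For every function on a finite set some subset of given size consists of largest values. -/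
theorem exists_threshold {n s : ℕ} (hs : 1 ≤ s) (hsn : s ≤ n) (f : ℕ → ℝ) :
    ∃ (S : Finset ℕ) (l : ℝ), S ⊆ Finset.range n ∧ S.card = s ∧
      (∀ i ∈ S, l ≤ f i) ∧ (∀ i < n, i ∉ S → f i ≤ l) ∧
      ∀ T ⊆ Finset.range n, T.card = s → ∑ i ∈ T, f i ≤ ∑ i ∈ S, f i := by
  have hne : ((Finset.range n).powersetCard s).Nonempty := by
    rw [Finset.powersetCard_nonempty]; simpa using hsn
  obtain ⟨S, hS, hmax⟩ := Finset.exists_max_image _ (fun T => ∑ i ∈ T, f i) hne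
  rw [Finset.mem_powersetCard] at hS
  have hSne : S.Nonempty := by rw [← Finset.card_pos]; omega
  obtain ⟨i0, hi0, hmin⟩ := S.exists_min_image f hSne
  refine ⟨S, f i0, hS.1, hS.2, hmin, fun i hi hiS => ?_, fun T hT hTc =>
    hmax T (Finset.mem_powersetCard.2 ⟨hT, hTc⟩)⟩
  -- exchange `i0` for `i`
  have hi' : i ∉ S.erase i0 := fun h => hiS (Finset.mem_of_mem_erase h)
  have h := hmax (insert i (S.erase i0)) (Finset.mem_powersetCard.2 ⟨?_, ?_⟩)
  · simp only [Finset.sum_insert hi', ← Finset.add_sum_erase S f hi0] at h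
    linarith
  · intro x hx
    rcases Finset.mem_insert.1 hx with rfl | hx
    · simpa using hi
    · exact hS.1 (Finset.mem_of_mem_erase hx)
  · rw [Finset.card_insert_of_notMem hi', Finset.card_erase_of_mem hi0]; omega

/-- At a generic perturbation, the largest values of a nonzero linear functional are attained on a
set cut off by a shallow hyperplane.  The threshold of the functional defines a hyperplane that
separates the largest values from the others; it is moved until it contains `m + 1` of the points.
By general position it contains no others, so one of the `m + 2` further points remains as reference
point, and `J` decides which of the points on the hyperplane belong to the set. -/
theorem IsGeneric.exists_cutSet {b : ℕ → Fin (m + 1) → ℝ} {n s : ℕ} {ε : ℝ} (hε0 : 0 < ε)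
    (hε : IsGeneric b (n + (m + 2)) ε) (hs : 1 ≤ s) (hsn : s ≤ n) {c : Fin (m + 1) → ℝ}
    (hc : c ≠ 0) :
    ∃ I z cl σ j J, n ≤ z ∧ z < n + (m + 2) ∧ IsShallow b n s I z cl σ j ∧
      (cutSet b n I σ j J).card = s ∧
      ∀ T ⊆ Finset.range n, T.card = s →
        ∑ i ∈ T, c ⬝ᵥ (fun k => b i k + ε * (i : ℝ) ^ ((k : ℕ) + 1)) ≤
        ∑ i ∈ cutSet b n I σ j J, c ⬝ᵥ (fun k => b i k + ε * (i : ℝ) ^ ((k : ℕ) + 1)) := by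
  classical
  set f : ℕ → ℝ := fun i => c ⬝ᵥ (fun k => b i k + ε * (i : ℝ) ^ ((k : ℕ) + 1)) with hf
  obtain ⟨S0, l, hS0, hS0c, hge, hle, hmax⟩ := exists_threshold hs hsn f
  set N := n + (m + 2) with hN
  -- the threshold `l` becomes a linear form in homogeneous coordinates, of which the first one is
  -- perturbed to `1 + ε`
  set w : Fin (m + 2) → ℝ := Fin.cons (-l / (1 + ε)) c with hw
  have hwdot : ∀ i, w ⬝ᵥ perturbed b ε i = f i - l := by
    intro i
    rw [hw, dotProduct, Fin.sum_univ_succ]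
    simp only [Fin.cons_zero, Fin.cons_succ, perturbed, Fin.val_zero, pow_zero, Fin.val_succ,
      hf, dotProduct]
    field_simp
    ring
  have hw0 : w ≠ 0 := by
    intro h
    apply hc
    ext k
    have := congrFun h k.succ
    simpa [hw] using this
  -- the further points are assigned to the sides of the hyperplane on which they lie
  let S : Set (Fin N) := {k | (k : ℕ) ∈ S0 ∨ (n ≤ (k : ℕ) ∧ 0 ≤ w ⬝ᵥ perturbed b ε k)}
  have hdet : ∀ e : Fin (m + 2) → Fin N, Function.Injective e →
      (Matrix.of fun a => perturbed b ε (e a)).det ≠ 0 := by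
    intro e he
    have h := hε.orientation_ne_zero (fun a => e a.succ.succ) (fun a => (e _).2) (e 0)
        (e 0).2 (e 1) (e 1).2
    rw [orientation_eq] at h
    have heq : (Fin.cons (e 0 : ℕ) (Fin.cons (e 1 : ℕ) fun a => (e a.succ.succ : ℕ))
        : Fin (m + 2) → ℕ)
        = fun a => (e a : ℕ) := by
      ext a
      refine Fin.cases rfl (fun a => Fin.cases rfl (fun a => rfl) a) a
    rw [heq] at h
    exact h (Fin.val_injective.comp he)
  obtain ⟨w', I', hw'0, hI', hzero, hpos, hneg⟩ := exists_separating_many_zeros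
    (fun k : Fin N => perturbed b ε k) (by omega) hdet S w hw0
    (by
      rintro k (hk | hk)
      · rw [hwdot]; linarith [hge _ hk]
      · exact hk.2)
    (by
      intro k hk
      by_cases hkn : (k : ℕ) < n
      · rw [hwdot]; linarith [hle _ hkn fun h => hk (Or.inl h)]
      · by_contra h
        exact hk (Or.inr ⟨by omega, (not_le.1 h).le⟩))
  -- the pencil consists of the hyperplanes through all points but the first
  set j : ℕ := (I' 0 : ℕ) with hj
  set I : Fin m → ℕ := fun a => (I' a.succ : ℕ) with hI
  have hcons : (Fin.cons j I : Fin (m + 1) → ℕ) = fun a => (I' a : ℕ) := by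
    ext a; exact Fin.cases rfl (fun a => rfl) a
  have hIN : ∀ a, I a < N := fun a => (I' _).2
  have hjN : j < N := (I' 0).2
  have hIinj : Function.Injective I := fun a a' h => by
    have := hI' (Fin.val_injective h)
    exact Fin.succ_injective _ this
  have hjI : ∀ a, I a ≠ j := fun a h => by
    have := hI' (Fin.val_injective h)
    exact Fin.succ_ne_zero _ this
  have horne : ∀ k < N, (∀ a, (I' a : ℕ) ≠ k) → orientation b ε I j k ≠ 0 := by
    intro k hk hka
    refine hε.orientation_ne_zero I hIN j hjN k hk (injective_cons_cons.2 ⟨hka 0, hjI, fun a =>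
      hka a.succ, hIinj⟩)
  -- the orientation is proportional to the form `w'`
  have hwne : ∀ k < N, (∀ a, (I' a : ℕ) ≠ k) → w' ⬝ᵥ perturbed b ε k ≠ 0 := by
    intro k hk hka h0
    refine horne k hk hka ?_
    rw [orientation_eq]
    refine Matrix.exists_mulVec_eq_zero_iff.1 ⟨w', hw'0, ?_⟩
    ext a
    rw [Matrix.mulVec, dotProduct_comm]
    refine Fin.cases ?_ (fun a => Fin.cases ?_ (fun a => ?_) a) a
    · exact hzero 0
    · exact h0
    · exact hzero a.succ
  obtain ⟨z, hzn, hzN, hz⟩ : ∃ z, n ≤ z ∧ z < N ∧ ∀ a, (I' a : ℕ) ≠ z := by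
    by_contra hcon
    push Not at hcon
    have hsub : Finset.Ico n N ⊆ Finset.univ.image fun a => (I' a : ℕ) := by
      intro z hz
      rw [Finset.mem_Ico] at hz
      obtain ⟨a, ha⟩ := hcon z hz.1 hz.2
      exact Finset.mem_image.2 ⟨a, Finset.mem_univ _, ha⟩
    have h1 := (Finset.card_le_card hsub).trans Finset.card_image_le
    simp [hN] at h1
  have hprop : ∀ k, orientation b ε I j k * (w' ⬝ᵥ perturbed b ε z) =
      orientation b ε I j z * (w' ⬝ᵥ perturbed b ε k) := by
    intro k
    -- express the point `k` in the basis `j`, `z`, `I`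
    set M : Matrix (Fin (m + 2)) (Fin (m + 2)) ℝ := Matrix.of fun a =>
      perturbed b ε ((Fin.cons j (Fin.cons z I) : Fin (m + 2) → ℕ) a) with hM
    have hu : IsUnit M.det := by
      rw [isUnit_iff_ne_zero, hM, ← orientation_eq]; exact horne z hzN hz
    set v := perturbed b ε k ᵥ* M⁻¹ with hv
    have hk : perturbed b ε k = v 0 • perturbed b ε j + (v 1 • perturbed b ε z +
        ∑ a : Fin m, v a.succ.succ • perturbed b ε (I a)) := by
      have : perturbed b ε k = v ᵥ* M := by
        rw [hv, Matrix.vecMul_vecMul, Matrix.nonsing_inv_mul _ hu, Matrix.vecMul_one]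
      rw [this, Matrix.vecMul_eq_sum, Fin.sum_univ_succ, Fin.sum_univ_succ]
      rfl
    have h1 : orientation b ε I j k = v 1 * orientation b ε I j z := by
      rw [orientation_swap b ε I k j, orientation_swap b ε I z j, orientation, orientation, hk,
        detForm_add_left, detForm_add_left,
        detForm_sum_left, Finset.sum_eq_zero, detForm_smul_left, detForm_smul_left, detForm_self]
      · ring
      · intro a _
        rw [detForm_smul_left, detForm_left_eq_zero (fun a => perturbed b ε (I a)), mul_zero]
    have h2 : w' ⬝ᵥ perturbed b ε k = v 1 * (w' ⬝ᵥ perturbed b ε z) := by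
      have h3 : ∀ a, w' ⬝ᵥ perturbed b ε (I a) = 0 := fun a => hzero a.succ
      have h4 : w' ⬝ᵥ perturbed b ε j = 0 := hzero 0
      rw [hk]
      simp [dotProduct_add, dotProduct_sum, dotProduct_smul, h3, h4]
    rw [h1, h2]; ring
  have hzne := hwne z hzN hz
  have hozne := horne z hzN hz
  -- the sign of the factor of proportionality
  let σ : Bool := decide (0 < orientation b ε I j z * (w' ⬝ᵥ perturbed b ε z))
  have hside : ∀ k < N, (OnSide b I σ j k ↔ 0 < w' ⬝ᵥ perturbed b ε k) := by
    intro k hk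
    rw [hε.onSide_iff I hIN _ _ hjN _ hk, orientation_swap b ε I j k]
    have hp := hprop k
    set x := orientation b ε I j k
    set y := w' ⬝ᵥ perturbed b ε z
    set x0 := orientation b ε I j z
    set y0 := w' ⬝ᵥ perturbed b ε k
    have hy2 : 0 < y ^ 2 := by positivity
    have hkey : x * y ^ 2 = (x0 * y) * y0 := by linear_combination y * hp
    by_cases hσ : 0 < x0 * y
    · have : σ = true := decide_eq_true hσ
      simp only [this, if_true]
      rw [← mul_pos_iff_of_pos_right hy2, hkey, mul_pos_iff_of_pos_left hσ]
    · have : σ = false := decide_eq_false hσ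
      have hσ' : 0 < - (x0 * y) := by
        have := mul_ne_zero hozne hzne
        have := lt_of_le_of_ne (not_lt.1 hσ) this
        linarith
      simp only [this, Bool.false_eq_true, if_false]
      rw [← mul_pos_iff_of_pos_right hy2, neg_mul, hkey, ← neg_mul, mul_pos_iff_of_pos_left hσ']
  have hSiff : ∀ k (hk : k < N), (∀ a, (I' a : ℕ) ≠ k) →
      (OnSide b I σ j k ↔ (⟨k, hk⟩ : Fin N) ∈ S) := by
    intro k hk hka
    rw [hside k hk]
    constructor
    · intro h
      by_contra hk'
      exact absurd (hneg _ hk') (not_le.2 h)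
    · intro h
      exact lt_of_le_of_ne (hpos _ h) (Ne.symm (hwne k hk hka))
  have hnotside : ∀ a, ¬ OnSide b I σ j (I' a) := fun a h => by
    rw [hside _ (I' a).2] at h
    exact absurd (hzero a) h.ne'
  let J : Finset (Fin (m + 1)) := Finset.univ.filter fun a => (I' a : ℕ) ∈ S0
  have hcut : cutSet b n I σ j J = S0 := by
    ext i
    simp only [cutSet, Finset.mem_filter, Finset.mem_range, hcons]
    constructor
    · rintro ⟨hi, ⟨a, ha, rfl⟩ | h⟩
      · simpa [J] using ha
      · by_cases hia : ∃ a, (I' a : ℕ) = i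
        · obtain ⟨a, rfl⟩ := hia
          exact absurd h (hnotside a)
        · push Not at hia
          rcases (hSiff i (by omega) hia).1 h with h | h
          · exact h
          · exact absurd h.1 (not_le.2 hi)
    · intro hi
      have hin := Finset.mem_range.1 (hS0 hi)
      refine ⟨hin, ?_⟩
      by_cases hia : ∃ a, (I' a : ℕ) = i
      · obtain ⟨a, rfl⟩ := hia
        exact Or.inl ⟨a, by simpa [J] using hi, rfl⟩
      · push Not at hia
        exact Or.inr ((hSiff i (by omega) hia).2 (Or.inl hi))
  obtain ⟨cl, hcl⟩ : ∃ cl, OnSide b I cl z j := by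
    rcases lt_or_gt_of_ne hozne with h | h
    · exact ⟨true, (hε.onSide_iff I hIN _ _ hzN _ hjN).2 (by
        rw [if_pos rfl, orientation_swap b ε I j z]; linarith)⟩
    · exact ⟨false, (hε.onSide_iff I hIN _ _ hzN _ hjN).2 (by simpa using h)⟩
  refine ⟨I, z, cl, σ, j, J, hzn, hzN,
    ⟨hIN, hjN, hcl, isStrictTotalOn_onSide hIN hIinj hzN cl σ, ?_⟩, ?_, ?_⟩
  · intro T hT
    have hsub : T ⊆ S0 ∪ Finset.Ico n N := by
      intro x hx
      obtain ⟨hxN, hx⟩ := hT x hx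
      have hia : ∀ a, (I' a : ℕ) ≠ x := by
        rintro a rfl
        exact hnotside a hx
      rcases (hSiff x hxN hia).1 hx with h | h
      · exact Finset.mem_union_left _ h
      · exact Finset.mem_union_right _ (Finset.mem_Ico.2 ⟨h.1, hxN⟩)
    refine (Finset.card_le_card hsub).trans ((Finset.card_union_le _ _).trans ?_)
    simp [hS0c, hN]; omega
  · rw [hcut, hS0c]
  · rw [hcut]; exact hmax

/-- A finite family that contains all sets of size `s` cut off by shallow hyperplanes contains, for
every linear functional, a set of `s` points on which it attains its largest values.  This follows
from the case of a generic perturbation by letting the perturbation tend to zero. -/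
theorem exists_maximizing_mem {b : ℕ → Fin (m + 1) → ℝ} {n s : ℕ} (hs : 1 ≤ s) (hsn : s ≤ n)
    {F : List (Finset ℕ)}
    (hF : ∀ I z c σ j J, n ≤ z → z < n + (m + 2) → IsShallow b n s I z c σ j →
      (cutSet b n I σ j J).card = s → cutSet b n I σ j J ∈ F)
    (c : Fin (m + 1) → ℝ) :
    ∃ S ∈ F, S ⊆ Finset.range n ∧ S.card = s ∧
      ∀ T ⊆ Finset.range n, T.card = s → ∑ i ∈ T, c ⬝ᵥ b i ≤ ∑ i ∈ S, c ⬝ᵥ b i := by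
  classical
  -- for `c = 0` all sets are equally good, and `c` may be replaced by any other functional
  obtain ⟨c', hc', hcc⟩ : ∃ c' : Fin (m + 1) → ℝ, c' ≠ 0 ∧ (c ≠ 0 → c' = c) := by
    by_cases hc : c = 0
    · exact ⟨1, one_ne_zero, fun h => absurd hc h⟩
    · exact ⟨c, hc, fun _ => rfl⟩
  suffices h : ∃ S ∈ F, S ⊆ Finset.range n ∧ S.card = s ∧
      ∀ T ⊆ Finset.range n, T.card = s → ∑ i ∈ T, c' ⬝ᵥ b i ≤ ∑ i ∈ S, c' ⬝ᵥ b i by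
    by_cases hc : c = 0
    · obtain ⟨S, h1, h2, h3, -⟩ := h
      exact ⟨S, h1, h2, h3, by simp [hc]⟩
    · rwa [← hcc hc]
  -- otherwise each of the finitely many sets in `F` is beaten by another one, and still is after a
  -- small perturbation
  by_contra hcon
  push Not at hcon
  let G : Finset (Finset ℕ) := F.toFinset.filter fun S => S ⊆ Finset.range n ∧ S.card = s
  let f : ℝ → ℕ → ℝ := fun ε i => c' ⬝ᵥ (fun k => b i k + ε * (i : ℝ) ^ ((k : ℕ) + 1))
  have hlim : ∀ T : Finset ℕ, Tendsto (fun ε => ∑ i ∈ T, f ε i) (𝓝[>] 0)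
      (𝓝 (∑ i ∈ T, c' ⬝ᵥ b i)) := by
    intro T
    have hcont : Continuous fun ε => ∑ i ∈ T, f ε i := by
      simp only [f, dotProduct]; fun_prop
    have := (hcont.tendsto 0).mono_left (nhdsWithin_le_nhds (s := Set.Ioi 0))
    simpa [f] using this
  have hev : ∀ᶠ ε in 𝓝[>] (0 : ℝ), ∀ S ∈ G, ∃ T ⊆ Finset.range n, T.card = s ∧
      ∑ i ∈ S, f ε i < ∑ i ∈ T, f ε i := by
    rw [Filter.eventually_all_finset]
    intro S hS
    simp only [G, Finset.mem_filter, List.mem_toFinset] at hS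
    obtain ⟨T, hT, hTc, hlt⟩ := hcon S hS.1 hS.2.1 hS.2.2
    filter_upwards [(hlim S).eventually_lt (hlim T) hlt] with ε hε
    exact ⟨T, hT, hTc, hε⟩
  obtain ⟨ε, ⟨h1, h2⟩, h3⟩ := ((hev.and (eventually_isGeneric b (n + (m + 2)))).and
    (self_mem_nhdsWithin : ∀ᶠ ε in 𝓝[>] (0 : ℝ), 0 < ε)).exists
  obtain ⟨I, z, cl, σ, j, J, hz1, hz2, hsh, hcard, hmax⟩ := h2.exists_cutSet h3 hs hsn hc'
  have hmem : cutSet b n I σ j J ∈ G := by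
    simp only [G, Finset.mem_filter, List.mem_toFinset]
    exact ⟨hF I z cl σ j J hz1 hz2 hsh hcard, Finset.filter_subset _ _, hcard⟩
  obtain ⟨T, hT, hTc, hlt⟩ := h1 _ hmem
  exact absurd (hmax T hT hTc) (not_le.2 hlt)

end CutSet

/-! ### Evaluating orientations by a test -/

/-- A polynomial in an infinitesimal `ε`, given by expressions for its coefficients in increasing
degree. -/
abbrev EpsExp := List RExp

namespace EpsExp

/-- The value at a given real number `ε`. -/
noncomputable def eval (σ : Memory) (ε : ℝ) : EpsExp → ℝ
  | [] => 0
  | a :: l => a.eval σ + ε * eval σ ε l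

/-- The sum of two polynomials. -/
def add : EpsExp → EpsExp → EpsExp
  | [], l => l
  | a :: l, [] => a :: l
  | a :: l, b :: l' => .add a b :: add l l'

/-- The product of a polynomial and a real expression. -/
def smul (a : RExp) (l : EpsExp) : EpsExp := l.map (.mul a)

/-- The product of two polynomials. -/
def mul : EpsExp → EpsExp → EpsExp
  | [], _ => []
  | a :: l, l' => add (smul a l') (.const 0 :: mul l l')

variable (σ : Memory) (ε : ℝ)

theorem eval_add : ∀ l l' : EpsExp, (add l l').eval σ ε = l.eval σ ε + l'.eval σ ε
  | [], l => by simp [add, eval]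
  | a :: l, [] => by simp [add, eval]
  | a :: l, b :: l' => by simp [add, eval, RExp.eval, eval_add l l']; ring

theorem eval_smul (a : RExp) (l : EpsExp) : (smul a l).eval σ ε = a.eval σ * l.eval σ ε := by
  induction l with
  | nil => simp [smul, eval]
  | cons b l ih =>
    simp only [smul] at ih
    simp [smul, eval, RExp.eval, ih]; ring

theorem eval_mul : ∀ l l' : EpsExp, (mul l l').eval σ ε = l.eval σ ε * l'.eval σ ε
  | [], l => by simp [mul, eval]
  | a :: l, l' => by simp [mul, eval, RExp.eval, eval_add, eval_smul, eval_mul l l']; ring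

/-- The sum of a list of polynomials. -/
def sum (L : List EpsExp) : EpsExp := L.foldr add []

/-- The product of a list of polynomials. -/
def prod (L : List EpsExp) : EpsExp := L.foldr mul [.const 1]

theorem eval_sum (L : List EpsExp) : (sum L).eval σ ε = (L.map (eval σ ε)).sum := by
  induction L with
  | nil => simp [sum, eval]
  | cons a L ih =>
    simp only [sum] at ih
    simp [sum, eval_add, ih]

theorem eval_prod (L : List EpsExp) : (prod L).eval σ ε = (L.map (eval σ ε)).prod := by
  induction L with
  | nil => simp [prod, eval, RExp.eval]
  | cons a L ih =>
    simp only [prod] at ih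
    simp [prod, eval_mul, ih]

/-- The determinant, by the Leibniz formula; the size of the matrix does not depend on the input, so
neither does that of the expressions. -/
noncomputable def det {k : ℕ} (M : Fin k → Fin k → EpsExp) : EpsExp :=
  sum ((Finset.univ : Finset (Equiv.Perm (Fin k))).toList.map fun π =>
    smul (.const (Equiv.Perm.sign π : ℤ)) (prod ((List.finRange k).map fun i => M (π i) i)))

theorem eval_det {k : ℕ} (M : Fin k → Fin k → EpsExp) :
    (det M).eval σ ε = (Matrix.of fun i j => (M i j).eval σ ε).det := by
  rw [det, eval_sum, Matrix.det_apply', List.map_map, Finset.sum_map_toList]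
  refine Finset.sum_congr rfl fun π _ => ?_
  simp only [Function.comp, eval_smul, eval_prod, RExp.eval, List.map_map, Matrix.of_apply]
  rw [← List.prod_ofFn, List.ofFn_eq_map]
  rfl

/-- Tests whether the polynomial is positive for infinitesimal positive `ε`, that is, whether its
first nonzero coefficient is positive. -/
def posTest : EpsExp → Test
  | [] => .realLE (.const 1) (.const 0)
  | a :: l => .conj (.realLE (.const 0) a) (.neg (.conj (.realLE a (.const 0)) (.neg (posTest l))))

theorem eventually_holds_posTest (l : EpsExp) :
    ∀ᶠ ε in 𝓝[>] (0 : ℝ), ((posTest l).holds σ ↔ 0 < l.eval σ ε) := by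
  induction l with
  | nil =>
    refine Eventually.of_forall fun ε => ?_
    simp [posTest, Test.holds, RExp.eval, eval]
  | cons a l ih =>
    have hcont : Continuous fun ε => eval σ ε l := by
      clear ih
      induction l with
      | nil => simp only [eval]; fun_prop
      | cons b l ih => simp only [eval]; fun_prop
    have hlim : Tendsto (fun ε => eval σ ε (a :: l)) (𝓝[>] 0) (𝓝 (a.eval σ)) := by
      have h : Continuous fun ε => eval σ ε (a :: l) := by simp only [eval]; fun_prop
      have := (h.tendsto 0).mono_left (nhdsWithin_le_nhds (s := Set.Ioi 0))
      simpa [eval] using this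
    rcases lt_trichotomy (a.eval σ) 0 with h | h | h
    · filter_upwards [hlim.eventually (gt_mem_nhds h)] with ε hε
      simp [posTest, Test.holds, RExp.eval, h.not_ge, hε.le]
    · filter_upwards [ih, (self_mem_nhdsWithin : ∀ᶠ ε in 𝓝[>] (0 : ℝ), 0 < ε)] with ε hε hpos
      have hpos : 0 < ε := hpos
      simp [posTest, Test.holds, RExp.eval, h, hε, eval, hpos]
    · filter_upwards [hlim.eventually (lt_mem_nhds h)] with ε hε
      simp [posTest, Test.holds, RExp.eval, h.not_ge, h.le, hε]

theorem holds_posTest (l : EpsExp) :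
    (posTest l).holds σ ↔ ∀ᶠ ε in 𝓝[>] (0 : ℝ), 0 < l.eval σ ε := by
  have h := eventually_holds_posTest σ l
  constructor
  · intro h1
    filter_upwards [h] with ε hε using hε.1 h1
  · intro h1
    obtain ⟨ε, h2, h3⟩ := (h.and h1).exists
    exact h2.2 h3

end EpsExp

/-- The `k`-th power of a real expression. -/
def RExp.pow (e : RExp) : ℕ → RExp
  | 0 => .const 1
  | k + 1 => .mul (pow e k) e

theorem RExp.eval_pow (σ : Memory) (e : RExp) (k : ℕ) : (e.pow k).eval σ = e.eval σ ^ k := by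
  induction k with
  | zero => simp [pow, eval]
  | succ k ih => simp [pow, eval, ih, pow_succ]

/-- The coordinates of the `i`-th point: products of two entries of the `i`-th column of `a`, for
the pairs of rows listed by `pr`. -/
def quadPoint {m : ℕ} (pr : Fin (m + 1) → ℕ × ℕ) (a : ℕ → ℕ → ℝ) (i : ℕ) (k : Fin (m + 1)) : ℝ :=
  a (pr k).1 i * a (pr k).2 i

/-- The perturbed homogeneous coordinates of the point with index `e`.  Real array `0` holds the
matrix, and cell `(i, 0)` of real array `2` holds `i`, since numbers cannot be converted. -/
def pointExp {m : ℕ} (pr : Fin (m + 1) → ℕ × ℕ) (e : NExp) (k : Fin (m + 2)) : EpsExp :=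
  [(Fin.cons (.const 1) fun k =>
      .mul (.get 0 (.const (pr k).1) e) (.get 0 (.const (pr k).2) e) : Fin (m + 2) → RExp) k,
    (RExp.get 2 e (.const 0)).pow k]

theorem eval_pointExp {m : ℕ} (pr : Fin (m + 1) → ℕ × ℕ) (e : NExp) (k : Fin (m + 2)) {σ : Memory}
    (ε : ℝ) (h : σ.real 2 (e.eval σ) 0 = (e.eval σ : ℕ)) :
    (pointExp pr e k).eval σ ε = perturbed (quadPoint pr (σ.real 0)) ε (e.eval σ) k := by
  simp only [pointExp, EpsExp.eval, perturbed, RExp.eval_pow, RExp.eval, NExp.eval, h]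
  refine Fin.cases ?_ (fun k => ?_) k <;> simp [RExp.eval, NExp.eval, quadPoint]

/-- Tests whether the point `y` lies strictly on side `σ` of the hyperplane through `x` and `I`. -/
noncomputable def sideTest {m : ℕ} (pr : Fin (m + 1) → ℕ × ℕ) (I : Fin m → NExp) (σ : Bool)
    (x y : NExp) : Test :=
  EpsExp.posTest (EpsExp.det fun a k => pointExp pr
    ((if σ then Fin.cons x (Fin.cons y I) else Fin.cons y (Fin.cons x I) : Fin (m + 2) → NExp) a) k)

/-- The orientation test is exact: the infinitesimal is treated symbolically, so its cost is
constant and no value of `ε` has to be chosen. -/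
theorem holds_sideTest {m : ℕ} {pr : Fin (m + 1) → ℕ × ℕ} {I : Fin m → NExp} {σ : Bool}
    {x y : NExp} {τ : Memory} {N : ℕ} (hreal : ∀ i < N, τ.real 2 i 0 = i)
    (hI : ∀ a, (I a).eval τ < N) (hx : x.eval τ < N) (hy : y.eval τ < N) :
    (sideTest pr I σ x y).holds τ ↔
      OnSide (quadPoint pr (τ.real 0)) (fun a => (I a).eval τ) σ (x.eval τ) (y.eval τ) := by
  rw [sideTest, EpsExp.holds_posTest, OnSide]
  refine eventually_congr (Eventually.of_forall fun ε => ?_)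
  rw [EpsExp.eval_det]
  cases σ
  · simp only [Bool.false_eq_true, if_false, orientation_eq]
    apply iff_of_eq; congr 2
    ext a k
    refine Fin.cases ?_ (fun a => Fin.cases ?_ (fun a => ?_) a) a
    · exact eval_pointExp pr _ _ ε (hreal _ hy)
    · exact eval_pointExp pr _ _ ε (hreal _ hx)
    · exact eval_pointExp pr _ _ ε (hreal _ (hI a))
  · simp only [if_true, orientation_eq]
    apply iff_of_eq; congr 2
    ext a k
    refine Fin.cases ?_ (fun a => Fin.cases ?_ (fun a => ?_) a) a
    · exact eval_pointExp pr _ _ ε (hreal _ hx)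
    · exact eval_pointExp pr _ _ ε (hreal _ hy)
    · exact eval_pointExp pr _ _ ε (hreal _ (hI a))

/-! ### Lists of candidate sets in memory -/

/-- The memory lists exactly the sets of `F`, in this order. -/
def StoresFamily (τ : Memory) (F : List (Finset ℕ)) : Prop :=
  τ.numCandidates = F.length ∧ ∀ l (h : l < F.length),
    τ.nat 4 l 0 = F[l].card ∧ (Finset.range F[l].card).image (τ.nat 5 l) = F[l]

theorem StoresFamily.congr {τ τ' : Memory} {F : List (Finset ℕ)} (h : StoresFamily τ F)
    (h3 : τ'.nat 3 = τ.nat 3) (h4 : τ'.nat 4 = τ.nat 4) (h5 : τ'.nat 5 = τ.nat 5) :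
    StoresFamily τ' F := by
  simpa [StoresFamily, Memory.numCandidates, h3, h4, h5] using h

/-- The memories agree up to the arrays of natural numbers in `W`. -/
def AgreesOff (W : ℕ → Prop) (σ τ : Memory) : Prop :=
  (∀ a, ¬ W a → τ.nat a = σ.nat a) ∧ τ.real = σ.real

theorem AgreesOff.refl (W : ℕ → Prop) (σ : Memory) : AgreesOff W σ σ := ⟨fun _ _ => rfl, rfl⟩

theorem AgreesOff.trans {W : ℕ → Prop} {σ τ υ : Memory} (h : AgreesOff W σ τ)
    (h' : AgreesOff W τ υ) : AgreesOff W σ υ :=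
  ⟨fun a ha => (h'.1 a ha).trans (h.1 a ha), h'.2.trans h.2⟩

theorem AgreesOff.mono {W W' : ℕ → Prop} {σ τ : Memory} (h : AgreesOff W σ τ)
    (hW : ∀ a, W a → W' a) : AgreesOff W' σ τ :=
  ⟨fun a ha => h.1 a fun h' => ha (hW a h'), h.2⟩

theorem AgreesOff.setNat {W : ℕ → Prop} (σ : Memory) {a : ℕ} (ha : W a) (i j v : ℕ) :
    AgreesOff W σ (σ.setNat a i j v) := by
  refine ⟨fun b hb => ?_, rfl⟩
  have : b ≠ a := fun h => hb (h ▸ ha)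
  funext x y
  simp [Memory.setNat, this]

theorem Memory.setNat_nat_of_ne (σ : Memory) {a b : ℕ} (h : b ≠ a) (i j v : ℕ) :
    (σ.setNat a i j v).nat b = σ.nat b := by
  funext x y; simp [Memory.setNat, h]

theorem HaltsWithin.agreesOff {E : EigSolver} {P : Program} {σ : Memory} {T : ℕ}
    {Q : Memory → Prop} {W : ℕ → Prop} (h : HaltsWithin E P σ T Q) (hW : P.NatIn W)
    (hV : P.RealIn fun _ => False) :
    HaltsWithin E P σ T (fun τ => Q τ ∧ AgreesOff W σ τ) :=
  (h.frame hW hV).mono le_rfl fun _ h => ⟨h.1, h.2.1, funext fun a => h.2.2 a id⟩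

/-- Started in `σ`, the program appends at most `g` sets to the listed ones, all of them consisting
of `s` numbers below `n`, and among them all sets satisfying `Req`. -/
def Appends (E : EigSolver) (n s : ℕ) (P : Program) (σ : Memory) (B g : ℕ)
    (Req : Finset ℕ → Prop) : Prop :=
  ∀ F, StoresFamily σ F → HaltsWithin E P σ B fun τ => ∃ G, StoresFamily τ (F ++ G) ∧
    G.length ≤ g ∧ (∀ S ∈ G, S.card = s ∧ S ⊆ Finset.range n) ∧ ∀ X, Req X → X ∈ G

theorem Appends.mono {E : EigSolver} {n s : ℕ} {P : Program} {σ : Memory} {B B' g g' : ℕ}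
    {Req Req' : Finset ℕ → Prop} (h : Appends E n s P σ B g Req) (hB : B ≤ B') (hg : g ≤ g')
    (hR : ∀ X, Req' X → Req X) : Appends E n s P σ B' g' Req' :=
  fun F hF => (h F hF).mono hB fun _ ⟨G, h1, h2, h3, h4⟩ =>
    ⟨G, h1, h2.trans hg, h3, fun X hX => h4 X (hR X hX)⟩

/-- Rule for a sequence of programs, all of which append sets in every memory that agrees with the
initial one up to what the programs write. -/
theorem Appends.seqList {E : EigSolver} {n s : ℕ} {α : Type*} {P : α → Program} {σ : Memory}
    {B g : ℕ} {Req : α → Finset ℕ → Prop} {W : ℕ → Prop} (hW : ∀ x, (P x).NatIn W)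
    (hV : ∀ x, (P x).RealIn fun _ => False)
    (h : ∀ x τ, AgreesOff W σ τ → Appends E n s (P x) τ B g (Req x)) (L : List α) :
    Appends E n s (Program.seqList (L.map P)) σ (L.length * (B + 1) + 1) (L.length * g)
      (fun X => ∃ x ∈ L, Req x X) := by
  suffices key : ∀ L : List α, ∀ τ, AgreesOff W σ τ →
      Appends E n s (Program.seqList (L.map P)) τ (L.length * (B + 1) + 1) (L.length * g)
        (fun X => ∃ x ∈ L, Req x X) from key L σ (.refl W σ)
  intro L
  induction L with
  | nil =>
    intro τ _ F hF
    exact (HaltsWithin.skip (Q := fun τ => StoresFamily τ F) hF).mono (by simp) fun _ h =>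
      ⟨[], by simpa using h, by simp⟩
  | cons x L ih =>
    intro τ hτ F hF
    refine ((((h x τ hτ) F hF).agreesOff (hW x) (hV x)).seq
      (Q := fun τ => ∃ G, StoresFamily τ (F ++ G) ∧ G.length ≤ (x :: L).length * g ∧
        (∀ S ∈ G, S.card = s ∧ S ⊆ Finset.range n) ∧ ∀ X, (∃ y ∈ x :: L, Req y X) → X ∈ G)
      (T' := L.length * (B + 1) + 1) ?_).mono ?_ fun _ h => h
    · rintro τ' ⟨⟨G, h1, h2, h3, h4⟩, h5⟩
      refine (ih τ' (hτ.trans h5) (F ++ G) h1).mono le_rfl ?_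
      rintro τ'' ⟨G', g1, g2, g3, g4⟩
      refine ⟨G ++ G', by simpa using g1, ?_, ?_, ?_⟩
      · simp only [List.length_append, List.length_cons, Nat.succ_mul]; omega
      · intro S hS
        rcases List.mem_append.1 hS with hS | hS
        exacts [h3 S hS, g3 S hS]
      · rintro X ⟨y, hy, hX⟩
        rcases List.mem_cons.1 hy with rfl | hy
        · exact List.mem_append_left _ (h4 X hX)
        · exact List.mem_append_right _ (g4 X ⟨y, hy, hX⟩)
    · simp only [List.length_cons, Nat.succ_mul]; omega

/-- Rule for a counting loop whose body appends sets in every memory that agrees with the initial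
one up to what the loop writes. -/
theorem Appends.forLoop {E : EigSolver} {n s : ℕ} {P : Program} {σ : Memory} {v N B g : ℕ}
    {b : NExp} {Req : ℕ → Finset ℕ → Prop} {W : ℕ → Prop} (hW : P.NatIn W)
    (hV : P.RealIn fun _ => False) (hv : ¬ W v) (hv5 : 5 < v)
    (hb : ∀ τ, AgreesOff (fun a => W a ∨ a = v) σ τ → b.eval τ = N)
    (h : ∀ k < N, ∀ τ, AgreesOff (fun a => W a ∨ a = v) σ τ → τ.nat v 0 0 = k →
      Appends E n s P τ B g (Req k)) :
    Appends E n s (Program.forLoop v b P) σ (N * (B + b.cost + 20) + b.cost + 20) (N * g)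
      (fun X => ∃ k < N, Req k X) := by
  intro F hF
  have set_family : ∀ τ G k, StoresFamily τ G → StoresFamily (τ.setNat v 0 0 k) G := by
    intro τ G k hG
    refine hG.congr ?_ ?_ ?_ <;> exact Memory.setNat_nat_of_ne _ (by omega) _ _ _
  refine (HaltsWithin.forLoop (fun k τ => AgreesOff (fun a => W a ∨ a = v) σ τ ∧ τ.nat v 0 0 = k ∧
    ∃ G, StoresFamily τ (F ++ G) ∧ G.length ≤ k * g ∧
    (∀ S ∈ G, S.card = s ∧ S ⊆ Finset.range n) ∧ ∀ X, (∃ i < k, Req i X) → X ∈ G) ?_ ?_ ?_).mono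
    le_rfl fun τ h => h.2.2
  · refine ⟨AgreesOff.setNat σ (Or.inr rfl) _ _ _, by simp [Memory.setNat], [], ?_, by simp⟩
    simpa using set_family _ _ _ hF
  · rintro k τ ⟨h1, h2, -⟩
    exact ⟨h2, hb τ h1⟩
  · rintro k hk τ ⟨h1, h2, G, h3, h4, h5, h6⟩
    refine ((h k hk τ h1 h2 _ h3).agreesOff hW hV).mono le_rfl ?_
    rintro τ' ⟨⟨G', g3, g4, g5, g6⟩, g1⟩
    refine ⟨by rw [g1.1 v hv, h2], (h1.trans (g1.mono fun _ => Or.inl)).trans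
      (AgreesOff.setNat _ (Or.inr rfl) _ _ _), by simp [Memory.setNat], G ++ G', ?_, ?_, ?_, ?_⟩
    · simpa using set_family _ _ _ g3
    · simp only [List.length_append, Nat.succ_mul]; omega
    · intro S hS
      rcases List.mem_append.1 hS with hS | hS
      exacts [h5 S hS, g5 S hS]
    · rintro X ⟨i, hi, hX⟩
      rcases Nat.lt_succ_iff_lt_or_eq.1 hi with hi | rfl
      · exact List.mem_append_left _ (h6 X ⟨i, hi, hX⟩)
      · exact List.mem_append_right _ (g6 X hX)

/-! ### Listing one cut set

The programs below use the following cells.  Natural numbers: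

* `0`, `1`, `2`: the scalars `n`, `s`, `d` of the input;
* `3`, `4`, `5`: the number of listed sets, their lengths, and their elements;
* `6`: the index of the reference point, among the `m + 2` additional points;
* `7`, `8`: counters for the rounds of a scan and for the points;
* `9`, `10`: the selected point, and whether there is one;
* `11`: marks of the points that have been selected before;
* `12`, `13`: counters for the rows and columns of matrices;
* `14`, `15`: the current and the best candidate;
* `20 + a`: the `a`-th point that determines the pencil.

Real numbers:

* `0`, `1`: the input matrix and the solution;
* `2`: the indices of the points, as real numbers;
* `3`, `4`, `5`: a covariance matrix, its eigenvalues, and its eigenvectors;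
* `6`, `7`: the sum of eigenvalues of the current and of the best candidate. -/

/-- The disjunction of two tests. -/
def Test.or (b c : Test) : Test := .neg (.conj (.neg b) (.neg c))

@[simp] theorem Test.holds_or (σ : Memory) (b c : Test) :
    (Test.or b c).holds σ ↔ b.holds σ ∨ c.holds σ := by
  simp only [Test.or, Test.holds]; tauto

/-- `e = f`. -/
def Test.natEq (e f : NExp) : Test := .conj (.natLE e f) (.natLE f e)

@[simp] theorem Test.holds_natEq (σ : Memory) (e f : NExp) :
    (Test.natEq e f).holds σ ↔ e.eval σ = f.eval σ := by
  simp only [Test.natEq, Test.holds]; exact le_antisymm_iff.symm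

theorem Test.holds_foldr_or (σ : Memory) (L : List Test) (c : Test) :
    (L.foldr Test.or c).holds σ ↔ (∃ b ∈ L, b.holds σ) ∨ c.holds σ := by
  induction L with
  | nil => simp
  | cons b L ih => simp [ih, or_assoc]

section Enumeration

variable {m : ℕ} (pr : Fin (m + 1) → ℕ × ℕ)

/-- The variables holding the `m` points that determine the current pencil. -/
def pencilVar (a : Fin m) : NExp := .var (20 + a)

/-- Tests whether the point in variable `8` belongs to the cut set determined by the pencil, the
side `σ`, the point in variable `9`, and `J`. -/
noncomputable def cutTest (σ : Bool) (J : Finset (Fin (m + 1))) : Test :=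
  (J.toList.map fun a =>
    Test.natEq ((Fin.cons (.var 9) pencilVar : Fin (m + 1) → NExp) a) (.var 8)).foldr Test.or
      (sideTest pr pencilVar σ (.var 9) (.var 8))

/-- Writes the cut set into the first free row and keeps it if it has `s` elements; otherwise
the next cut set overwrites it. -/
noncomputable def listCut (σ : Bool) (J : Finset (Fin (m + 1))) : Program :=
  .seq (.setNat 4 (.var 3) (.const 0) (.const 0))
    (.seq (.forLoop 8 (.var 0) (.ite (cutTest pr σ J)
        (.seq (.setNat 5 (.var 3) (.get 4 (.var 3) (.const 0)) (.var 8))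
          (.setNat 4 (.var 3) (.const 0) (.add (.get 4 (.var 3) (.const 0)) (.const 1)))) .skip))
      (.ite (.natEq (.get 4 (.var 3) (.const 0)) (.var 1))
        (.setNat 3 (.const 0) (.const 0) (.add (.var 3) (.const 1))) .skip))

theorem natIn_listCut {W : ℕ → Prop} (h3 : W 3) (h4 : W 4) (h5 : W 5) (h8 : W 8) (σ : Bool)
    (J : Finset (Fin (m + 1))) : (listCut pr σ J).NatIn W := by
  simp [listCut, Program.NatIn, h3, h4, h5, h8]

theorem realIn_listCut (σ : Bool) (J : Finset (Fin (m + 1))) (V : ℕ → Prop) :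
    (listCut pr σ J).RealIn V := by
  simp [listCut, Program.RealIn]

/-- The data that the enumeration reads and that stay fixed: the input, and the indices of the `N`
points as real numbers. -/
structure InputStored (n s N : ℕ) (A : ℕ → ℕ → ℝ) (τ : Memory) : Prop where
  n_eq : τ.nat 0 0 0 = n
  s_eq : τ.nat 1 0 0 = s
  real_eq : τ.real 0 = A
  index_eq : ∀ i < N, τ.real 2 i 0 = i

theorem InputStored.congr {n s N : ℕ} {A : ℕ → ℕ → ℝ} {W : ℕ → Prop} {σ τ : Memory}
    (h : InputStored n s N A σ) (h' : AgreesOff W σ τ) (h0 : ¬ W 0) (h1 : ¬ W 1) :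
    InputStored n s N A τ :=
  ⟨by rw [h'.1 0 h0, h.1], by rw [h'.1 1 h1, h.2], by rw [h'.2, h.3], by rw [h'.2]; exact h.4⟩

variable {n s : ℕ} {A : ℕ → ℕ → ℝ} {E : EigSolver}

/-- The points stored in the pencil variables. -/
def pencilOf (m : ℕ) (τ : Memory) (a : Fin m) : ℕ := τ.nat (20 + a) 0 0

/-- The test decides membership in the cut set. -/
theorem holds_cutTest {τ : Memory} (hin : InputStored n s (n + (m + 2)) A τ)
    (hI : ∀ a : Fin m, pencilOf m τ a < n + (m + 2)) (hj : τ.nat 9 0 0 < n + (m + 2))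
    (hi : τ.nat 8 0 0 < n) (σ : Bool) (J : Finset (Fin (m + 1))) :
    (cutTest pr σ J).holds τ ↔
      τ.nat 8 0 0 ∈ cutSet (quadPoint pr A) n (pencilOf m τ) σ (τ.nat 9 0 0) J := by
  have hi' : (NExp.var 8).eval τ < n + (m + 2) := by rw [NExp.eval_var]; omega
  rw [cutTest, Test.holds_foldr_or, holds_sideTest (I := pencilVar) (x := .var 9) (y := .var 8)
    hin.index_eq hI hj hi', hin.real_eq]
  simp only [cutSet, Finset.mem_filter, Finset.mem_range, hi, true_and, List.mem_map,
    Finset.mem_toList]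
  refine or_congr ?_ Iff.rfl
  have hcons : ∀ a : Fin (m + 1), ((Fin.cons (.var 9) pencilVar : Fin (m + 1) → NExp) a).eval τ =
      (Fin.cons (τ.nat 9 0 0) (pencilOf m τ) : Fin (m + 1) → ℕ) a := fun a =>
    Fin.cases rfl (fun a => rfl) a
  constructor
  · rintro ⟨_, ⟨a, ha, rfl⟩, h⟩
    rw [Test.holds_natEq, hcons] at h
    exact ⟨a, ha, h⟩
  · rintro ⟨a, ha, h⟩
    exact ⟨_, ⟨a, ha, rfl⟩, by rw [Test.holds_natEq, hcons]; exact h⟩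

/-- A set becomes listed when it has been written to the first free row and the counter is
increased. -/
theorem StoresFamily.append_singleton {τ : Memory} {F : List (Finset ℕ)} {S : Finset ℕ}
    (h : ∀ l (h : l < F.length),
      τ.nat 4 l 0 = F[l].card ∧ (Finset.range F[l].card).image (τ.nat 5 l) = F[l])
    (h3 : τ.nat 3 0 0 = F.length + 1) (h4 : τ.nat 4 F.length 0 = S.card)
    (h5 : (Finset.range S.card).image (τ.nat 5 F.length) = S) : StoresFamily τ (F ++ [S]) := by
  refine ⟨by simp [Memory.numCandidates, h3], fun l hl => ?_⟩
  rcases Nat.lt_or_ge l F.length with hlt | hge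
  · rw [List.getElem_append_left hlt]; exact h l hlt
  · have : l = F.length := by simp at hl; omega
    subst this
    simpa using ⟨h4, h5⟩

/-- Listing a cut set takes time `O(n)`. -/
theorem appends_listCut (n s m : ℕ) (pr : Fin (m + 1) → ℕ × ℕ) (σ : Bool)
    (J : Finset (Fin (m + 1))) {τ : Memory}
    (hin : InputStored n s (n + (m + 2)) A τ)
    (hI : ∀ a : Fin m, pencilOf m τ a < n + (m + 2)) (hj : τ.nat 9 0 0 < n + (m + 2)) :
    Appends E n s (listCut pr σ J) τ (n * ((cutTest pr σ J).cost + 60) + 90) 1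
      (fun X => X = cutSet (quadPoint pr A) n (pencilOf m τ) σ (τ.nat 9 0 0) J ∧ X.card = s) := by
  classical
  intro F hF
  set X := cutSet (quadPoint pr A) n (pencilOf m τ) σ (τ.nat 9 0 0) J with hX
  set L := F.length with hL
  have h3 : τ.nat 3 0 0 = L := hF.1
  let W : ℕ → Prop := fun a => a = 4 ∨ a = 5 ∨ a = 8
  -- the part of the cut set below `k`
  let Part : ℕ → Finset ℕ := fun k => X.filter (· < k)
  have hPart : ∀ k, Part (k + 1) = if k ∈ X then insert k (Part k) else Part k := by
    intro k
    ext i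
    split_ifs with hk
    · simp only [Part, Finset.mem_filter, Finset.mem_insert, Nat.lt_succ_iff_lt_or_eq]
      constructor
      · rintro ⟨h1, h2 | h2⟩
        exacts [Or.inr ⟨h1, h2⟩, Or.inl h2]
      · rintro (rfl | ⟨h1, h2⟩)
        exacts [⟨hk, Or.inr rfl⟩, ⟨h1, Or.inl h2⟩]
    · simp only [Part, Finset.mem_filter, Nat.lt_succ_iff_lt_or_eq]
      constructor
      · rintro ⟨h1, h2 | rfl⟩
        exacts [⟨h1, h2⟩, absurd h1 hk]
      · rintro ⟨h1, h2⟩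
        exact ⟨h1, Or.inl h2⟩
  -- the first `k` indices have been scanned, and those in `X` are stored in row `L`
  let Inv : ℕ → Memory → Prop := fun k υ => AgreesOff W τ υ ∧ υ.nat 8 0 0 = k ∧
    (∀ l < L, υ.nat 4 l 0 = τ.nat 4 l 0 ∧ υ.nat 5 l = τ.nat 5 l) ∧
    υ.nat 4 L 0 = (Part k).card ∧
    (Finset.range (Part k).card).image (υ.nat 5 L) = Part k
  have hW3 : ∀ υ, AgreesOff W τ υ → υ.nat 3 0 0 = L := fun υ h => by
    rw [h.1 3 (by simp [W]), h3]
  have hloop : ∀ υ, υ = τ.setNat 4 L 0 0 → HaltsWithin E (.forLoop 8 (.var 0) (.ite (cutTest pr σ J)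
        (.seq (.setNat 5 (.var 3) (.get 4 (.var 3) (.const 0)) (.var 8))
          (.setNat 4 (.var 3) (.const 0) (.add (.get 4 (.var 3) (.const 0)) (.const 1)))) .skip)) υ
        (n * ((1 + (cutTest pr σ J).cost + 30) + (NExp.var 0).cost + 20) + (NExp.var 0).cost + 20)
        (Inv n) := by
    rintro υ rfl
    refine HaltsWithin.forLoop Inv ?_ ?_ ?_
    · refine ⟨(AgreesOff.setNat τ (by simp [W]) _ _ _).trans
        (AgreesOff.setNat _ (by simp [W]) _ _ _),
        by simp [Memory.setNat], fun l hl => ?_, ?_, ?_⟩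
      · have : l ≠ L := hl.ne
        exact ⟨by simp [Memory.setNat, this], by funext x; simp [Memory.setNat]⟩
      · simp [Memory.setNat, Part]
      · simp [Part]
    · rintro k υ ⟨h1, h2, -⟩
      exact ⟨h2, by rw [NExp.eval_var, h1.1 0 (by simp [W]), hin.n_eq]⟩
    · rintro k hk υ ⟨h1, h2, h4, h5, h6⟩
      have hpen : pencilOf m υ = pencilOf m τ := by
        funext a; simp only [pencilOf]; rw [h1.1 _ (by simp only [W]; omega)]
      have h9 : υ.nat 9 = τ.nat 9 := h1.1 9 (by simp [W])
      have hυ3 := hW3 υ h1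
      have htest : (cutTest pr σ J).holds υ ↔ k ∈ X := by
        rw [holds_cutTest pr (hin.congr h1 (by simp [W]) (by simp [W])) (by rw [hpen]; exact hI)
          (by rw [h9]; exact hj) (by rw [h2]; exact hk), hpen, h9, h2]
      refine HaltsWithin.ite (fun hb => ?_) (fun hb => ?_)
      · have hkX := htest.1 hb
        have hkP : k ∉ Part k := by simp [Part]
        refine ((HaltsWithin.setNat (Q := fun υ' => υ' = υ.setNat 5 L (Part k).card k) ?_).seq
          (T' := 1 + (NExp.var 3).cost + (NExp.const 0).cost +
            (NExp.add (.get 4 (.var 3) (.const 0)) (.const 1)).cost) ?_).mono ?_ fun _ h => h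
        · simp [NExp.eval, hυ3, h5, h2]
        · rintro υ' rfl
          refine HaltsWithin.setNat ?_
          have e3 : (υ.setNat 5 L (Part k).card k).nat 3 0 0 = L := by simp [Memory.setNat, hυ3]
          simp only [NExp.eval_var, NExp.eval, e3]
          have e4 : (υ.setNat 5 L (Part k).card k).nat 4 L 0 = (Part k).card := by
            simp [Memory.setNat, h5]
          rw [e4]
          refine ⟨by simp [Memory.setNat, h2],
            ((h1.trans (AgreesOff.setNat _ (by simp [W]) _ _ _)).trans
            (AgreesOff.setNat _ (by simp [W]) _ _ _)).trans
              (AgreesOff.setNat _ (by simp [W]) _ _ _),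
            by simp [Memory.setNat], fun l hl => ?_, ?_, ?_⟩
          · have : l ≠ L := hl.ne
            refine ⟨by simp [Memory.setNat, this, h4 l hl], ?_⟩
            rw [← (h4 l hl).2]
            funext x; simp [Memory.setNat, this]
          · rw [hPart, if_pos hkX, Finset.card_insert_of_notMem hkP]
            simp [Memory.setNat]
          · rw [hPart, if_pos hkX, Finset.card_insert_of_notMem hkP, Finset.range_add_one,
              Finset.image_insert]
            congr 1
            · simp [Memory.setNat]
            · conv_rhs => rw [← h6]
              refine Finset.image_congr fun x hx => ?_
              have hx' : x ≠ (Part k).card := by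
                have := Finset.mem_range.1 (Finset.mem_coe.1 hx); omega
              simp [Memory.setNat, hx']
        · simp [NExp.cost, NExp.var]
      · have hkX : k ∉ X := fun h => hb (htest.2 h)
        refine (HaltsWithin.skip (Q := fun υ' => υ' = υ) rfl).mono (by omega) ?_
        rintro υ' rfl
        refine ⟨h2, h1.trans (AgreesOff.setNat _ (by simp [W]) _ _ _), by simp [Memory.setNat],
          fun l hl => ?_, ?_, ?_⟩
        · exact ⟨by simp [Memory.setNat, h4 l hl],
            by rw [← (h4 l hl).2]; funext x; simp [Memory.setNat]⟩
        · rw [hPart, if_neg hkX, ← h5]; simp [Memory.setNat]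
        · rw [hPart, if_neg hkX]
          conv_rhs => rw [← h6]
          refine Finset.image_congr fun x _ => ?_
          simp [Memory.setNat]
  have hXn : Part n = X := by
    refine Finset.filter_true_of_mem fun i hi => ?_
    exact Finset.mem_range.1 ((Finset.filter_subset _ _) hi)
  refine ((HaltsWithin.setNat (Q := fun υ => υ = τ.setNat 4 L 0 0) ?_).seq fun υ hυ =>
    (hloop υ hυ).seq (T' := 1 + (Test.natEq (.get 4 (.var 3) (.const 0)) (.var 1)).cost + 20)
      fun υ h => HaltsWithin.ite (fun hb => ?_) (fun hb => ?_)).mono ?_ fun _ h => h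
  · simp [NExp.eval, h3]
  · obtain ⟨h1, h2, h4, h5, h6⟩ := h
    rw [hXn] at h5 h6
    have hcard : X.card = s := by
      rw [Test.holds_natEq] at hb
      simpa [NExp.eval, hW3 υ h1, h5, h1.1 1 (by simp [W]), hin.s_eq] using hb
    refine HaltsWithin.mono (T := 1 + (NExp.const 0).cost + (NExp.const 0).cost +
      (NExp.add (.var 3) (.const 1)).cost) (HaltsWithin.setNat ?_)
        (by simp [NExp.cost, NExp.var]) (fun _ h => h)
    refine ⟨[X], StoresFamily.append_singleton (fun l hl => ?_) ?_ ?_ ?_, by simp, ?_, ?_⟩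
    · have := hF.2 l hl
      rw [← (h4 l hl).1, ← (h4 l hl).2] at this
      simpa [Memory.setNat_nat_of_ne] using this
    · simp [NExp.eval, Memory.setNat, hW3 υ h1, L]
    · simpa [Memory.setNat_nat_of_ne] using h5
    · simpa [Memory.setNat_nat_of_ne] using h6
    · intro S hS
      rw [List.mem_singleton] at hS
      subst hS
      exact ⟨hcard, Finset.filter_subset _ _⟩
    · rintro Y ⟨rfl, -⟩; simp
  · obtain ⟨h1, h2, h4, h5, h6⟩ := h
    rw [hXn] at h5
    have hcard : X.card ≠ s := by
      rw [Test.holds_natEq] at hb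
      simpa [NExp.eval, hW3 υ h1, h5, h1.1 1 (by simp [W]), hin.s_eq] using hb
    refine (HaltsWithin.skip (Q := fun υ' => υ' = υ) rfl).mono (by omega) ?_
    rintro υ' rfl
    refine ⟨[], ⟨by simpa [Memory.numCandidates] using hW3 υ' h1, fun l hl => ?_⟩,
      by simp, by simp, ?_⟩
    · have hl' : l < F.length := by simpa using hl
      have := hF.2 l hl'
      rw [← (h4 l hl').1, ← (h4 l hl').2] at this
      simpa using this
    · rintro Y ⟨rfl, h⟩
      exact absurd h hcard
  · simp [NExp.cost, NExp.var, Test.natEq, Test.cost]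
    ring_nf
    omega

end Enumeration

/-! ### Enumerating the shallow hyperplanes of a pencil -/

section Enumeration

/-- The number `n + m + 2` of points: one for each column of the matrix, and `m + 2` additional
ones, whose columns are zero in the memory. -/
def numPoints (m : ℕ) : NExp := .add (.var 0) (.const (m + 2))

/-- The reference point of the pencil. -/
def refPoint : NExp := .add (.var 0) (.var 6)

variable {m : ℕ} (pr : Fin (m + 1) → ℕ × ℕ)

/-- Tests whether the point in variable `8` is unmarked, belongs to the class `c`, and improves on
the point in variable `9`, if variable `10` indicates that there is one. -/
noncomputable def selectTest (c σ : Bool) : Test :=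
  .conj (.natLE (.get 11 (.var 8) (.const 0)) (.const 0))
    (.conj (sideTest pr pencilVar c refPoint (.var 8))
      (.or (.natLE (.var 10) (.const 0)) (sideTest pr pencilVar σ (.var 9) (.var 8))))

/-- Selects an unmarked point of the class `c` that is last in the rotational order given by `σ`. -/
noncomputable def selectPoint (c σ : Bool) : Program :=
  .seq (.setNat 10 (.const 0) (.const 0) (.const 0))
    (.forLoop 8 (numPoints m) (.ite (selectTest pr c σ)
      (.seq (.setNat 9 (.const 0) (.const 0) (.var 8))
        (.setNat 10 (.const 0) (.const 0) (.const 1))) .skip))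

/-- Selects and marks a point, and lists all cut sets of the hyperplane through it. -/
noncomputable def pencilRound (c σ : Bool) : Program :=
  .seq (selectPoint pr c σ)
    (.ite (.natLE (.const 1) (.var 10))
      (.seq (.setNat 11 (.var 9) (.const 0) (.const 1))
        (.seqList ((Finset.univ : Finset (Finset (Fin (m + 1)))).toList.map (listCut pr σ))))
      .skip)

/-- Unmarks all points, and then selects the last `s + m + 3` ones of the class `z.1` in the order
given by the side `z.2`: one more than the number of points that a shallow hyperplane may have on
that side. -/
noncomputable def pencilScan (z : Bool × Bool) : Program :=
  .seq (.forLoop 8 (numPoints m) (.setNat 11 (.var 8) (.const 0) (.const 0)))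
    (.forLoop 7 (.add (.var 1) (.const (m + 3))) (pencilRound pr z.1 z.2))

variable {n s : ℕ} {A : ℕ → ℕ → ℝ} {E : EigSolver}

/-- The point `k` belongs to the class and is unmarked. -/
def Selectable {m : ℕ} (b : ℕ → Fin (m + 1) → ℝ) (n : ℕ) (I : Fin m → ℕ) (z : ℕ) (c : Bool)
    (τ : Memory) (k : ℕ) : Prop :=
  (k < n + (m + 2) ∧ OnSide b I c z k) ∧ τ.nat 11 k 0 = 0

theorem pencilOf_congr {W : ℕ → Prop} {σ τ : Memory} (h : AgreesOff W σ τ)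
    (hW : ∀ a, 20 ≤ a → ¬ W a) : pencilOf m τ = pencilOf m σ := by
  funext a; simp only [pencilOf]; rw [h.1 _ (hW _ (by omega))]

/-- The selection finds an unmarked point of the class whenever there is one, and a last one if the
class is strictly ordered; no assumption on the order is needed for termination, so that the program
may also run on degenerate pencils. -/
theorem haltsWithin_selectPoint (c σ : Bool) {τ : Memory}
    (hin : InputStored n s (n + (m + 2)) A τ)
    (hI : ∀ a : Fin m, pencilOf m τ a < n + (m + 2)) (hz : n + τ.nat 6 0 0 < n + (m + 2)) :
    HaltsWithin E (selectPoint pr c σ) τ ((n + (m + 2)) * ((selectTest pr c σ).cost + 60) + 60)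
      (fun υ => AgreesOff (fun a => a = 8 ∨ a = 9 ∨ a = 10) τ υ ∧
        ((υ.nat 10 0 0 = 0 ∧
            ∀ k, ¬ Selectable (quadPoint pr A) n (pencilOf m τ) (n + τ.nat 6 0 0) c τ k) ∨
          (υ.nat 10 0 0 = 1 ∧
            Selectable (quadPoint pr A) n (pencilOf m τ) (n + τ.nat 6 0 0) c τ (υ.nat 9 0 0) ∧
            (IsStrictTotalOn
                (fun x => x < n + (m + 2) ∧
                  OnSide (quadPoint pr A) (pencilOf m τ) c (n + τ.nat 6 0 0) x)
                (OnSide (quadPoint pr A) (pencilOf m τ) σ) →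
              ∀ k, Selectable (quadPoint pr A) n (pencilOf m τ) (n + τ.nat 6 0 0) c τ k →
                ¬ OnSide (quadPoint pr A) (pencilOf m τ) σ (υ.nat 9 0 0) k)))) := by
  set b := quadPoint pr A with hb
  set I := pencilOf m τ with hIdef
  set z := n + τ.nat 6 0 0 with hzdef
  set N := n + (m + 2) with hN
  let W : ℕ → Prop := fun a => a = 8 ∨ a = 9 ∨ a = 10
  let Inv : ℕ → Memory → Prop := fun t υ => AgreesOff W τ υ ∧ υ.nat 8 0 0 = t ∧
    ((υ.nat 10 0 0 = 0 ∧ ∀ k < t, ¬ Selectable b n I z c τ k) ∨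
      (υ.nat 10 0 0 = 1 ∧ Selectable b n I z c τ (υ.nat 9 0 0) ∧
        (IsStrictTotalOn (fun x => x < N ∧ OnSide b I c z x) (OnSide b I σ) →
          ∀ k < t, Selectable b n I z c τ k → ¬ OnSide b I σ (υ.nat 9 0 0) k)))
  have hloop : ∀ υ, υ = τ.setNat 10 0 0 0 → HaltsWithin E
      (.forLoop 8 (numPoints m) (.ite (selectTest pr c σ)
        (.seq (.setNat 9 (.const 0) (.const 0) (.var 8))
          (.setNat 10 (.const 0) (.const 0) (.const 1))) .skip)) υ
      (N * ((1 + (selectTest pr c σ).cost + 20) + (numPoints m).cost + 20) +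
        (numPoints m).cost + 20)
      (Inv N) := by
    rintro υ rfl
    refine HaltsWithin.forLoop Inv ?_ ?_ ?_
    · refine ⟨(AgreesOff.setNat τ (by simp [W]) _ _ _).trans
        (AgreesOff.setNat _ (by simp [W]) _ _ _),
        by simp [Memory.setNat], Or.inl ⟨by simp [Memory.setNat], by simp⟩⟩
    · rintro t υ ⟨h1, h2, -⟩
      exact ⟨h2, by simp [numPoints, NExp.eval, h1.1 0 (by simp [W]), hin.n_eq, hN]⟩
    · rintro t ht υ ⟨h1, h2, h3⟩
      have hinυ := hin.congr h1 (by simp [W]) (by simp [W])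
      have hpen : pencilOf m υ = I := pencilOf_congr h1 (by simp only [W]; omega)
      have h6 : υ.nat 6 = τ.nat 6 := h1.1 6 (by simp [W])
      have h11 : υ.nat 11 = τ.nat 11 := h1.1 11 (by simp [W])
      have hp : ∀ a : Fin m, (pencilVar a).eval υ < N := by
        intro a; have := hI a; rw [← hpen] at this; exact this
      have hp' : (fun a : Fin m => (pencilVar a).eval υ) = I := hpen
      have href : (refPoint).eval υ = z := by simp [refPoint, NExp.eval, hinυ.n_eq, h6, hzdef]
      have htest : (selectTest pr c σ).holds υ ↔ Selectable b n I z c τ t ∧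
          (υ.nat 10 0 0 = 0 ∨ (sideTest pr pencilVar σ (.var 9) (.var 8)).holds υ) := by
        simp only [selectTest, Test.holds, Test.holds_or]
        rw [holds_sideTest (I := pencilVar) (x := refPoint) (y := .var 8) hinυ.index_eq hp
          (by rw [href]; exact hz) (by rw [NExp.eval_var, h2]; exact ht), hinυ.real_eq, hp', href]
        simp [NExp.eval, h2, h11, Selectable, ht, hb, ← hN]
        tauto
      have hstep : ∀ υ' : Memory, υ' = (υ.setNat 9 0 0 t).setNat 10 0 0 1 →
          (Selectable b n I z c τ t) →
          (IsStrictTotalOn (fun x => x < N ∧ OnSide b I c z x) (OnSide b I σ) →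
            ∀ k ≤ t, Selectable b n I z c τ k → ¬ OnSide b I σ t k) →
          υ'.nat 8 0 0 = t ∧ Inv (t + 1) (υ'.setNat 8 0 0 (t + 1)) := by
        rintro _ rfl hsel hmax
        refine ⟨by simp [Memory.setNat, h2],
          ((h1.trans (AgreesOff.setNat _ (by simp [W]) _ _ _)).trans
          (AgreesOff.setNat _ (by simp [W]) _ _ _)).trans (AgreesOff.setNat _ (by simp [W]) _ _ _),
          by simp [Memory.setNat], Or.inr ⟨by simp [Memory.setNat], ?_, fun h k hk => ?_⟩⟩
        · simpa [Memory.setNat] using hsel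
        · simpa [Memory.setNat] using hmax h k (by omega)
      have hkeep : Inv (t + 1) (υ.setNat 8 0 0 (t + 1)) ↔
          ((υ.nat 10 0 0 = 0 ∧ ∀ k < t + 1, ¬ Selectable b n I z c τ k) ∨
      (υ.nat 10 0 0 = 1 ∧ Selectable b n I z c τ (υ.nat 9 0 0) ∧
        (IsStrictTotalOn (fun x => x < N ∧ OnSide b I c z x) (OnSide b I σ) →
          ∀ k < t + 1, Selectable b n I z c τ k → ¬ OnSide b I σ (υ.nat 9 0 0) k))) := by
        have := h1.trans (AgreesOff.setNat υ (show W 8 by simp [W]) 0 0 (t + 1))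
        simp only [Inv, this, true_and]
        simp [Memory.setNat]
      have hrun : HaltsWithin E (.seq (.setNat 9 (.const 0) (.const 0) (.var 8))
          (.setNat 10 (.const 0) (.const 0) (.const 1))) υ 20
          (fun υ' => υ' = (υ.setNat 9 0 0 t).setNat 10 0 0 1) := by
        refine ((HaltsWithin.setNat (Q := fun υ' => υ' = υ.setNat 9 0 0 t) ?_).seq
          (T' := 1 + (NExp.const 0).cost + (NExp.const 0).cost + (NExp.const 1).cost)
          fun υ' h => HaltsWithin.setNat ?_).mono ?_ fun _ h => h
        · simp [NExp.eval, h2]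
        · simp [NExp.eval, h]
        · simp [NExp.cost, NExp.var]
      refine HaltsWithin.ite (fun hb => ?_) (fun hb => ?_)
      · obtain ⟨hsel, hor⟩ := htest.1 hb
        refine hrun.mono (by omega) fun υ' hυ' => hstep υ' hυ' hsel fun hord k hk hkS hlt => ?_
        have htt : ¬ OnSide b I σ t t := fun h => hord.asymm t t hsel.1 hsel.1 h h
        rcases hk.eq_or_lt with rfl | hk
        · exact htt hlt
        rcases h3 with ⟨-, hnone⟩ | ⟨h10, hbest, hmax⟩
        · exact hnone k hk hkS
        · have hside : OnSide b I σ (υ.nat 9 0 0) t := by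
            have h := hor.resolve_left (by omega)
            rw [holds_sideTest (I := pencilVar) (x := .var 9) (y := .var 8) hinυ.index_eq hp
              (by rw [NExp.eval_var]; exact hbest.1.1) (by rw [NExp.eval_var, h2]; exact ht),
              hinυ.real_eq, hp', NExp.eval_var, NExp.eval_var, h2] at h
            exact h
          -- `best < t < k` contradicts the maximality of `best`
          exact hmax hord k hk hkS (hord.trans _ _ _ hbest.1 hsel.1 hkS.1 hside hlt)
      · refine (HaltsWithin.skip (Q := fun υ' => υ' = υ) rfl).mono (by omega) ?_
        rintro υ' rfl
        refine ⟨h2, hkeep.2 ?_⟩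
        rw [htest] at hb
        rcases h3 with ⟨h10, hnone⟩ | ⟨h10, hbest, hmax⟩
        · refine Or.inl ⟨h10, fun k hk hkS => ?_⟩
          rcases Nat.lt_succ_iff_lt_or_eq.1 hk with hk | rfl
          · exact hnone k hk hkS
          · exact hb ⟨hkS, Or.inl h10⟩
        · refine Or.inr ⟨h10, hbest, fun hord k hk hkS hlt => ?_⟩
          rcases Nat.lt_succ_iff_lt_or_eq.1 hk with hk | rfl
          · exact hmax hord k hk hkS hlt
          · refine hb ⟨hkS, Or.inr ?_⟩
            rw [holds_sideTest (I := pencilVar) (x := .var 9) (y := .var 8) hinυ.index_eq hp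
              (by rw [NExp.eval_var]; exact hbest.1.1) (by rw [NExp.eval_var, h2]; exact ht),
              hinυ.real_eq, hp', NExp.eval_var, NExp.eval_var, h2]
            exact hlt
  refine ((HaltsWithin.setNat (Q := fun υ => υ = τ.setNat 10 0 0 0) rfl).seq hloop).mono ?_ ?_
  · simp [NExp.cost, NExp.var, numPoints]
    ring_nf
    omega
  · rintro υ ⟨h1, -, h3⟩
    refine ⟨h1, ?_⟩
    rcases h3 with ⟨h10, hnone⟩ | ⟨h10, hbest, hmax⟩
    · exact Or.inl ⟨h10, fun k hk => hnone k hk.1.1 hk⟩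
    · exact Or.inr ⟨h10, hbest, fun hord k hk => hmax hord k hk.1.1 hk⟩

theorem natIn_pencilRound (c σ : Bool) :
    (pencilRound pr c σ).NatIn (fun a => (3 ≤ a ∧ a ≤ 5) ∨ (8 ≤ a ∧ a ≤ 11)) := by
  refine ⟨by simp [selectPoint, Program.NatIn], ⟨by simp [Program.NatIn], ?_⟩, trivial⟩
  refine Program.natIn_seqList fun P hP => ?_
  obtain ⟨J, -, rfl⟩ := List.mem_map.1 hP
  exact natIn_listCut pr (by omega) (by omega) (by omega) (by omega) σ J

theorem realIn_pencilRound (c σ : Bool) (V : ℕ → Prop) : (pencilRound pr c σ).RealIn V := by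
  refine ⟨by simp [selectPoint, Program.RealIn], ⟨by simp [Program.RealIn], ?_⟩, trivial⟩
  refine Program.realIn_seqList fun P hP => ?_
  obtain ⟨J, -, rfl⟩ := List.mem_map.1 hP
  exact realIn_listCut pr σ J V

theorem natIn_pencilScan (z : Bool × Bool) :
    (pencilScan pr z).NatIn (fun a => (3 ≤ a ∧ a ≤ 5) ∨ (7 ≤ a ∧ a ≤ 11)) := by
  refine ⟨by simp [Program.NatIn], ?_⟩
  rw [Program.natIn_forLoop]
  exact ⟨by omega, (natIn_pencilRound pr z.1 z.2).mono fun a => by omega⟩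

theorem realIn_pencilScan (z : Bool × Bool) (V : ℕ → Prop) : (pencilScan pr z).RealIn V := by
  refine ⟨by simp [Program.RealIn], ?_⟩
  rw [Program.realIn_forLoop]
  exact realIn_pencilRound pr z.1 z.2 V

/-- A common bound for the costs of the tests in the program. -/
noncomputable def testCost (pr : Fin (m + 1) → ℕ × ℕ) : ℕ :=
  ∑ c : Bool, ∑ σ : Bool, (selectTest pr c σ).cost +
    ∑ σ : Bool, ∑ J : Finset (Fin (m + 1)), (cutTest pr σ J).cost

theorem cost_selectTest_le (c σ : Bool) : (selectTest pr c σ).cost ≤ testCost pr := by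
  refine le_trans ?_ (Nat.le_add_right _ _)
  exact (Finset.single_le_sum (f := fun σ => (selectTest pr c σ).cost) (fun _ _ => Nat.zero_le _)
    (Finset.mem_univ σ)).trans (Finset.single_le_sum
      (f := fun c => ∑ σ : Bool, (selectTest pr c σ).cost) (fun _ _ => Nat.zero_le _)
    (Finset.mem_univ c))

theorem cost_cutTest_le (σ : Bool) (J : Finset (Fin (m + 1))) :
    (cutTest pr σ J).cost ≤ testCost pr := by
  refine le_trans ?_ (Nat.le_add_left _ _)
  exact (Finset.single_le_sum (f := fun J => (cutTest pr σ J).cost) (fun _ _ => Nat.zero_le _)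
    (Finset.mem_univ J)).trans (Finset.single_le_sum
      (f := fun σ => ∑ J : Finset (Fin (m + 1)), (cutTest pr σ J).cost)
      (fun _ _ => Nat.zero_le _) (Finset.mem_univ σ))

/-- One round either finds nothing to select or selects an extreme point, marks it, and lists all
cut sets of its hyperplane. -/
theorem haltsWithin_pencilRound (c σ : Bool) {τ : Memory}
    (hin : InputStored n s (n + (m + 2)) A τ)
    (hI : ∀ a : Fin m, pencilOf m τ a < n + (m + 2)) (hz : n + τ.nat 6 0 0 < n + (m + 2))
    {F : List (Finset ℕ)} (hF : StoresFamily τ F) :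
    HaltsWithin E (pencilRound pr c σ) τ
      ((2 ^ (m + 1) + 1) * ((n + (m + 2)) * (testCost pr + 60) + 200))
      (fun υ => ∃ G, StoresFamily υ (F ++ G) ∧ G.length ≤ 2 ^ (m + 1) ∧
        (∀ S ∈ G, S.card = s ∧ S ⊆ Finset.range n) ∧
        ((υ.nat 11 = τ.nat 11 ∧
            ∀ k, ¬ Selectable (quadPoint pr A) n (pencilOf m τ) (n + τ.nat 6 0 0) c τ k) ∨
          ∃ j, (∀ k, υ.nat 11 k 0 = if k = j then 1 else τ.nat 11 k 0) ∧
            Selectable (quadPoint pr A) n (pencilOf m τ) (n + τ.nat 6 0 0) c τ j ∧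
            (IsStrictTotalOn
                (fun x => x < n + (m + 2) ∧
                  OnSide (quadPoint pr A) (pencilOf m τ) c (n + τ.nat 6 0 0) x)
                (OnSide (quadPoint pr A) (pencilOf m τ) σ) →
              ∀ k, Selectable (quadPoint pr A) n (pencilOf m τ) (n + τ.nat 6 0 0) c τ k →
                ¬ OnSide (quadPoint pr A) (pencilOf m τ) σ j k) ∧
            ∀ J, (cutSet (quadPoint pr A) n (pencilOf m τ) σ j J).card = s →
              cutSet (quadPoint pr A) n (pencilOf m τ) σ j J ∈ G)) := by
  set b := quadPoint pr A with hb
  set I := pencilOf m τ with hIdef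
  set z := n + τ.nat 6 0 0 with hzdef
  set N := n + (m + 2) with hN
  let L := (Finset.univ : Finset (Finset (Fin (m + 1)))).toList
  have hLlen : L.length = 2 ^ (m + 1) := by simp [L]
  let W : ℕ → Prop := fun a => a = 3 ∨ a = 4 ∨ a = 5 ∨ a = 8
  refine ((haltsWithin_selectPoint (E := E) pr c σ hin hI hz).seq
    (T' := 1 + 10 + (2 ^ (m + 1) * (n * (testCost pr + 60) + 91) + 20)) ?_).mono ?_ fun _ h => h
  · rintro υ ⟨h1, h2⟩
    have hFυ : StoresFamily υ F := hF.congr (h1.1 3 (by simp)) (h1.1 4 (by simp)) (h1.1 5 (by simp))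
    have h11 : υ.nat 11 = τ.nat 11 := h1.1 11 (by simp)
    refine HaltsWithin.mono (T := 1 + (Test.natLE (.const 1) (.var 10)).cost +
      (2 ^ (m + 1) * (n * (testCost pr + 60) + 91) + 20))
      (HaltsWithin.ite (fun hb => ?_) (fun hb => ?_))
      (by simp [Test.cost, NExp.cost, NExp.var]) (fun _ h => h)
    · have h10 : 1 ≤ υ.nat 10 0 0 := by simpa [Test.holds, NExp.eval] using hb
      rcases h2 with ⟨h, -⟩ | ⟨-, hsel, hmax⟩
      · omega
      set j := υ.nat 9 0 0 with hj
      refine ((HaltsWithin.setNat (Q := fun υ' => υ' = υ.setNat 11 j 0 1) ?_).seq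
        (T' := 2 ^ (m + 1) * (n * (testCost pr + 60) + 90 + 1) + 1) ?_).mono ?_ fun _ h => h
      · simp [NExp.eval, hj]
      · rintro υ' rfl
        have h3 := (h1.mono (W' := fun a => a = 8 ∨ a = 9 ∨ a = 10 ∨ a = 11)
            (fun a => by omega)).trans
          (AgreesOff.setNat υ (a := 11) (by simp) j 0 1)
        have hall := Appends.seqList (E := E) (n := n) (s := s) (P := listCut pr σ)
          (σ := υ.setNat 11 j 0 1) (B := n * (testCost pr + 60) + 90) (g := 1) (W := W)
          (Req := fun J X => X = cutSet b n I σ j J ∧ X.card = s)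
          (fun J => natIn_listCut pr (by simp [W]) (by simp [W]) (by simp [W]) (by simp [W]) σ J)
          (fun J => realIn_listCut pr σ J _) (fun J υ' hυ' => ?_) L F
          (hFυ.congr (Memory.setNat_nat_of_ne _ (by omega) _ _ _)
            (Memory.setNat_nat_of_ne _ (by omega) _ _ _)
            (Memory.setNat_nat_of_ne _ (by omega) _ _ _))
        · have hfr := hall.agreesOff (W := W) (Program.natIn_seqList fun P hP => by
            obtain ⟨J, -, rfl⟩ := List.mem_map.1 hP
            exact natIn_listCut pr (by simp [W]) (by simp [W]) (by simp [W]) (by simp [W]) σ J)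
            (Program.realIn_seqList fun P hP => by
              obtain ⟨J, -, rfl⟩ := List.mem_map.1 hP
              exact realIn_listCut pr σ J _)
          refine hfr.mono (by rw [hLlen]) ?_
          rintro υ'' ⟨⟨G, g1, g2, g3, g4⟩, g5⟩
          refine ⟨G, g1, by rw [hLlen] at g2; omega, g3,
            Or.inr ⟨j, fun k => ?_, hsel, hmax, fun J hJ => ?_⟩⟩
          · rw [g5.1 11 (by simp [W]), ← h11]
            simp [Memory.setNat]
          · exact g4 _ ⟨J, by simp [L], rfl, hJ⟩
        · have h4 : AgreesOff
              (fun a => a = 3 ∨ a = 4 ∨ a = 5 ∨ a = 8 ∨ a = 9 ∨ a = 10 ∨ a = 11) τ υ' :=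
            (h3.mono fun a => by omega).trans (hυ'.mono fun a => by simp only [W]; omega)
          have hpen : pencilOf m υ' = I := pencilOf_congr h4 (by omega)
          have h9 : υ'.nat 9 0 0 = j := by
            rw [hυ'.1 9 (by simp [W]), Memory.setNat_nat_of_ne _ (by omega)]
          have := appends_listCut (E := E) (A := A) n s m pr σ J (τ := υ')
            (hin.congr h4 (by simp) (by simp)) (by rw [hpen]; exact hI) (by rw [h9]; exact hsel.1.1)
          rw [hpen, h9] at this
          refine this.mono ?_ le_rfl fun _ h => h
          have := cost_cutTest_le pr σ J
          gcongr
      · simp [NExp.cost, NExp.var]; ring_nf; omega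
    · have h10 : ¬ 1 ≤ υ.nat 10 0 0 := by simpa [Test.holds, NExp.eval] using hb
      refine (HaltsWithin.skip (Q := fun υ' => υ' = υ) rfl).mono (by omega) ?_
      rintro υ' rfl
      rcases h2 with ⟨-, hnone⟩ | ⟨h, -⟩
      · exact ⟨[], by simpa using hFυ, by simp, by simp, Or.inl ⟨h11, hnone⟩⟩
      · omega
  · have h1 := cost_selectTest_le pr c σ
    have h2 : N * ((selectTest pr c σ).cost + 60) ≤ N * (testCost pr + 60) := by gcongr
    have h3 : n * (testCost pr + 60) ≤ N * (testCost pr + 60) := by gcongr; omega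
    have h4 : 2 ^ (m + 1) * (n * (testCost pr + 60) + 91) ≤
      2 ^ (m + 1) * (N * (testCost pr + 60) + 200) := by gcongr; omega
    rw [Nat.succ_mul, ← hN]
    omega

/-- Scanning a pencil lists all cut sets of its shallow hyperplanes. After `t` rounds, a shallow
hyperplane has either been treated or is followed, in the rotational order, by those through `t`
selected points, all of which lie on its side `z.2`; the latter is impossible after `s + m + 3`
rounds. -/
theorem appends_pencilScan (z : Bool × Bool) {τ : Memory}
    (hin : InputStored n s (n + (m + 2)) A τ)
    (hI : ∀ a : Fin m, pencilOf m τ a < n + (m + 2)) (hz : τ.nat 6 0 0 < m + 2) :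
    Appends E n s (pencilScan pr z) τ
      ((s + m + 4) * ((2 ^ (m + 1) + 1) * ((n + (m + 2)) * (testCost pr + 60) + 200) + 100))
      ((s + (m + 3)) * 2 ^ (m + 1))
      (fun X => ∃ j J, IsShallow (quadPoint pr A) n s (pencilOf m τ) (n + τ.nat 6 0 0) z.1 z.2 j ∧
        X = cutSet (quadPoint pr A) n (pencilOf m τ) z.2 j J ∧ X.card = s) := by
  intro F hF
  obtain ⟨c, σ⟩ := z
  simp only
  set b := quadPoint pr A with hb
  set I := pencilOf m τ with hIdef
  set z := n + τ.nat 6 0 0 with hzdef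
  set N := n + (m + 2) with hN
  set B := (2 ^ (m + 1) + 1) * (N * (testCost pr + 60) + 200) with hB
  have hreset : HaltsWithin E (.forLoop 8 (numPoints m) (.setNat 11 (.var 8)
      (.const 0) (.const 0))) τ
      (N * (10 + (numPoints m).cost + 20) + (numPoints m).cost + 20)
      (fun υ => AgreesOff (fun a => a = 8 ∨ a = 11) τ υ ∧ υ.nat 8 0 0 = N ∧ ∀ k < N,
        υ.nat 11 k 0 = 0) := by
    refine HaltsWithin.forLoop (fun t υ => AgreesOff (fun a => a = 8 ∨ a = 11) τ υ ∧
      υ.nat 8 0 0 = t ∧ ∀ k < t, υ.nat 11 k 0 = 0) ?_ ?_ ?_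
    · exact ⟨AgreesOff.setNat _ (by simp) _ _ _, by simp [Memory.setNat], by simp⟩
    · rintro t υ ⟨h1, h2, -⟩
      exact ⟨h2, by simp [numPoints, NExp.eval, h1.1 0 (by simp), hin.n_eq, hN]⟩
    · rintro t ht υ ⟨h1, h2, h3⟩
      refine HaltsWithin.mono (T := 1 + (NExp.var 8).cost + (NExp.const 0).cost +
        (NExp.const 0).cost)
        (HaltsWithin.setNat ?_) (by simp [NExp.cost, NExp.var]) fun _ h => h
      simp only [NExp.eval_var, h2, NExp.eval]
      refine ⟨by simp [Memory.setNat, h2], (h1.trans (AgreesOff.setNat _ (by simp) _ _ _)).trans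
        (AgreesOff.setNat _ (by simp) _ _ _), by simp [Memory.setNat], fun k hk => ?_⟩
      simp only [Memory.setNat]
      simp only [show (11 : ℕ) ≠ 8 by omega, false_and, if_false, true_and, and_true]
      split_ifs with hkt
      · rfl
      · exact h3 k (by omega)
  let W : ℕ → Prop := fun a => (3 ≤ a ∧ a ≤ 5) ∨ (7 ≤ a ∧ a ≤ 11)
  refine (hreset.seq (T' := (s + (m + 3)) * (B + 30) + 30) fun υ0 hυ0 => ?_).mono ?_ fun _ h => h
  · obtain ⟨h1, -, h3⟩ := hυ0
    have hF0 : StoresFamily υ0 F := hF.congr (h1.1 3 (by simp)) (h1.1 4 (by simp))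
        (h1.1 5 (by simp))
    refine (HaltsWithin.forLoop (B := B) (N := s + (m + 3)) (fun t υ => AgreesOff W τ υ ∧
      υ.nat 7 0 0 = t ∧
      ∃ G, StoresFamily υ (F ++ G) ∧ G.length ≤ t * 2 ^ (m + 1) ∧
        (∀ S ∈ G, S.card = s ∧ S ⊆ Finset.range n) ∧
        ∀ j, IsShallow b n s I z c σ j →
          (∀ J, (cutSet b n I σ j J).card = s → cutSet b n I σ j J ∈ G) ∨
          (υ.nat 11 j 0 = 0 ∧ ∃ T : Finset ℕ, T.card = t ∧
            ∀ x ∈ T, x < N ∧ OnSide b I σ j x ∧ υ.nat 11 x 0 ≠ 0)) ?_ ?_ ?_).mono ?_ ?_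
    · refine ⟨(h1.mono fun a => by simp only [W]; omega).trans
        (AgreesOff.setNat _ (by simp [W]) _ _ _),
        by simp [Memory.setNat], [], ?_, by simp, by simp, fun j hj => Or.inr ⟨?_, ∅, by simp⟩⟩
      · simpa using hF0.congr (Memory.setNat_nat_of_ne _ (by omega) _ _ _)
            (Memory.setNat_nat_of_ne _ (by omega) _ _ _)
            (Memory.setNat_nat_of_ne _ (by omega) _ _ _)
      · rw [Memory.setNat_nat_of_ne _ (by omega)]
        exact h3 j hj.lt_j
    · rintro t υ ⟨h4, h5, -⟩
      exact ⟨h5, by simp [NExp.eval, h4.1 1 (by simp [W]), hin.s_eq]⟩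
    · rintro t ht υ ⟨h4, h5, G, g1, g2, g3, g4⟩
      have hpen : pencilOf m υ = I := pencilOf_congr h4 (by simp only [W]; omega)
      have h6 : υ.nat 6 = τ.nat 6 := h4.1 6 (by simp [W])
      have hround := haltsWithin_pencilRound (E := E) (A := A) (s := s) pr c σ
          (τ := υ) (F := F ++ G)
        (hin.congr h4 (by simp [W]) (by simp [W]))
        (by rw [hpen]; exact hI) (by rw [h6]; omega) g1
      rw [hpen, h6, ← hb, ← hzdef, ← hN, ← hB] at hround
      refine (hround.agreesOff (natIn_pencilRound pr c σ)
        (realIn_pencilRound pr c σ _)).mono le_rfl ?_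
      rintro υ' ⟨⟨G', f1, f2, f3, f4⟩, f5⟩
      refine ⟨by rw [f5.1 7 (by omega), h5],
        (h4.trans (f5.mono fun a => by simp only [W]; omega)).trans
        (AgreesOff.setNat _ (by simp [W]) _ _ _), by simp [Memory.setNat], G ++ G', ?_, ?_, ?_, ?_⟩
      · simpa using f1.congr (Memory.setNat_nat_of_ne _ (by omega) _ _ _)
            (Memory.setNat_nat_of_ne _ (by omega) _ _ _)
            (Memory.setNat_nat_of_ne _ (by omega) _ _ _)
      · simp only [List.length_append, Nat.succ_mul]; omega
      · intro S hS
        rcases List.mem_append.1 hS with hS | hS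
        exacts [g3 S hS, f3 S hS]
      · intro j hj
        rw [Memory.setNat_nat_of_ne _ (by omega)]
        rcases g4 j hj with hfound | ⟨hun, T, hT, hTx⟩
        · exact Or.inl fun J hJ => List.mem_append_left _ (hfound J hJ)
        have hjs : Selectable b n I z c υ j := ⟨⟨hj.lt_j, hj.mem_class⟩, hun⟩
        rcases f4 with ⟨-, hnone⟩ | ⟨j', hmark, hsel, hmax, hlist⟩
        · exact absurd hjs (hnone j)
        by_cases hjj : j = j'
        · subst hjj
          exact Or.inl fun J hJ => List.mem_append_right _ (hlist J hJ)
        · -- the selected point follows `j` in the order, and is added to `T`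
          refine Or.inr ⟨by rw [hmark, if_neg hjj, hun], insert j' T, ?_, ?_⟩
          · rw [Finset.card_insert_of_notMem, hT]
            exact fun h => (hTx _ h).2.2 hsel.2
          · intro x hx
            rw [hmark]
            rcases Finset.mem_insert.1 hx with rfl | hx
            · refine ⟨hsel.1.1, ?_, by simp⟩
              exact (hj.order.total _ _ hjs.1 hsel.1 hjj).resolve_right (hmax hj.order j hjs)
            · refine ⟨(hTx x hx).1, (hTx x hx).2.1, ?_⟩
              split_ifs
              · simp
              · exact (hTx x hx).2.2
    · simp [NExp.cost, NExp.var]; ring_nf; omega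
    · rintro υ ⟨-, -, G, g1, g2, g3, g4⟩
      refine ⟨G, g1, g2, g3, ?_⟩
      rintro X ⟨j, J, hj, rfl, hX⟩
      rcases g4 j hj with h | ⟨-, T, hT, hTx⟩
      · exact h J hX
      · have := hj.card_le T fun x hx => ⟨(hTx x hx).1, (hTx x hx).2.1⟩
        omega
  · have h1 : N * (10 + (numPoints m).cost + 20) ≤ B := by
      have : (1 : ℕ) ≤ 2 ^ (m + 1) + 1 := Nat.le_add_left _ _
      calc N * (10 + (numPoints m).cost + 20) ≤ 1 * (N * (testCost pr + 60) + 200) := by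
            simp only [numPoints, NExp.cost, NExp.var, one_mul]
            exact le_trans (Nat.mul_le_mul_left _ (by omega)) (Nat.le_add_right _ _)
        _ ≤ B := by rw [hB]; gcongr
    have h2 : (s + m + 4) * (B + 100) = (s + (m + 3)) * (B + 30) + (s + (m + 3)) * 70 + B + 100 := by
      ring
    rw [h2]
    have : 70 * 3 ≤ (s + (m + 3)) * 70 := by nlinarith
    simp only [numPoints, NExp.cost, NExp.var] at h1 ⊢
    omega

end Enumeration

/-! ### Enumerating all candidate sets -/

section Enumeration

variable {m : ℕ} (pr : Fin (m + 1) → ℕ × ℕ)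

/-- Scans the current pencil with respect to all reference points, classes and sides. -/
noncomputable def pencilAll : Program :=
  .forLoop 6 (.const (m + 2))
    (.seqList ((Finset.univ : Finset (Bool × Bool)).toList.map (pencilScan pr)))

/-- Runs through all values of the first `a` pencil variables. -/
noncomputable def pencilLoops : ℕ → Program
  | 0 => pencilAll pr
  | a + 1 => .forLoop (20 + a) (numPoints m) (pencilLoops a)

/-- Writes the real number `i` into cell `(i, 0)` of real array `2`. -/
def writeIndices (m : ℕ) : Program :=
  .forLoop 8 (numPoints m) (.setReal 2 (.add (.var 8) (.const 1)) (.const 0)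
    (.add (.get 2 (.var 8) (.const 0)) (.const 1)))

/-- Lists all candidate sets. -/
noncomputable def enumerate : Program := .seq (writeIndices m) (pencilLoops pr m)

variable {n s : ℕ} {A : ℕ → ℕ → ℝ} {E : EigSolver}

/-- The sets of size `s` that some shallow hyperplane through the points `I` cuts off. -/
def IsPencilCut {m : ℕ} (b : ℕ → Fin (m + 1) → ℝ) (n s : ℕ) (I : Fin m → ℕ) (X : Finset ℕ) : Prop :=
  ∃ z c σ j J, n ≤ z ∧ z < n + (m + 2) ∧ IsShallow b n s I z c σ j ∧ X = cutSet b n I σ j J ∧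
    X.card = s

theorem natIn_pencilAll : (pencilAll pr).NatIn (fun a => (3 ≤ a ∧ a ≤ 5) ∨ (6 ≤ a ∧ a ≤ 11)) := by
  rw [pencilAll, Program.natIn_forLoop]
  refine ⟨by omega, Program.natIn_seqList fun P hP => ?_⟩
  obtain ⟨J, -, rfl⟩ := List.mem_map.1 hP
  exact (natIn_pencilScan pr J).mono fun a => by omega

theorem realIn_pencilAll (V : ℕ → Prop) : (pencilAll pr).RealIn V := by
  rw [pencilAll, Program.realIn_forLoop]
  refine Program.realIn_seqList fun P hP => ?_
  obtain ⟨J, -, rfl⟩ := List.mem_map.1 hP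
  exact realIn_pencilScan pr J V

theorem natIn_pencilLoops (a : ℕ) :
    (pencilLoops pr a).NatIn (fun i => (3 ≤ i ∧ i ≤ 11) ∨ (20 ≤ i ∧ i < 20 + a)) := by
  induction a with
  | zero => exact (natIn_pencilAll pr).mono fun a => by omega
  | succ a ih =>
    rw [pencilLoops, Program.natIn_forLoop]
    exact ⟨by omega, ih.mono fun a => by omega⟩

theorem realIn_pencilLoops (V : ℕ → Prop) (a : ℕ) : (pencilLoops pr a).RealIn V := by
  induction a with
  | zero => exact realIn_pencilAll pr V
  | succ a ih => rwa [pencilLoops, Program.realIn_forLoop]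

/-- The cut sets of one pencil are listed in time `O(n * s)`. -/
theorem appends_pencilAll {τ : Memory} (hin : InputStored n s (n + (m + 2)) A τ)
    (hI : ∀ a : Fin m, pencilOf m τ a < n + (m + 2)) {B g : ℕ}
    (hB : B = (s + m + 4) * ((2 ^ (m + 1) + 1) * ((n + (m + 2)) * (testCost pr + 60) + 200) + 100))
    (hg : g = (s + (m + 3)) * 2 ^ (m + 1)) :
    Appends E n s (pencilAll pr) τ ((m + 2) * (4 * (B + 1) + 22) + 21) ((m + 2) * (4 * g))
      (IsPencilCut (quadPoint pr A) n s (pencilOf m τ)) := by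
  let W : ℕ → Prop := fun a => (3 ≤ a ∧ a ≤ 5) ∨ (7 ≤ a ∧ a ≤ 11)
  have h := Appends.forLoop (E := E) (n := n) (s := s) (σ := τ) (v := 6) (N := m + 2)
    (b := .const (m + 2)) (W := W)
    (P := .seqList ((Finset.univ : Finset (Bool × Bool)).toList.map (pencilScan pr)))
    (B := 4 * (B + 1) + 1) (g := 4 * g)
    (Req := fun k X => ∃ x ∈ (Finset.univ : Finset (Bool × Bool)).toList, ∃ j J,
      IsShallow (quadPoint pr A) n s (pencilOf m τ) (n + k) x.1 x.2 j ∧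
        X = cutSet (quadPoint pr A) n (pencilOf m τ) x.2 j J ∧ X.card = s)
    (Program.natIn_seqList fun P hP => by
      obtain ⟨J, -, rfl⟩ := List.mem_map.1 hP
      exact natIn_pencilScan pr J)
    (Program.realIn_seqList fun P hP => by
      obtain ⟨J, -, rfl⟩ := List.mem_map.1 hP
      exact realIn_pencilScan pr J _)
    (by simp [W]) (by omega) (fun _ _ => rfl) ?_
  · refine h.mono (by simp [NExp.cost]) le_rfl ?_
    rintro X ⟨z, c, σ, j, J, hz1, hz2, h1, h2, h3⟩
    exact ⟨z - n, by omega, (c, σ), by simp, j, J, by rwa [Nat.add_sub_cancel' hz1], h2, h3⟩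
  · intro k hk υ hυ h6
    have hlen : (Finset.univ : Finset (Bool × Bool)).toList.length = 4 := by simp
    have := Appends.seqList (E := E) (n := n) (s := s) (P := pencilScan pr) (σ := υ)
        (B := B) (g := g)
      (W := W) (Req := fun x X => ∃ j J,
      IsShallow (quadPoint pr A) n s (pencilOf m τ) (n + k) x.1 x.2 j ∧
        X = cutSet (quadPoint pr A) n (pencilOf m τ) x.2 j J ∧ X.card = s)
      (natIn_pencilScan pr) (fun x => realIn_pencilScan pr x _) (fun x υ' hυ' => ?_)
      (Finset.univ : Finset (Bool × Bool)).toList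
    · rwa [hlen] at this
    · have h1 : AgreesOff (fun a => W a ∨ a = 6) τ υ' := hυ.trans (hυ'.mono fun _ => Or.inl)
      have hpen : pencilOf m υ' = pencilOf m τ := pencilOf_congr h1 (by simp only [W]; omega)
      have h6' : υ'.nat 6 0 0 = k := by rw [hυ'.1 6 (by simp [W]), h6]
      have := appends_pencilScan (E := E) (A := A) (s := s) pr x
          (hin.congr h1 (by simp [W]) (by simp [W]))
        (by rw [hpen]; exact hI) (by rw [h6']; exact hk)
      rw [hpen, h6', ← hB, ← hg] at this
      exact this

/-- With the pencil variables from `a` on fixed, the loops list the cut sets of all pencils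
extending them. -/
theorem appends_pencilLoops {B g : ℕ}
    (h0 : ∀ τ : Memory, InputStored n s (n + (m + 2)) A τ →
      (∀ a : Fin m, pencilOf m τ a < n + (m + 2)) →
      Appends E n s (pencilAll pr) τ B g (IsPencilCut (quadPoint pr A) n s (pencilOf m τ)))
    {a : ℕ} (ha : a ≤ m) {τ : Memory} (hin : InputStored n s (n + (m + 2)) A τ)
    (hI : ∀ i : Fin m, a ≤ i → pencilOf m τ i < n + (m + 2)) :
    Appends E n s (pencilLoops pr a) τ ((n + (m + 2)) ^ a * (B + 50 * a)) ((n + (m + 2)) ^ a * g)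
      (fun X => ∃ I : Fin m → ℕ, (∀ i, I i < n + (m + 2)) ∧ (∀ i : Fin m, a ≤ i →
        I i = pencilOf m τ i) ∧
        IsPencilCut (quadPoint pr A) n s I X) := by
  induction a generalizing τ with
  | zero =>
    refine (h0 τ hin fun i => hI i (Nat.zero_le _)).mono (by simp) (by simp) ?_
    rintro X ⟨I, -, h1, h2⟩
    rwa [← funext fun i => h1 i (Nat.zero_le _)]
  | succ a ih =>
    set N := n + (m + 2) with hN
    let W : ℕ → Prop := fun i => (3 ≤ i ∧ i ≤ 11) ∨ (20 ≤ i ∧ i < 20 + a)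
    have h := Appends.forLoop (E := E) (n := n) (s := s) (σ := τ) (v := 20 + a) (N := N)
      (b := numPoints m) (W := W) (P := pencilLoops pr a)
      (B := N ^ a * (B + 50 * a)) (g := N ^ a * g)
      (Req := fun k X => ∃ I : Fin m → ℕ, (∀ i, I i < N) ∧ (∀ i : Fin m, a + 1 ≤ i →
        I i = pencilOf m τ i) ∧
        I ⟨a, ha⟩ = k ∧ IsPencilCut (quadPoint pr A) n s I X)
      (natIn_pencilLoops pr a) (realIn_pencilLoops pr _ a) (by simp [W]; omega) (by omega)
      (fun υ hυ => by
        simp only [numPoints, NExp.eval, NExp.eval_var]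
        rw [hυ.1 0 (by simp [W]; omega), hin.n_eq]) ?_
    · refine h.mono ?_ (le_of_eq (by ring)) ?_
      · have h1 : (numPoints m).cost = 5 := rfl
        have h2 : 1 ≤ N ^ a := Nat.one_le_pow _ _ (by omega)
        have h3 : 1 ≤ N := by omega
        rw [h1, pow_succ]
        have h4 : N * (N ^ a * (B + 50 * a) + 5 + 20) + 5 + 20 ≤
            N * (N ^ a * (B + 50 * a)) + 50 * N := by
          rw [add_assoc (N ^ a * _), Nat.mul_add]; omega
        have h5 : N * 1 ≤ N * N ^ a := Nat.mul_le_mul_left _ h2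
        calc _ ≤ _ := h4
          _ ≤ N * (N ^ a * (B + 50 * a)) + 50 * (N * N ^ a) := by omega
          _ = _ := by ring
      · rintro X ⟨I, h1, h2, h3⟩
        exact ⟨I ⟨a, ha⟩, h1 _, I, h1, h2, rfl, h3⟩
    · intro k hk υ hυ hυk
      have hpen : ∀ i : Fin m, a + 1 ≤ i → pencilOf m υ i = pencilOf m τ i := fun i hi => by
        simp only [pencilOf]; rw [hυ.1 _ (by simp only [W]; omega)]
      have hpa : pencilOf m υ ⟨a, ha⟩ = k := hυk
      have hcase : ∀ i : Fin m, a ≤ i → i = ⟨a, ha⟩ ∨ a + 1 ≤ i := fun i hi => by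
        rcases hi.eq_or_lt with h | h
        · exact Or.inl (Fin.ext h.symm)
        · exact Or.inr h
      refine (ih (by omega) (hin.congr hυ (by simp [W]; omega) (by simp [W]; omega)) fun i hi =>
        ?_).mono le_rfl
        le_rfl ?_
      · rcases hcase i hi with rfl | hi
        · rw [hpa]; exact hk
        · rw [hpen i hi]; exact hI i hi
      · rintro X ⟨I, h1, h2, h3, h4⟩
        refine ⟨I, h1, fun i hi => ?_, h4⟩
        rcases hcase i hi with rfl | hi
        · rw [hpa, h3]
        · rw [hpen i hi, h2 i hi]

theorem haltsWithin_writeIndices {m : ℕ} {σ : Memory} (hn : σ.nat 0 0 0 = n)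
    (h0 : σ.real 2 0 0 = 0) :
    HaltsWithin E (writeIndices m) σ ((n + (m + 2)) * 50 + 25)
      (fun τ => (∀ i < n + (m + 2), τ.real 2 i 0 = i) ∧ (∀ a, a ≠ 8 → τ.nat a = σ.nat a) ∧
        ∀ a, a ≠ 2 → τ.real a = σ.real a) := by
  have h : HaltsWithin E (writeIndices m) σ ((n + (m + 2)) * (20 + (numPoints m).cost + 20) +
      (numPoints m).cost + 20)
      (fun τ => (∀ a, a ≠ 8 → τ.nat a = σ.nat a) ∧
    τ.nat 8 0 0 = n + (m + 2) ∧ ∀ i ≤ n + (m + 2), τ.real 2 i 0 = i) := by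
    refine HaltsWithin.forLoop (fun t τ => (∀ a, a ≠ 8 → τ.nat a = σ.nat a) ∧
      τ.nat 8 0 0 = t ∧ ∀ i ≤ t, τ.real 2 i 0 = i) ?_ ?_ ?_
    · refine ⟨fun a ha => Memory.setNat_nat_of_ne _ ha _ _ _,
        by simp [Memory.setNat], fun i hi => ?_⟩
      obtain rfl : i = 0 := by omega
      simpa [Memory.setNat] using h0
    · rintro k τ ⟨h1, h2, -⟩
      exact ⟨h2, by simp [numPoints, NExp.eval, h1 0, hn]⟩
    · rintro k hk τ ⟨h1, h2, h3⟩
      refine HaltsWithin.mono (HaltsWithin.setReal (Q := fun τ' =>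
        τ' = τ.setReal 2 (k + 1) 0 (k + 1)) ?_)
        (by simp [NExp.cost, RExp.cost, NExp.var]) ?_
      · simp [NExp.eval, RExp.eval, h2, h3 k le_rfl]
      · rintro _ rfl
        refine ⟨h2, fun a ha => ?_, by simp [Memory.setNat], fun i hi => ?_⟩
        · rw [Memory.setNat_nat_of_ne _ ha]; exact h1 a ha
        · rcases hi.eq_or_lt with rfl | hi
          · simp [Memory.setNat, Memory.setReal]
          · have : i ≠ k + 1 := hi.ne
            simp [Memory.setNat, Memory.setReal, this, h3 i (by omega)]
  have hW : (writeIndices m).NatIn (fun a => a = 8) := by simp [writeIndices, Program.NatIn]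
  have hV : (writeIndices m).RealIn (fun a => a = 2) := by simp [writeIndices, Program.RealIn]
  refine (h.frame hW hV).mono ?_ ?_
  · have : (numPoints m).cost = 5 := rfl
    rw [this]; omega
  · rintro τ ⟨⟨-, -, h1⟩, h2, h3⟩
    exact ⟨fun i hi => h1 i hi.le, h2, h3⟩

theorem eigFree_listCut (σ : Bool) (J : Finset (Fin (m + 1))) : (listCut pr σ J).EigFree := by
  simp [listCut, Program.EigFree]

theorem eigFree_enumerate : (enumerate pr).EigFree := by
  have hround : ∀ c σ, (pencilRound pr c σ).EigFree := fun c σ => by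
    refine ⟨by simp [selectPoint, Program.EigFree], ⟨trivial, ?_⟩, trivial⟩
    refine Program.eigFree_seqList fun P hP => ?_
    obtain ⟨J, -, rfl⟩ := List.mem_map.1 hP
    exact eigFree_listCut pr σ J
  have hall : (pencilAll pr).EigFree := by
    rw [pencilAll, Program.eigFree_forLoop]
    refine Program.eigFree_seqList fun P hP => ?_
    obtain ⟨z, -, rfl⟩ := List.mem_map.1 hP
    refine ⟨by simp [Program.EigFree], ?_⟩
    rw [Program.eigFree_forLoop]
    exact hround z.1 z.2
  have hloops : ∀ a, (pencilLoops pr a).EigFree := fun a => by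
    induction a with
    | zero => exact hall
    | succ a ih => rwa [pencilLoops, Program.eigFree_forLoop]
  exact ⟨by simp [writeIndices, Program.EigFree], hloops m⟩

/-- The enumeration lists `O(n ^ (m + 1))` sets in time `O(n ^ (m + 1) * s)`: there are `O(n ^ m)`
pencils with `O(s)` shallow hyperplanes each, and each hyperplane takes time `O(n)`. -/
theorem exists_haltsWithin_enumerate :
    ∃ K : ℕ, ∀ (E : EigSolver) (n s : ℕ) (σ : Memory), 1 ≤ s → s ≤ n → σ.nat 0 0 0 = n →
      σ.nat 1 0 0 = s → σ.nat 3 0 0 = 0 → σ.real 2 0 0 = 0 →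
      HaltsWithin E (enumerate pr) σ (K * (n ^ (m + 1) * s)) fun τ =>
        (∃ F, StoresFamily τ F ∧ F.length ≤ K * n ^ (m + 1) ∧
          (∀ S ∈ F, S.card = s ∧ S ⊆ Finset.range n) ∧
          ∀ I X, IsPencilCut (quadPoint pr (σ.real 0)) n s I X → X ∈ F) ∧
        (∀ a, a < 3 → τ.nat a = σ.nat a) ∧ ∀ a, a ≠ 2 → τ.real a = σ.real a := by
  set C := testCost pr
  set K1 := (m + 5) * ((2 ^ (m + 1) + 1) * ((m + 3) * (C + 60) + 200) + 100) with hK1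
  set K2 := (m + 2) * (4 * K1 + 26) + 21 with hK2
  set K3 := (m + 3) ^ m * (K2 + 50 * m) with hK3
  set K4 := (m + 3) ^ m * ((m + 2) * (4 * ((m + 4) * 2 ^ (m + 1)))) with hK4
  set K5 := (m + 3) * 50 + 26 with hK5
  refine ⟨K3 + K4 + K5, fun E n s σ hs hsn h0 h1 h3 hr => ?_⟩
  set N := n + (m + 2) with hN
  set B := (s + m + 4) * ((2 ^ (m + 1) + 1) * (N * (C + 60) + 200) + 100) with hB
  set g := (s + (m + 3)) * 2 ^ (m + 1) with hg
  have hn : 1 ≤ n := hs.trans hsn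
  have hns : 1 ≤ n * s := Nat.mul_pos hn hs
  have hNle : N ≤ (m + 3) * n := by rw [hN]; nlinarith
  have hsle : s + m + 4 ≤ (m + 5) * s := by nlinarith
  have hBle : B ≤ K1 * (n * s) := by
    calc B ≤ ((m + 5) * s) *
          ((2 ^ (m + 1) + 1) * (((m + 3) * n) * (C + 60) + 200 * n) + 100 * n) := by
          rw [hB]; gcongr <;> omega
      _ = K1 * (n * s) := by rw [hK1]; ring
  have hB2 : (m + 2) * (4 * (B + 1) + 22) + 21 ≤ K2 * (n * s) := by
    calc (m + 2) * (4 * (B + 1) + 22) + 21 = (m + 2) * (4 * B + 26 * 1) + 21 * 1 := by ring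
      _ ≤ (m + 2) * (4 * (K1 * (n * s)) + 26 * (n * s)) + 21 * (n * s) := by gcongr
      _ = K2 * (n * s) := by rw [hK2]; ring
  have hB3 : N ^ m * ((m + 2) * (4 * (B + 1) + 22) + 21 + 50 * m) ≤ K3 * (n ^ (m + 1) * s) := by
    calc N ^ m * ((m + 2) * (4 * (B + 1) + 22) + 21 + 50 * m)
        ≤ ((m + 3) * n) ^ m * (K2 * (n * s) + 50 * m * (n * s)) := by
          exact Nat.mul_le_mul (Nat.pow_le_pow_left hNle m)
            (Nat.add_le_add hB2 (Nat.le_mul_of_pos_right _ hns))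
      _ = K3 * (n ^ (m + 1) * s) := by rw [hK3, mul_pow]; ring
  have hg3 : N ^ m * ((m + 2) * (4 * g)) ≤ K4 * n ^ (m + 1) := by
    calc N ^ m * ((m + 2) * (4 * g)) ≤ ((m + 3) * n) ^ m *
      ((m + 2) * (4 * (((m + 4) * n) * 2 ^ (m + 1)))) := by
          rw [hg]
          gcongr
          nlinarith
      _ = K4 * n ^ (m + 1) := by rw [hK4, mul_pow]; ring
  have hB5 : 1 + (N * 50 + 25) ≤ K5 * (n ^ (m + 1) * s) := by
    have h5 : n ≤ n ^ (m + 1) * s := by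
      calc n = n ^ 1 * 1 := by ring
        _ ≤ n ^ (m + 1) * s := by gcongr; omega
    calc 1 + (N * 50 + 25) ≤ ((m + 3) * n) * 50 + 26 * n := by omega
      _ = K5 * n := by rw [hK5]; ring
      _ ≤ _ := by gcongr
  have hrun : HaltsWithin E (enumerate pr) σ (1 + (N * 50 + 25) +
      N ^ m * ((m + 2) * (4 * (B + 1) + 22) + 21 + 50 * m)) fun τ =>
      ∃ F, StoresFamily τ F ∧ F.length ≤ N ^ m * ((m + 2) * (4 * g)) ∧
          (∀ S ∈ F, S.card = s ∧ S ⊆ Finset.range n) ∧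
          ∀ I X, IsPencilCut (quadPoint pr (σ.real 0)) n s I X → X ∈ F := by
    refine (haltsWithin_writeIndices h0 hr).seq ?_
    rintro τ ⟨h4, h5, h6⟩
    have hin : InputStored n s N (σ.real 0) τ :=
      ⟨by rw [h5 0 (by omega), h0], by rw [h5 1 (by omega), h1], h6 0 (by omega), h4⟩
    have hF : StoresFamily τ [] := ⟨by simp [Memory.numCandidates, h5 3, h3], by simp⟩
    refine (appends_pencilLoops (E := E) pr (fun υ hυ hI =>
      appends_pencilAll pr hυ hI hB hg) le_rfl hin
      (fun i hi => absurd i.2 (by omega)) [] hF).mono le_rfl ?_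
    rintro υ ⟨G, g1, g2, g3, g4⟩
    refine ⟨G, by simpa using g1, g2, g3, fun I X hX =>
      g4 X ⟨I, ?_, fun i hi => absurd i.2 (by omega), hX⟩⟩
    obtain ⟨_, _, _, _, _, _, _, h, _⟩ := hX
    exact h.lt_I
  have hW : (enumerate pr).NatIn (fun a => 3 ≤ a) := by
    refine ⟨by simp [writeIndices, Program.NatIn], (natIn_pencilLoops pr m).mono fun a => by omega⟩
  have hV : (enumerate pr).RealIn (fun a => a = 2) :=
    ⟨by simp [writeIndices, Program.RealIn], realIn_pencilLoops pr _ m⟩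
  refine (hrun.frame hW hV).mono ?_ ?_
  · have hsum : (K3 + K4 + K5) * (n ^ (m + 1) * s) = K3 * (n ^ (m + 1) * s) +
        K4 * (n ^ (m + 1) * s) + K5 * (n ^ (m + 1) * s) := by ring
    omega
  · rintro τ ⟨⟨F, f1, f2, f3, f4⟩, f5, f6⟩
    refine ⟨⟨F, f1, f2.trans (hg3.trans ?_), f3, f4⟩, fun a ha => f5 a (by omega), f6⟩
    gcongr; omega

end Enumeration

end PencilEnumeration

/-! ### Evaluating the candidates -/

/-- The memories agree up to the arrays of natural numbers in `W` and the real arrays in `V`. -/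
def AgreesOff₂ (W V : ℕ → Prop) (σ τ : Memory) : Prop :=
  (∀ a, ¬ W a → τ.nat a = σ.nat a) ∧ ∀ a, ¬ V a → τ.real a = σ.real a

theorem AgreesOff₂.trans {W V W' V' : ℕ → Prop} {σ τ υ : Memory} (h : AgreesOff₂ W V σ τ)
    (h' : AgreesOff₂ W' V' τ υ) (hW : ∀ a, W' a → W a) (hV : ∀ a, V' a → V a) :
    AgreesOff₂ W V σ υ :=
  ⟨fun a ha => (h'.1 a fun h => ha (hW a h)).trans (h.1 a ha),
    fun a ha => (h'.2 a fun h => ha (hV a h)).trans (h.2 a ha)⟩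

theorem AgreesOff₂.setNat {W V : ℕ → Prop} {σ τ : Memory} (h : AgreesOff₂ W V σ τ) {a : ℕ}
    (ha : W a) (i j v : ℕ) : AgreesOff₂ W V σ (τ.setNat a i j v) :=
  ⟨fun b hb => by
    rw [Memory.setNat_nat_of_ne _ (by rintro rfl; exact hb ha)]; exact h.1 b hb, h.2⟩

theorem Memory.setReal_real_of_ne (σ : Memory) {a b : ℕ} (h : b ≠ a) (i j : ℕ) (v : ℝ) :
    (σ.setReal a i j v).real b = σ.real b := by
  funext x y; simp [Memory.setReal, h]

theorem AgreesOff₂.setReal {W V : ℕ → Prop} {σ τ : Memory} (h : AgreesOff₂ W V σ τ) {a : ℕ}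
    (ha : V a) (i j : ℕ) (v : ℝ) : AgreesOff₂ W V σ (τ.setReal a i j v) :=
  ⟨h.1, fun b hb => by
    rw [Memory.setReal_real_of_ne _ (by rintro rfl; exact hb ha)]; exact h.2 b hb⟩

theorem AgreesOff₂.refl (W V : ℕ → Prop) (σ : Memory) : AgreesOff₂ W V σ σ :=
  ⟨fun _ _ => rfl, fun _ _ => rfl⟩

/-- The sum of a list of real expressions. -/
def RExp.sumList (L : List RExp) : RExp := L.foldr .add (.const 0)

theorem RExp.eval_sumList (σ : Memory) (L : List RExp) :
    (RExp.sumList L).eval σ = (L.map (RExp.eval σ)).sum := by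
  induction L with
  | nil => simp [sumList, eval]
  | cons a L ih =>
    simp only [sumList] at ih
    simp [sumList, eval, ih]

section Solve

variable (r : ℕ)

/-- Entry of the covariance matrix of the candidate in row `v`, at the positions in variables `12`
and `13`. -/
def gramEntry (v : ℕ) : RExp :=
  .sumList ((List.finRange r).map fun p : Fin r =>
    .mul (.get 0 (.const (p : ℕ)) (.get 5 (.var v) (.var 12)))
      (.get 0 (.const (p : ℕ)) (.get 5 (.var v) (.var 13))))

/-- Computes eigenpairs of the covariance matrix of the candidate with index in variable `v`. -/
def gramEig (v : ℕ) : Program :=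
  .seq (.forLoop 12 (.var 1) (.forLoop 13 (.var 1) (.setReal 3 (.var 12) (.var 13)
    (gramEntry r v))))
    (.eig (.var 1) (.var 2) 3 4 5)

/-- The sum of the computed eigenvalues. -/
def sumEigs : Program :=
  .seq (.setReal 6 (.const 0) (.const 0) (.const 0))
    (.forLoop 13 (.var 2) (.setReal 6 (.const 0) (.const 0)
      (.add (.get 6 (.const 0) (.const 0)) (.get 4 (.var 13) (.const 0)))))

/-- Finds a candidate with largest sum of eigenvalues.  The best sum so far is initially zero, as is
every unused cell; the sums are nonnegative, so the first candidate is always accepted. -/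
def searchBest : Program :=
  .forLoop 14 (.var 3) (.seq (gramEig r 14) (.seq sumEigs
    (.ite (.realLE (.get 7 (.const 0) (.const 0)) (.get 6 (.const 0) (.const 0)))
      (.seq (.setReal 7 (.const 0) (.const 0) (.get 6 (.const 0) (.const 0)))
        (.setNat 15 (.const 0) (.const 0) (.var 14))) .skip)))

/-- Copies the eigenvectors to the rows given by the best candidate. -/
def writeSolution : Program :=
  .forLoop 12 (.var 1) (.forLoop 13 (.var 2)
    (.setReal 1 (.get 5 (.var 15) (.var 12)) (.var 13) (.get 5 (.var 12) (.var 13))))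

/-- Solves the problem, once the candidates are listed. -/
def solveListed : Program := .seq (searchBest r) (.seq (gramEig r 15) writeSolution)

/-- The covariance matrix of the columns with indices `f 0`, …, `f (s - 1)`. -/
def listGram (a : ℕ → ℕ → ℝ) (s : ℕ) (f : ℕ → ℕ) : Matrix (Fin s) (Fin s) ℝ :=
  Matrix.of fun i j => ∑ p : Fin r, a p (f i) * a p (f j)

variable {E : EigSolver} {s d : ℕ}

/-- The columns `0`, …, `d - 1` of real array `5` become the eigenvectors returned by the solver,
which is charged `d * s ^ 2`; the covariance matrix costs `O(s ^ 2)`. -/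
theorem haltsWithin_gramEig {v : ℕ} (hv : v = 14 ∨ v = 15) {τ : Memory} (h1 : τ.nat 1 0 0 = s)
    (h2 : τ.nat 2 0 0 = d) :
    HaltsWithin E (gramEig r v) τ ((s * (s * ((gramEntry r v).cost + 50) + 50) + 50) + d * s ^ 2)
      (fun υ => AgreesOff₂ (fun a => a = 12 ∨ a = 13) (fun a => a = 3 ∨ a = 4 ∨ a = 5) τ υ ∧
        (∀ j : Fin d, υ.real 4 j 0 =
          (E s d (listGram r (τ.real 0) s (τ.nat 5 (τ.nat v 0 0)))).1 j) ∧
        ∀ (i : Fin s) (j : Fin d),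
          υ.real 5 i j = (E s d (listGram r (τ.real 0) s (τ.nat 5 (τ.nat v 0 0)))).2 i j) := by
  set f := τ.nat 5 (τ.nat v 0 0) with hf
  set a := τ.real 0 with ha
  let W : ℕ → Prop := fun a => a = 12 ∨ a = 13
  let V : ℕ → Prop := fun a => a = 3
  let entry : ℕ → ℕ → ℝ := fun i j => ∑ p : Fin r, a p (f i) * a p (f j)
  have hentry : ∀ υ, AgreesOff₂ W V τ υ → (gramEntry r v).eval υ = entry (υ.nat 12 0 0)
      (υ.nat 13 0 0) := by
    intro υ h
    have e5 : υ.nat 5 = τ.nat 5 := h.1 5 (by simp [W])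
    have ev : υ.nat v = τ.nat v := h.1 v (by simp only [W]; omega)
    have e0 : υ.real 0 = a := h.2 0 (by simp [V])
    rw [gramEntry, RExp.eval_sumList, List.map_map, ← List.ofFn_eq_map, List.sum_ofFn]
    simp [entry, RExp.eval, NExp.eval, e5, ev, e0, hf]
  have inner : ∀ υ, AgreesOff₂ W V τ υ → (∀ i < υ.nat 12 0 0, ∀ j < s, υ.real 3 i j = entry i j) →
      HaltsWithin E (.forLoop 13 (.var 1) (.setReal 3 (.var 12) (.var 13) (gramEntry r v))) υ
        (s * ((gramEntry r v).cost + 20 + (NExp.var 1).cost + 20) + (NExp.var 1).cost + 20)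
        (fun υ' => AgreesOff₂ W V τ υ' ∧ υ'.nat 12 0 0 = υ.nat 12 0 0 ∧
          ∀ i < υ.nat 12 0 0 + 1, ∀ j < s, υ'.real 3 i j = entry i j) := by
    intro υ hυ hold
    refine (HaltsWithin.forLoop (N := s) (fun k υ' => AgreesOff₂ W V τ υ' ∧ υ'.nat 13 0 0 = k ∧
      υ'.nat 12 0 0 = υ.nat 12 0 0 ∧ (∀ i < υ.nat 12 0 0, ∀ j < s, υ'.real 3 i j = entry i j) ∧
        ∀ j < k, υ'.real 3 (υ.nat 12 0 0) j = entry (υ.nat 12 0 0) j) ?_ ?_ ?_).mono le_rfl ?_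
    · refine ⟨hυ.setNat (by simp [W]) _ _ _,
        by simp [Memory.setNat], by simp [Memory.setNat], ?_, by simp⟩
      simpa [Memory.setNat] using hold
    · rintro k υ' ⟨g1, g2, -⟩
      exact ⟨g2, by rw [NExp.eval_var, g1.1 1 (by simp [W]), h1]⟩
    · rintro k hk υ' ⟨g1, g2, g3, g4, g5⟩
      refine HaltsWithin.mono (HaltsWithin.setReal (Q := fun υ'' =>
        υ'' = υ'.setReal 3 (υ.nat 12 0 0) k (entry (υ.nat 12 0 0) k)) ?_)
        (by simp [NExp.cost, NExp.var]; omega) ?_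
      · rw [hentry υ' g1]; simp [g2, g3]
      · rintro _ rfl
        refine ⟨g2, (g1.setReal (by simp [V]) _ _ _).setNat (by simp [W]) _ _ _,
          by simp [Memory.setNat],
          by simp [Memory.setNat, Memory.setReal, g3], fun i hi j hj => ?_, fun j hj => ?_⟩
        · have : i ≠ υ.nat 12 0 0 := hi.ne
          simp [Memory.setNat, Memory.setReal, this, g4 i hi j hj]
        · rcases Nat.lt_succ_iff_lt_or_eq.1 hj with hj | rfl
          · have : j ≠ k := hj.ne
            simp [Memory.setNat, Memory.setReal, this, g5 j hj]
          · simp [Memory.setNat, Memory.setReal]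
    · rintro υ' ⟨g1, -, g3, g4, g5⟩
      refine ⟨g1, g3, fun i hi j hj => ?_⟩
      rcases Nat.lt_succ_iff_lt_or_eq.1 hi with hi | rfl
      · exact g4 i hi j hj
      · exact g5 j hj
  have outer : HaltsWithin E (.forLoop 12 (.var 1) (.forLoop 13 (.var 1)
      (.setReal 3 (.var 12) (.var 13) (gramEntry r v)))) τ
      (s * ((s * ((gramEntry r v).cost + 20 + (NExp.var 1).cost + 20) + (NExp.var 1).cost + 20) +
        (NExp.var 1).cost + 20) + (NExp.var 1).cost + 20)
      (fun υ => AgreesOff₂ W V τ υ ∧ υ.nat 12 0 0 = s ∧ ∀ i < s, ∀ j < s, υ.real 3 i j =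
        entry i j) := by
    refine HaltsWithin.forLoop (fun k υ => AgreesOff₂ W V τ υ ∧ υ.nat 12 0 0 = k ∧
      ∀ i < k, ∀ j < s, υ.real 3 i j = entry i j) ?_ ?_ ?_
    · exact ⟨(AgreesOff₂.refl W V τ).setNat (by simp [W]) _ _ _, by simp [Memory.setNat], by simp⟩
    · rintro k υ ⟨g1, g2, -⟩
      exact ⟨g2, by rw [NExp.eval_var, g1.1 1 (by simp [W]), h1]⟩
    · rintro k hk υ ⟨g1, g2, g3⟩
      refine (inner υ g1 (by rw [g2]; exact g3)).mono le_rfl ?_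
      rintro υ' ⟨f1, f2, f3⟩
      rw [g2] at f2 f3
      exact ⟨f2, f1.setNat (by simp [W]) _ _ _, by simp [Memory.setNat], f3⟩
  refine (outer.seq (T' := 1 + (NExp.var 1).cost + (NExp.var 2).cost + d * s ^ 2) fun υ hυ =>
    ?_).mono ?_ fun _ h => h
  · obtain ⟨g1, -, g3⟩ := hυ
    have e1 : (NExp.var 1).eval υ = s := by rw [NExp.eval_var, g1.1 1 (by simp [W]), h1]
    have e2 : (NExp.var 2).eval υ = d := by rw [NExp.eval_var, g1.1 2 (by simp [W]), h2]
    have hM : υ.matrix 3 s s = listGram r a s f := by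
      ext i j
      exact g3 i i.2 j j.2
    refine ⟨_, _, Exec.eig υ (.var 1) (.var 2) 3 4 5, by rw [e1, e2], ?_⟩
    rw [e1, e2, hM]
    refine ⟨⟨fun b hb => g1.1 b hb, fun b hb => ?_⟩, fun j => ?_, fun i j => ?_⟩
    · rw [← g1.2 b (by simp only [V]; omega)]
      funext x y
      have h4 : b ≠ 4 := by omega
      have h5 : b ≠ 5 := by omega
      simp [Memory.setMatrix, h4, h5]
    · simp [Memory.setMatrix]
    · simp [Memory.setMatrix]
  · simp only [NExp.cost, NExp.var]
    have : s * (s * ((gramEntry r v).cost + 20 + (1 + 1 + 1) + 20) + (1 + 1 + 1) + 20 +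
        (1 + 1 + 1) + 20) ≤
        s * (s * ((gramEntry r v).cost + 50) + 50) := by
      refine Nat.mul_le_mul_left _ ?_
      have : s * ((gramEntry r v).cost + 20 + (1 + 1 + 1) + 20) ≤ s * ((gramEntry r v).cost + 50) :=
        Nat.mul_le_mul_left _ (by omega)
      omega
    omega

theorem haltsWithin_sumEigs {τ : Memory} (h2 : τ.nat 2 0 0 = d) :
    HaltsWithin E sumEigs τ (d * 60 + 60)
      (fun υ => AgreesOff₂ (fun a => a = 13) (fun a => a = 6) τ υ ∧
        υ.real 6 0 0 = ∑ j : Fin d, τ.real 4 j 0) := by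
  let W : ℕ → Prop := fun a => a = 13
  let V : ℕ → Prop := fun a => a = 6
  refine ((HaltsWithin.setReal (Q := fun υ => AgreesOff₂ W V τ υ ∧ υ.real 6 0 0 = 0) ?_).seq
    (T' := d * (20 + (NExp.var 2).cost + 20) + (NExp.var 2).cost + 20) fun υ hυ =>
      ?_).mono ?_ fun _ h => h
  · exact ⟨(AgreesOff₂.refl W V τ).setReal (by simp [V]) _ _ _,
      by simp [Memory.setReal, RExp.eval, NExp.eval]⟩
  · obtain ⟨g1, g2⟩ := hυ
    refine (HaltsWithin.forLoop (N := d) (fun k υ' => AgreesOff₂ W V τ υ' ∧ υ'.nat 13 0 0 = k ∧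
      υ'.real 6 0 0 = ∑ j ∈ Finset.range k, τ.real 4 j 0) ?_ ?_ ?_).mono le_rfl ?_
    · exact ⟨g1.setNat (by simp [W]) _ _ _,
        by simp [Memory.setNat], by simpa [Memory.setNat] using g2⟩
    · rintro k υ' ⟨f1, f2, -⟩
      exact ⟨f2, by rw [NExp.eval_var, f1.1 2 (by simp [W]), h2]⟩
    · rintro k hk υ' ⟨f1, f2, f3⟩
      refine HaltsWithin.mono (HaltsWithin.setReal (Q := fun υ'' =>
        υ'' = υ'.setReal 6 0 0 (∑ j ∈ Finset.range (k + 1), τ.real 4 j 0)) ?_)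
        (by simp [NExp.cost, RExp.cost, NExp.var]) ?_
      · simp [NExp.eval, RExp.eval, f2, f3, f1.2 4 (by simp [V]), Finset.sum_range_succ]
      · rintro _ rfl
        exact ⟨f2, (f1.setReal (by simp [V]) _ _ _).setNat (by simp [W]) _ _ _,
          by simp [Memory.setNat],
          by simp [Memory.setNat, Memory.setReal]⟩
    · rintro υ' ⟨f1, -, f3⟩
      exact ⟨f1, by rw [f3, Finset.sum_range]⟩
  · simp [NExp.cost, RExp.cost, NExp.var]; omega

/-- The value of a candidate, as computed by the program: the sum of the eigenvalues returned by the
solver. -/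
noncomputable def listValue (r : ℕ) (E : EigSolver) (a : ℕ → ℕ → ℝ) (s d : ℕ) (f : ℕ → ℕ) : ℝ :=
  ∑ j : Fin d, (E s d (listGram r a s f)).1 j

theorem haltsWithin_searchBest {τ : Memory} (h1 : τ.nat 1 0 0 = s) (h2 : τ.nat 2 0 0 = d)
    (h7 : τ.real 7 0 0 = 0)
    (hval : ∀ l < τ.nat 3 0 0, 0 ≤ listValue r E (τ.real 0) s d (τ.nat 5 l)) :
    HaltsWithin E (searchBest r) τ
      (τ.nat 3 0 0 *
        (((s * (s * ((gramEntry r 14).cost + 50) + 50) + 50) + d * s ^ 2) + d * 60 + 160) + 30)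
      (fun υ => AgreesOff₂ (fun a => 12 ≤ a ∧ a ≤ 15) (fun a => 3 ≤ a ∧ a ≤ 7) τ υ ∧
        (0 < τ.nat 3 0 0 → υ.nat 15 0 0 < τ.nat 3 0 0 ∧ ∀ l < τ.nat 3 0 0,
          listValue r E (τ.real 0) s d (τ.nat 5 l) ≤
            listValue r E (τ.real 0) s d (τ.nat 5 (υ.nat 15 0 0)))) := by
  set val : ℕ → ℝ := fun l => listValue r E (τ.real 0) s d (τ.nat 5 l) with hvaldef
  set L := τ.nat 3 0 0 with hL
  let W : ℕ → Prop := fun a => 12 ≤ a ∧ a ≤ 15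
  let V : ℕ → Prop := fun a => 3 ≤ a ∧ a ≤ 7
  refine (HaltsWithin.forLoop (N := L)
      (B := ((s * (s * ((gramEntry r 14).cost + 50) + 50) + 50) + d * s ^ 2) + d * 60 + 110)
      (fun k υ => AgreesOff₂ W V τ υ ∧ υ.nat 14 0 0 = k ∧
      (k = 0 → υ.real 7 0 0 = 0) ∧
      (0 < k → υ.nat 15 0 0 < k ∧ υ.real 7 0 0 = val (υ.nat 15 0 0)) ∧
      ∀ l < k, val l ≤ υ.real 7 0 0) ?_ ?_ ?_).mono ?_ ?_
  · refine ⟨(AgreesOff₂.refl W V τ).setNat (by simp [W]) _ _ _,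
      by simp [Memory.setNat], fun _ => ?_, by simp, by simp⟩
    simpa [Memory.setNat] using h7
  · rintro k υ ⟨g1, g2, -⟩
    exact ⟨g2, by rw [NExp.eval_var, g1.1 3 (by simp [W])]⟩
  · rintro k hk υ ⟨g1, g2, g3, g4, g5⟩
    have e1 : υ.nat 1 0 0 = s := by rw [g1.1 1 (by simp [W]), h1]
    have e2 : υ.nat 2 0 0 = d := by rw [g1.1 2 (by simp [W]), h2]
    have e5 : υ.nat 5 = τ.nat 5 := g1.1 5 (by simp [W])
    have e0 : υ.real 0 = τ.real 0 := g1.2 0 (by simp [V])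
    have hge := haltsWithin_gramEig r (E := E) (Or.inl rfl : (14 : ℕ) = 14 ∨ (14 : ℕ) = 15) e1 e2
    rw [g2, e5, e0] at hge
    refine (hge.seq (T' := 1 + (d * 60 + 60) + 30) fun υ1 hυ1 => ?_).mono (by omega) fun _ h => h
    obtain ⟨f1, f2, -⟩ := hυ1
    have e2' : υ1.nat 2 0 0 = d := by rw [f1.1 2 (by simp), e2]
    refine ((haltsWithin_sumEigs (E := E) e2').seq (T' := 30) fun υ2 hυ2 => ?_)
    obtain ⟨q1, q2⟩ := hυ2
    have hacc : υ2.real 6 0 0 = val k := by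
      rw [q2]
      exact Finset.sum_congr rfl fun j _ => f2 j
    have hA : AgreesOff₂ W V τ υ2 := (g1.trans f1 (fun a => by simp only [W]; omega)
      (fun a => by simp only [V]; omega)).trans q1 (fun a => by simp only [W]; omega)
      (fun a => by simp only [V]; omega)
    have h14 : υ2.nat 14 0 0 = k := by rw [q1.1 14 (by simp), f1.1 14 (by simp), g2]
    have h15 : υ2.nat 15 = υ.nat 15 := by rw [q1.1 15 (by simp), f1.1 15 (by simp)]
    have h7' : υ2.real 7 = υ.real 7 := by rw [q1.2 7 (by simp), f1.2 7 (by simp)]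
    have htest : (Test.realLE (.get 7 (.const 0) (.const 0))
        (.get 6 (.const 0) (.const 0))).holds υ2 ↔
        υ.real 7 0 0 ≤ val k := by
      simp [Test.holds, RExp.eval, NExp.eval, h7', hacc]
    refine HaltsWithin.mono (T := 1 + (Test.realLE (.get 7 (.const 0) (.const 0))
      (.get 6 (.const 0) (.const 0))).cost + 20) (HaltsWithin.ite (fun hb => ?_) (fun hb => ?_))
      (by simp [Test.cost, RExp.cost, NExp.cost]) fun _ h => h
    · refine ((HaltsWithin.setReal (Q := fun υ3 => υ3 = υ2.setReal 7 0 0 (val k)) ?_).seq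
        (T' := 1 + (NExp.const 0).cost + (NExp.const 0).cost + (NExp.var 14).cost)
        fun υ3 hυ3 => HaltsWithin.setNat ?_).mono ?_ fun _ h => h
      · simp [NExp.eval, RExp.eval, hacc]
      · subst hυ3
        have h14' : (υ2.setReal 7 0 0 (val k)).nat 14 0 0 = k := h14
        simp only [NExp.eval_var, h14', NExp.eval]
        refine ⟨by simp [Memory.setNat, h14'],
          ((hA.setReal (by simp [V]) _ _ _).setNat (by simp [W]) _ _ _).setNat
          (by simp [W]) _ _ _, by simp [Memory.setNat], by simp, fun _ => ?_, fun l hl => ?_⟩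
        · simp [Memory.setNat, Memory.setReal]
        · have : (((υ2.setReal 7 0 0 (val k)).setNat 15 0 0 k).setNat 14 0 0 (k + 1)).real 7 0 0 =
              val k := by
            simp [Memory.setNat, Memory.setReal]
          rw [this]
          rcases Nat.lt_succ_iff_lt_or_eq.1 hl with hl | rfl
          · exact (g5 l hl).trans (htest.1 hb)
          · exact le_rfl
      · simp [NExp.cost, RExp.cost, NExp.var]
    · have hlt : val k < υ.real 7 0 0 := by rw [htest] at hb; exact not_le.1 hb
      have hk0 : 0 < k := by
        rcases Nat.eq_zero_or_pos k with h0 | h0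
        · have := g3 h0
          have := hval k hk
          simp only [hvaldef] at hlt
          linarith
        · exact h0
      refine (HaltsWithin.skip (Q := fun υ3 => υ3 = υ2) rfl).mono (by omega) ?_
      rintro υ3 rfl
      refine ⟨h14, hA.setNat (by simp [W]) _ _ _,
        by simp [Memory.setNat], by simp, fun _ => ?_, fun l hl => ?_⟩
      · have := g4 hk0
        rw [Memory.setNat_nat_of_ne _ (by omega), h15]
        refine ⟨by omega, ?_⟩
        rw [← this.2, ← h7']; rfl
      · change val l ≤ υ3.real 7 0 0
        rw [h7']
        rcases Nat.lt_succ_iff_lt_or_eq.1 hl with hl | rfl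
        · exact g5 l hl
        · exact hlt.le
  · have : (NExp.var 3).cost = 3 := rfl
    rw [this, add_assoc _ 3 20, add_assoc _ 3 20]
    have h : ∀ x : ℕ, L * (x + 110 + (3 + 20)) + (3 + 20) ≤ L * (x + 160) + 30 := fun x => by
      have : L * (x + 110 + (3 + 20)) ≤ L * (x + 160) := Nat.mul_le_mul_left _ (by omega)
      omega
    exact h _
  · rintro υ ⟨g1, -, -, g4, g5⟩
    refine ⟨g1, fun hpos => ⟨(g4 hpos).1, fun l hl => ?_⟩⟩
    have := g5 l hl
    rwa [(g4 hpos).2] at this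

theorem haltsWithin_writeSolution {τ : Memory} {f : ℕ → ℕ} (h1 : τ.nat 1 0 0 = s)
    (h2 : τ.nat 2 0 0 = d) (hf : τ.nat 5 (τ.nat 15 0 0) = f)
    (hinj : ∀ t < s, ∀ t' < s, f t = f t' → t = t') (hz : ∀ x y, τ.real 1 x y = 0) :
    HaltsWithin E writeSolution τ (s * (d * 60 + 60) + 30) (fun υ =>
      (∀ t < s, ∀ q < d, υ.real 1 (f t) q = τ.real 5 t q) ∧
        ∀ x, (∀ t < s, f t ≠ x) → ∀ q, υ.real 1 x q = 0) := by
  let W : ℕ → Prop := fun a => a = 12 ∨ a = 13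
  let V : ℕ → Prop := fun a => a = 1
  refine (HaltsWithin.forLoop (N := s) (B := d * 50 + 30) (fun k υ => AgreesOff₂ W V τ υ ∧
    υ.nat 12 0 0 = k ∧
    (∀ t < k, ∀ q < d, υ.real 1 (f t) q = τ.real 5 t q) ∧
        ∀ x, (∀ t < k, f t ≠ x) → ∀ q, υ.real 1 x q = 0) ?_ ?_ ?_).mono ?_ ?_
  · exact ⟨(AgreesOff₂.refl W V τ).setNat (by simp [W]) _ _ _, by simp [Memory.setNat], by simp,
      fun x _ q => hz x q⟩
  · rintro k υ ⟨g1, g2, -⟩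
    exact ⟨g2, by rw [NExp.eval_var, g1.1 1 (by simp [W]), h1]⟩
  · rintro k hk υ ⟨g1, g2, g3, g4⟩
    refine (HaltsWithin.forLoop (N := d) (B := 20) (fun j υ' => AgreesOff₂ W V τ υ' ∧
      υ'.nat 13 0 0 = j ∧
      υ'.nat 12 0 0 = k ∧ (∀ t < k, ∀ q < d, υ'.real 1 (f t) q = τ.real 5 t q) ∧
      (∀ q < j, υ'.real 1 (f k) q = τ.real 5 k q) ∧
        ∀ x, (∀ t < k + 1, f t ≠ x) → ∀ q, υ'.real 1 x q = 0) ?_ ?_ ?_).mono ?_ ?_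
    · exact ⟨g1.setNat (by simp [W]) _ _ _,
        by simp [Memory.setNat], by simpa [Memory.setNat] using g2, g3,
        by simp, fun x hx q => g4 x (fun t ht => hx t (by omega)) q⟩
    · rintro j υ' ⟨f1, f2, -⟩
      exact ⟨f2, by rw [NExp.eval_var, f1.1 2 (by simp [W]), h2]⟩
    · rintro j hj υ' ⟨f1, f2, f3, f4, f5, f6⟩
      refine HaltsWithin.mono (HaltsWithin.setReal (Q := fun υ'' =>
        υ'' = υ'.setReal 1 (f k) j (τ.real 5 k j)) ?_) (by simp [NExp.cost, RExp.cost, NExp.var]) ?_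
      · simp [NExp.eval, RExp.eval, f2, f3, f1.2 5 (by simp [V]), f1.1 5 (by simp [W]),
          f1.1 15 (by simp [W]), hf]
      · rintro _ rfl
        refine ⟨f2, (f1.setReal (by simp [V]) _ _ _).setNat (by simp [W]) _ _ _,
          by simp [Memory.setNat],
          by simpa [Memory.setNat, Memory.setReal] using f3, fun t ht q hq => ?_, fun q hq => ?_,
            fun x hx q => ?_⟩
        · have : f t ≠ f k := fun h => ht.ne (hinj t (by omega) k hk h)
          simp [Memory.setNat, Memory.setReal, this, f4 t ht q hq]
        · rcases Nat.lt_succ_iff_lt_or_eq.1 hq with hq | rfl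
          · have : q ≠ j := hq.ne
            simp [Memory.setNat, Memory.setReal, this, f5 q hq]
          · simp [Memory.setNat, Memory.setReal]
        · have : x ≠ f k := fun h => hx k (by omega) h.symm
          simp [Memory.setNat, Memory.setReal, this, f6 x hx q]
    · have : (NExp.var 2).cost = 3 := rfl
      rw [this]; omega
    · rintro υ' ⟨f1, -, f3, f4, f5, f6⟩
      refine ⟨f3, f1.setNat (by simp [W]) _ _ _, by simp [Memory.setNat], fun t ht q hq => ?_, f6⟩
      rcases Nat.lt_succ_iff_lt_or_eq.1 ht with ht | rfl
      · exact f4 t ht q hq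
      · exact f5 q hq
  · have : (NExp.var 1).cost = 3 := rfl
    rw [this]
    have : s * (d * 50 + 30 + 3 + 20) ≤ s * (d * 60 + 60) := Nat.mul_le_mul_left _ (by omega)
    omega
  · rintro υ ⟨-, -, g3, g4⟩
    exact ⟨g3, g4⟩

/-- Given a list of candidates, the program finds one with largest sum of eigenvalues and writes
the corresponding eigenvectors, in time proportional to `d * s ^ 2` for each candidate. The
eigenvectors of the best candidate are computed anew, since those computed during the search are
overwritten. -/
theorem exists_haltsWithin_solveListed :
    ∃ K : ℕ, ∀ (E : EigSolver) (s d : ℕ) (τ : Memory), 1 ≤ s → 1 ≤ d → 0 < τ.nat 3 0 0 →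
      τ.nat 1 0 0 = s → τ.nat 2 0 0 = d → τ.real 7 0 0 = 0 → (∀ x y, τ.real 1 x y = 0) →
      (∀ l < τ.nat 3 0 0, 0 ≤ listValue r E (τ.real 0) s d (τ.nat 5 l)) →
      (∀ l < τ.nat 3 0 0, ∀ t < s, ∀ t' < s, τ.nat 5 l t = τ.nat 5 l t' → t = t') →
      HaltsWithin E (solveListed r) τ (K * (τ.nat 3 0 0 * (d * s ^ 2))) fun υ =>
        ∃ l < τ.nat 3 0 0, (∀ l' < τ.nat 3 0 0, listValue r E (τ.real 0) s d (τ.nat 5 l') ≤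
            listValue r E (τ.real 0) s d (τ.nat 5 l)) ∧
          (∀ (t : Fin s) (q : Fin d), υ.real 1 (τ.nat 5 l t) q =
            (E s d (listGram r (τ.real 0) s (τ.nat 5 l))).2 t q) ∧
          ∀ x, (∀ t < s, τ.nat 5 l t ≠ x) → ∀ q, υ.real 1 x q = 0 := by
  set C := (gramEntry r 14).cost with hC
  have hC' : (gramEntry r 15).cost = C := by
    simp only [hC, gramEntry, RExp.sumList]
    induction (List.finRange r) with
    | nil => rfl
    | cons p L ih =>
      simp only [List.map_cons, List.foldr_cons, RExp.cost, NExp.cost, NExp.var] at ih ⊢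
      rw [ih]
  refine ⟨2 * C + 1000, fun E s d τ hs hd hpos h1 h2 h7 h10 hval hinj => ?_⟩
  set L := τ.nat 3 0 0 with hL
  refine ((haltsWithin_searchBest r h1 h2 h7 hval).seq
    (T' := 1 + ((s * (s * (C + 50) + 50) + 50) + d * s ^ 2) + (s * (d * 60 + 60) + 30))
    fun υ hυ => ?_).mono ?_ fun _ h => h
  · obtain ⟨g1, g2⟩ := hυ
    obtain ⟨hl, hmax⟩ := g2 hpos
    set l := υ.nat 15 0 0 with hldef
    have e1 : υ.nat 1 0 0 = s := by rw [g1.1 1 (by simp), h1]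
    have e2 : υ.nat 2 0 0 = d := by rw [g1.1 2 (by simp), h2]
    have e5 : υ.nat 5 = τ.nat 5 := g1.1 5 (by simp)
    have e0 : υ.real 0 = τ.real 0 := g1.2 0 (by simp)
    have hge := haltsWithin_gramEig r (E := E) (Or.inr rfl : (15 : ℕ) = 14 ∨ (15 : ℕ) = 15) e1 e2
    rw [hC', e5, e0, ← hldef] at hge
    refine hge.seq fun υ1 hυ1 => ?_
    obtain ⟨f1, -, f3⟩ := hυ1
    refine (haltsWithin_writeSolution (f := τ.nat 5 l) (by rw [f1.1 1 (by simp), e1])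
      (by rw [f1.1 2 (by simp), e2])
      (by rw [f1.1 5 (by simp), f1.1 15 (by simp), e5]) (hinj l hl)
      (fun x y => by rw [f1.2 1 (by simp), g1.2 1 (by simp)]; exact h10 x y)).mono le_rfl ?_
    rintro υ2 ⟨q1, q2⟩
    exact ⟨l, hl, hmax, fun t q => by rw [q1 t t.2 q q.2, f3], q2⟩
  · set Z := d * s ^ 2 with hZ
    have hsZ : s ^ 2 ≤ Z := Nat.le_mul_of_pos_left _ hd
    have hs1 : s ≤ s ^ 2 := Nat.le_self_pow (by omega) s
    have hdZ : d ≤ Z := Nat.le_mul_of_pos_right _ (by positivity)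
    have hsd : s * d ≤ Z := by rw [hZ, mul_comm]; exact Nat.mul_le_mul_left _ hs1
    have hG : s * (s * (C + 50) + 50) + 50 ≤ (C + 150) * Z := by
      calc s * (s * (C + 50) + 50) + 50 = (C + 50) * s ^ 2 + 50 * s + 50 := by ring
        _ ≤ (C + 50) * Z + 50 * Z + 50 * Z := by gcongr <;> omega
        _ = _ := by ring
    have hT1 : s * (s * (C + 50) + 50) + 50 + Z + d * 60 + 160 ≤ (C + 371) * Z := by
      have : (C + 371) * Z = (C + 150) * Z + Z + 60 * Z + 160 * Z := by ring
      omega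
    have hT3 : s * (d * 60 + 60) + 30 ≤ 150 * Z := by
      have : s * (d * 60 + 60) = 60 * (s * d) + 60 * s := by ring
      omega
    have hLZ : Z ≤ L * Z := Nat.le_mul_of_pos_left _ hpos
    have hA : L * (s * (s * (C + 50) + 50) + 50 + Z + d * 60 + 160) ≤ (C + 371) * (L * Z) := by
      calc _ ≤ L * ((C + 371) * Z) := Nat.mul_le_mul_left _ hT1
        _ = _ := by ring
    have hB : (C + 150) * Z ≤ (C + 150) * (L * Z) := Nat.mul_le_mul_left _ hLZ
    have hfin : (2 * C + 1000) * (L * Z) = (C + 371) * (L * Z) + (C + 150) * (L * Z) + 479 *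
        (L * Z) := by ring
    rw [← hC, ← hL]
    omega

end Solve

/-! ### Quadratic weights as linear functionals -/

/-- The two rows of the matrix whose product is the `k`-th coordinate of the points. The
coordinates are indexed by the unordered pairs of rows, of which there are `(r ^ 2 + r) / 2`. -/
noncomputable def rowPair {r m : ℕ} (ψ : Fin (m + 1) ≃ Sym2 (Fin r)) (k : Fin (m + 1)) : ℕ × ℕ :=
  ((Quot.out (ψ k)).1, (Quot.out (ψ k)).2)

/-- A quadratic form is a linear functional of the products of pairs of entries. -/
theorem exists_coefficients {r m : ℕ} (ψ : Fin (m + 1) ≃ Sym2 (Fin r))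
    (C : Matrix (Fin r) (Fin r) ℝ) : ∃ c : Fin (m + 1) → ℝ, ∀ a : Fin r → ℝ,
      ∑ p, ∑ q, C p q * (a p * a q) =
        ∑ k, c k * (a (Quot.out (ψ k)).1 * a (Quot.out (ψ k)).2) := by
  classical
  let g : Sym2 (Fin r) → ℝ := fun w => ∑ z : Fin r × Fin r with Sym2.mk z.1 z.2 = w, C z.1 z.2
  refine ⟨fun k => g (ψ k), fun a => ?_⟩
  rw [ψ.sum_comp (fun w => g w * (a (Quot.out w).1 * a (Quot.out w).2)), ← Fintype.sum_prod_type',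
    ← Finset.sum_fiberwise _ (fun z : Fin r × Fin r => Sym2.mk z.1 z.2)]
  refine Finset.sum_congr rfl fun w _ => ?_
  simp only [g, Finset.sum_mul]
  refine Finset.sum_congr rfl fun z hz => ?_
  rw [Finset.mem_filter] at hz
  have hw : Sym2.mk (Quot.out w).1 (Quot.out w).2 = w := Quot.out_eq w
  have h := hz.2.trans hw.symm
  rw [Sym2.eq_iff] at h
  rcases h with ⟨h1, h2⟩ | ⟨h1, h2⟩
  · rw [h1, h2]
  · rw [h1, h2, mul_comm (a _)]

theorem exists_equiv_sym2 {r : ℕ} (hr : 1 ≤ r) : ∃ m, (r ^ 2 + r) / 2 = m + 1 ∧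
    Nonempty (Fin (m + 1) ≃ Sym2 (Fin r)) := by
  have hcard : Fintype.card (Sym2 (Fin r)) = (r ^ 2 + r) / 2 := by
    rw [Sym2.card, Fintype.card_fin, Nat.choose_two_right]
    congr 1
    simp; ring
  have hpos : 1 ≤ (r ^ 2 + r) / 2 := by
    rw [Nat.le_div_iff_mul_le (by omega)]; nlinarith
  refine ⟨(r ^ 2 + r) / 2 - 1, by omega, ⟨Fintype.equivOfCardEq ?_⟩⟩
  rw [Fintype.card_fin, hcard]; omega

theorem inputMemory_real {r n : ℕ} (A : Matrix (Fin r) (Fin n) ℝ) (s d a : ℕ)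
    (ha : a ≠ 0) (i j : ℕ) :
    (inputMemory A s d).real a i j = 0 := by
  simp [inputMemory, Memory.setNat, Memory.setMatrix, ha]

theorem inputMemory_real_zero {r n : ℕ} (A : Matrix (Fin r) (Fin n) ℝ) (s d : ℕ)
    (p : Fin r) (i : Fin n) :
    (inputMemory A s d).real 0 p i = A p i := by
  simp [inputMemory, Memory.setNat, Memory.setMatrix]

/-! ### Correctness of the enumeration -/

/-- The memory lists sets of `s` column indices, without repetitions. -/
def ListsSets (n s : ℕ) (τ : Memory) : Prop :=
  ∀ l < τ.nat 3 0 0, τ.nat 4 l 0 = s ∧ (∀ t < s, τ.nat 5 l t < n) ∧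
    ∀ t < s, ∀ t' < s, τ.nat 5 l t = τ.nat 5 l t' → t = t'

/-- The elements of the `l`-th listed set. -/
def ListsSets.element {n s : ℕ} {τ : Memory} (h : ListsSets n s τ) {l : ℕ} (hl : l < τ.nat 3 0 0)
    (t : Fin s) : Fin n := ⟨τ.nat 5 l t, (h l hl).2.1 t t.2⟩

theorem ListsSets.element_injective {n s : ℕ} {τ : Memory} (h : ListsSets n s τ) {l : ℕ}
    (hl : l < τ.nat 3 0 0) : Function.Injective (h.element hl) := fun t t' htt =>
  Fin.ext ((h l hl).2.2 t t.2 t' t'.2 (congrArg Fin.val htt))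

theorem ListsSets.candidate_eq {n s : ℕ} {τ : Memory} (h : ListsSets n s τ) {l : ℕ}
    (hl : l < τ.nat 3 0 0) : τ.candidate n l = Finset.univ.image (h.element hl) := by
  ext i
  simp only [Memory.candidate, (h l hl).1, Finset.mem_filter, Finset.mem_univ, true_and,
    Finset.mem_range,
    Finset.mem_image, ListsSets.element]
  constructor
  · rintro ⟨t, ht, hti⟩
    exact ⟨⟨t, ht⟩, Fin.ext hti⟩
  · rintro ⟨t, ht⟩
    exact ⟨t, t.2, congrArg Fin.val ht⟩

theorem StoresFamily.listsSets {n s : ℕ} {τ : Memory} {F : List (Finset ℕ)} (h : StoresFamily τ F)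
    (hF : ∀ S ∈ F, S.card = s ∧ S ⊆ Finset.range n) : ListsSets n s τ := by
  intro l hl
  have hl' : l < F.length := by rw [← h.1]; exact hl
  obtain ⟨h4, h5⟩ := h.2 l hl'
  obtain ⟨hc, hn⟩ := hF _ (List.getElem_mem hl')
  rw [hc] at h4 h5
  refine ⟨h4, fun t ht => ?_, fun t ht t' ht' htt => ?_⟩
  · have : τ.nat 5 l t ∈ F[l] := h5 ▸ Finset.mem_image_of_mem _ (Finset.mem_range.2 ht)
    exact Finset.mem_range.1 (hn this)
  · have hinj : Set.InjOn (τ.nat 5 l) (Finset.range s) :=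
        Finset.card_image_iff.1 (by rw [h5, hc, Finset.card_range])
    exact hinj (by simpa using ht) (by simpa using ht') htt

/-- The `l`-th candidate, as a set of natural numbers, is the `l`-th set of the list. -/
theorem StoresFamily.map_candidate {n s : ℕ} {τ : Memory} {F : List (Finset ℕ)}
    (h : StoresFamily τ F)
    (hF : ∀ S ∈ F, S.card = s ∧ S ⊆ Finset.range n) {l : ℕ} (hl : l < F.length) :
    (τ.candidate n l).map Fin.valEmbedding = F[l] := by
  obtain ⟨h4, h5⟩ := h.2 l hl
  obtain ⟨hc, hn⟩ := hF _ (List.getElem_mem hl)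
  rw [hc] at h4 h5
  ext x
  conv_rhs => rw [← h5]
  simp only [Finset.mem_map, Fin.valEmbedding_apply, Memory.candidate, h4, Finset.mem_filter,
    Finset.mem_univ, true_and, Finset.mem_image]
  constructor
  · rintro ⟨i, ⟨t, ht, hti⟩, rfl⟩
    exact ⟨t, ht, hti⟩
  · rintro ⟨t, ht, htx⟩
    have hx : x ∈ F[l] := by rw [← h5]; exact Finset.mem_image.2 ⟨t, ht, htx⟩
    exact ⟨⟨x, Finset.mem_range.1 (hn hx)⟩, ⟨t, ht, htx⟩, rfl⟩

/-- For every `d`, one of the listed sets is optimal: by `exists_maximizing_mem` the list contains a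
set of maximal weight for every quadratic weight function. -/
theorem exists_enumeration {r m : ℕ} (ψ : Fin (m + 1) ≃ Sym2 (Fin r)) :
    ∃ K : ℕ, ∀ (E : EigSolver) (n s d₀ : ℕ) (A : Matrix (Fin r) (Fin n) ℝ), 1 ≤ s → s ≤ n →
      HaltsWithin E (enumerate (rowPair ψ)) (inputMemory A s d₀) (K * (n ^ (m + 1) * s)) fun τ =>
        τ.numCandidates ≤ K * n ^ (m + 1) ∧ ListsSets n s τ ∧
        (∀ d, ∃ l < τ.numCandidates, (τ.candidate n l).card = s ∧
          BinaryOptimal A d s (incidence (τ.candidate n l))) ∧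
        (∀ a, a < 3 → τ.nat a = (inputMemory A s d₀).nat a) ∧
        ∀ a, a ≠ 2 → τ.real a = (inputMemory A s d₀).real a := by
  obtain ⟨K, hK⟩ := exists_haltsWithin_enumerate (rowPair ψ)
  refine ⟨K, fun E n s d₀ A hs hsn => ?_⟩
  refine (hK E n s (inputMemory A s d₀) hs hsn (by simp [inputMemory, Memory.setNat])
    (by simp [inputMemory, Memory.setNat]) (by simp [inputMemory, Memory.setNat, Memory.setMatrix])
    (inputMemory_real A s d₀ 2 (by omega) 0 0)).mono le_rfl ?_
  rintro τ ⟨⟨F, hF, hlen, hgood, hall⟩, hnat, hreal⟩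
  refine ⟨hF.1.trans_le hlen, hF.listsSets hgood, fun d => ?_, hnat, hreal⟩
  have key : ∀ C : Matrix (Fin r) (Fin r) ℝ, ∃ S, (∃ l < τ.numCandidates, S = τ.candidate n l) ∧
      S.card = s ∧ ∀ T : Finset (Fin n), T.card = s →
        ∑ i ∈ T, ∑ p, ∑ q, C p q * (A p i * A q i) ≤
          ∑ i ∈ S, ∑ p, ∑ q, C p q * (A p i * A q i) := by
    intro C
    obtain ⟨c, hc⟩ := exists_coefficients ψ C
    set b := quadPoint (rowPair ψ) ((inputMemory A s d₀).real 0) with hb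
    have hweight : ∀ T : Finset (Fin n), ∑ i ∈ T, ∑ p, ∑ q, C p q * (A p i * A q i) =
        ∑ i ∈ T.map Fin.valEmbedding, c ⬝ᵥ b i := by
      intro T
      rw [Finset.sum_map]
      refine Finset.sum_congr rfl fun i _ => ?_
      rw [hc fun p => A p i]
      refine Finset.sum_congr rfl fun k _ => ?_
      simp only [hb, quadPoint, rowPair, Fin.valEmbedding_apply, inputMemory_real_zero]
    obtain ⟨S, hSF, -, hSc, hmax⟩ := exists_maximizing_mem (b := b) hs hsn (F := F)
      (fun I z cl σ j J h1 h2 h3 h4 => hall I _ ⟨z, cl, σ, j, J, h1, h2, h3, rfl, h4⟩) c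
    obtain ⟨l, hl, rfl⟩ := List.getElem_of_mem hSF
    have hmap := hF.map_candidate hgood hl
    refine ⟨τ.candidate n l, ⟨l, by rw [hF.1]; exact hl, rfl⟩, ?_, fun T hT => ?_⟩
    · rw [← Finset.card_map Fin.valEmbedding, hmap, hSc]
    · rw [hweight, hweight, hmap]
      refine hmax _ (fun x hx => ?_) (by rw [Finset.card_map, hT])
      obtain ⟨i, -, rfl⟩ := Finset.mem_map.1 hx
      exact Finset.mem_range.2 i.2
  obtain ⟨S, ⟨l, hl, rfl⟩, hSc, hopt⟩ := exists_binaryOptimal A (d := d) hsn key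
  exact ⟨l, hl, hSc, hopt⟩

/-! ### Correctness of the solver -/

theorem listGram_eq {r n s : ℕ} {A : Matrix (Fin r) (Fin n) ℝ} {a : ℕ → ℕ → ℝ}
    (ha : ∀ (p : Fin r) (i : Fin n), a p i = A p i) (e : Fin s → Fin n) {f : ℕ → ℕ}
    (hf : ∀ t : Fin s, f t = e t) :
    listGram r a s f = (A.submatrix id e)ᵀ * A.submatrix id e := by
  ext i j
  simp [listGram, Matrix.mul_apply, hf, ha]

/-- The enumeration followed by the evaluation of all candidates solves the problem. The computed
sums of eigenvalues are the values of the candidates in the binary problem. -/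
theorem exists_solution {r m : ℕ} (ψ : Fin (m + 1) ≃ Sym2 (Fin r)) :
    ∃ (P : Program) (K : ℕ), ∀ E : EigSolver, E.Correct →
      ∀ (n d s : ℕ) (A : Matrix (Fin r) (Fin n) ℝ), 1 ≤ d → d ≤ s → s ≤ n →
        HaltsWithin E P (inputMemory A s d) (K * (n ^ (m + 1) * (d * s ^ 2)))
          fun τ => SPCAOptimal A s (τ.matrix 1 n d) := by
  obtain ⟨K, hK⟩ := exists_enumeration ψ
  obtain ⟨K', hK'⟩ := exists_haltsWithin_solveListed r
  refine ⟨.seq (enumerate (rowPair ψ)) (solveListed r), 1 + K + K' * K,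
    fun E hE n d s A hd hds hsn => ?_⟩
  have hs : 1 ≤ s := hd.trans hds
  have hn : 1 ≤ n := hs.trans hsn
  refine ((hK E n s d A hs hsn).seq (T' := K' * (K * n ^ (m + 1) * (d * s ^ 2))) ?_).mono
    ?_ fun _ h => h
  · rintro τ ⟨hnum, hsets, hopt, hnat, hreal⟩
    have ha : ∀ (p : Fin r) (i : Fin n), τ.real 0 p i = A p i := fun p i => by
      rw [hreal 0 (by omega), inputMemory_real_zero]
    have hherm : ∀ e : Fin s → Fin n,
        ((A.submatrix id e)ᵀ * A.submatrix id e).IsHermitian := fun e => by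
      simpa using isHermitian_mul_transpose (A.submatrix id e)ᵀ
    have hvalue : ∀ l (hl : l < τ.nat 3 0 0), listValue r E (τ.real 0) s d (τ.nat 5 l) =
        binaryObjective A d (incidence (τ.candidate n l)) := by
      intro l hl
      rw [hsets.candidate_eq hl, ← kyFan_gram_submatrix A (hsets.element_injective hl) d (hherm _),
        kyFan_eq_sum_castLE _ hds, listValue, listGram_eq ha (hsets.element hl) (fun _ => rfl)]
      exact Finset.sum_congr rfl fun j _ => (hE s d _ (hherm _) hds).1 j
    have hnonneg : ∀ l < τ.nat 3 0 0, 0 ≤ listValue r E (τ.real 0) s d (τ.nat 5 l) := by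
      intro l hl
      rw [listValue, listGram_eq ha (hsets.element hl) (fun _ => rfl)]
      refine Finset.sum_nonneg fun j _ => ?_
      rw [(hE s d _ (hherm _) hds).1 j]
      have := eigenvalues₀_mul_transpose_nonneg (A.submatrix id (hsets.element hl))ᵀ
        (by rw [Matrix.transpose_transpose]; exact hherm _)
        ⟨j, lt_of_lt_of_le j.2 (hds.trans_eq (Fintype.card_fin s).symm)⟩
      simpa using this
    obtain ⟨l0, hl0, -, hopt0⟩ := hopt d
    have hpos : 0 < τ.nat 3 0 0 := lt_of_le_of_lt (Nat.zero_le _) hl0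
    refine (hK' E s d τ hs hd hpos (by rw [hnat 1 (by omega)]; simp [inputMemory, Memory.setNat])
      (by rw [hnat 2 (by omega)]; simp [inputMemory, Memory.setNat])
      (by rw [hreal 7 (by omega), inputMemory_real A s d 7 (by omega)])
      (fun x y => by rw [hreal 1 (by omega), inputMemory_real A s d 1 (by omega)]) hnonneg
      (fun l hl => (hsets l hl).2.2)).mono ?_ ?_
    · gcongr
      exact hnum
    · rintro υ ⟨l, hl, hmax, hU, hzero⟩
      set e := hsets.element hl with he
      have hinj := hsets.element_injective hl
      have hG : listGram r (τ.real 0) s (τ.nat 5 l) = (A.submatrix id e)ᵀ * A.submatrix id e :=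
        listGram_eq ha e fun _ => rfl
      obtain ⟨hlam, hV, hXV⟩ := hE s d _ (hherm e) hds
      set V := (E s d ((A.submatrix id e)ᵀ * A.submatrix id e)).2 with hVdef
      have hbest : BinaryOptimal A d s (incidence (Finset.univ.image e)) := by
        refine ⟨incidence_mem_binaryFeasible (Finset.card_image_le.trans (by simp)), fun y hy => ?_⟩
        have h1 := hmax l0 hl0
        rw [hvalue l0 hl0, hvalue l hl, hsets.candidate_eq hl] at h1
        exact (hopt0.2 y hy).trans h1
      have hmat : υ.matrix 1 n d = spreadRows e V := by
        ext x q
        simp only [Memory.matrix, spreadRows, Matrix.of_apply]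
        by_cases hx : ∃ t, e t = x
        · obtain ⟨t, rfl⟩ := hx
          rw [Finset.sum_eq_single t (fun t' _ ht' => if_neg fun h => ht' (hinj h))
            (by simp), if_pos rfl]
          have := hU t q
          rw [hG] at this
          exact this
        · push Not at hx
          rw [Finset.sum_eq_zero fun t _ => if_neg (hx t)]
          exact hzero x (fun t ht h => hx ⟨t, ht⟩ (Fin.ext h)) q
      rw [hmat]
      refine (spcaOptimal_spreadRows A hds hinj hbest hV (hherm e) ?_).1
      rw [hXV, funext hlam]
  · have h1 : n ^ (m + 1) * s ≤ n ^ (m + 1) * (d * s ^ 2) := by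
      refine Nat.mul_le_mul_left _ ?_
      calc s = 1 * s ^ 1 := by ring
        _ ≤ d * s ^ 2 := by gcongr; omega
    have h2 : 1 ≤ n ^ (m + 1) * (d * s ^ 2) := Nat.mul_pos (by positivity) (by positivity)
    have h3 : K * (n ^ (m + 1) * s) ≤ K * (n ^ (m + 1) * (d * s ^ 2)) := Nat.mul_le_mul_left _ h1
    have h4 : (1 + K + K' * K) * (n ^ (m + 1) * (d * s ^ 2)) = n ^ (m + 1) * (d * s ^ 2) +
      K * (n ^ (m + 1) * (d * s ^ 2)) + K' * (K * n ^ (m + 1) * (d * s ^ 2)) := by ring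
    omega

theorem mainTheorem9 (r : ℕ) (hr : 1 ≤ r) :
    -- the binary reformulation has the same optimal value
    (∀ (n d s : ℕ) (A : Matrix (Fin r) (Fin n) ℝ), (Aᵀ * A).rank = r →
      1 ≤ d → d ≤ s → s ≤ n →
      ∃ v : ℝ,
        IsGreatest {z | ∃ U : Matrix (Fin n) (Fin d) ℝ, SPCAFeasible d s U ∧
          spcaObjective A U = z} v ∧
        IsGreatest {z | ∃ x ∈ binaryFeasible n s, binaryObjective A d x = z} v) ∧
    -- enumeration of the candidate supports, by arithmetic only and without knowing `d`
    (∃ (P : Program) (K : ℕ), P.EigFree ∧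
      ∀ (E : EigSolver) (n s : ℕ) (A : Matrix (Fin r) (Fin n) ℝ), (Aᵀ * A).rank = r →
        1 ≤ s → s ≤ n →
        ∃ (t : ℕ) (σ : Memory), Exec E P (inputMemory A s 0) t σ ∧
          t ≤ K * (n ^ ((r ^ 2 + r) / 2) * s ^ 2) ∧
          σ.numCandidates ≤ K * n ^ ((r ^ 2 + r) / 2) ∧
          ∀ d : ℕ, 1 ≤ d → d ≤ s → ∃ l < σ.numCandidates,
            SPCAOptimalSupport A d s (σ.candidate n l) ∧
            BinaryOptimal A d s (incidence (σ.candidate n l))) ∧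
    -- computation of an optimal solution, left in real array `1`
    (∃ (P : Program) (K : ℕ), ∀ E : EigSolver, E.Correct →
      ∀ (n d s : ℕ) (A : Matrix (Fin r) (Fin n) ℝ), (Aᵀ * A).rank = r →
        1 ≤ d → d ≤ s → s ≤ n →
        ∃ (t : ℕ) (σ : Memory), Exec E P (inputMemory A s d) t σ ∧
          t ≤ K * (n ^ ((r ^ 2 + r) / 2) * (d * s ^ 2)) ∧
          SPCAOptimal A s (σ.matrix 1 n d)) := by
  obtain ⟨m, hm, ⟨ψ⟩⟩ := exists_equiv_sym2 hr
  refine ⟨fun n d s A _ hd hds hsn => ?_, ?_, ?_⟩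
  · obtain ⟨S, -, hSc, hopt⟩ := exists_binaryOptimal A (d := d) hsn (F := fun _ => True) fun C => by
      obtain ⟨S, hS, hmax⟩ := Finset.exists_max_image
        ((Finset.univ : Finset (Fin n)).powersetCard s)
        (fun S => ∑ i ∈ S, ∑ p, ∑ q, C p q * (A p i * A q i))
        (Finset.powersetCard_nonempty.2 (by simpa using hsn))
      exact ⟨S, trivial, (Finset.mem_powersetCard.1 hS).2, fun T hT =>
        hmax T (Finset.mem_powersetCard.2 ⟨Finset.subset_univ _, hT⟩)⟩
    obtain ⟨U, hU, -, hobj⟩ := exists_spcaOptimal A hds hSc hopt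
    refine ⟨binaryObjective A d (incidence S), ⟨⟨U, hU.1, hobj⟩, ?_⟩, ⟨⟨_, hopt.1, rfl⟩, ?_⟩⟩
    · rintro _ ⟨V, hV, rfl⟩
      rw [← hobj]
      exact hU.2 V hV
    · rintro _ ⟨y, hy, rfl⟩
      exact hopt.2 y hy
  · obtain ⟨K, hK⟩ := exists_enumeration ψ
    refine ⟨enumerate (rowPair ψ), K, eigFree_enumerate _, fun E n s A _ hs hsn => ?_⟩
    obtain ⟨t, σ, hexec, ht, hnum, -, hopt, -⟩ := hK E n s 0 A hs hsn
    rw [hm]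
    refine ⟨t, σ, hexec, ht.trans ?_, hnum, fun d hd hds => ?_⟩
    · gcongr
      exact Nat.le_self_pow (by omega) s
    · obtain ⟨l, hl, hc, hbin⟩ := hopt d
      obtain ⟨U, hU, hsup, -⟩ := exists_spcaOptimal A hds hc hbin
      exact ⟨l, hl, ⟨hc.le, U, hU, hsup⟩, hbin⟩
  · obtain ⟨P, K, hP⟩ := exists_solution ψ
    refine ⟨P, K, fun E hE n d s A _ hd hds hsn => ?_⟩
    obtain ⟨t, σ, hexec, ht, hopt⟩ := hP E hE n d s A hd hds hsn
    rw [hm]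
    exact ⟨t, σ, hexec, ht, hopt⟩
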